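/- Let $\mu>0$, $2\mu+\lambda>0$, $\kappa>0$, $\mathcal L=\mu\Delta+(\lambda+\mu)\nabla\operatorname{div}$ on $\mathbb R^3$, $\hat f(\xi)=\int e^{-ix\cdot\xi}f(x)\,dx$. Let $\phi_0\in\mathcal S(\mathbb R^3)$ with $\operatorname{supp}\hat\phi_0\subset\{1/2\le|\xi|\le2\}$, $\phi_j(x)=2^{3j}\phi_0(2^jx)$ and $\sum_{j\in\mathbb Z}\hat\phi_j(\xi)=1$ for $\xi\ne0$. Let $\chi\in C_0^\infty(\mathbb R^3)$ with $\operatorname{supp}\chi\subset[0,2)^3$, $\sum_{k\in\mathbb Z^3}\chi(\xi-k)=1$ for all $\xi$, and $\|f\|_{M_{3,1}}=\sum_{k\in\mathbb Z^3}\|\mathcal F^{-1}[\chi(\cdot-k)\hat f\,]\|_{L^3}$. For $0<\delta<1$ and an integer $N\ge2$ put $R=(\log N)^{-1}$, $e_1=(1,0,0)$ and $u_{0,N}=(u_{0,N,1},0,0)$ with $$u_{0,N,1}(x)=RN^{-1/3}\sum_{-\delta N\le j\le0}2^{-2j}\phi_j(x-2^{|j|+2N}e_1)\sin(2^Nx_1).$$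 Define $(P_k,U_k,\Theta_k)_{k\ge0}$ (the expansion, for the initial data $(0,u_{0,N},0)$, of the full compressible Navier–Stokes system of an ideal gas with density $1+\rho$, velocity $u$, temperature $\theta$) by $P_0=0$, $U_0=0$, $\Theta_0=\Theta_1=0$, $U_1(t)=e^{t\mathcal L}u_{0,N}$, $P_1(t)=-\int_0^t\operatorname{div}U_1\,ds$ and, for $k\ge2$, $$\Theta_k(t)=\int_0^te^{(t-s)\kappa\Delta}\Big\{-\sum(U_{k_1}\!\cdot\nabla)\Theta_{k_2}-\sum P_{k_3}(U_{k_1}\!\cdot\nabla)\Theta_{k_2}-\sum\Theta_{k_1}\operatorname{div}U_{k_2}-\sum P_{k_3}\Theta_{k_1}\operatorname{div}U_{k_2}-\sum P_{k_1}\partial_t\Theta_{k_2}+\sum\tilde D(U_{k_1}):\tilde D(U_{k_2})\Big\}ds,$$ $$U_k(t)=\int_0^te^{(t-s)\mathcal L}\Big\{-\sum(U_{k_1}\!\cdot\nabla)U_{k_2}-\sum P_{k_3}(U_{k_1}\!\cdot\nabla)U_{k_2}-\nabla\Big(\Theta_k+\sum P_{k_1}\Theta_{k_2}\Big)-\sum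 P_{k_1}\partial_tU_{k_2}\Big\}ds,$$ $$P_k(t)=-\int_0^t\Big(\operatorname{div}U_k+\sum\operatorname{div}(P_{k_1}U_{k_2})\Big)ds,$$ the functions in the integrands being taken at time $s$. The sums run over $k_1,k_2\ge1$ with $k_1+k_2=k$, respectively over $k_1,k_2\ge1$, $k_3\ge0$ with $k_1+k_2+k_3=k$ and $k_1\le k-1$. Here $\tilde D(u):\tilde D(v)=2\mu\operatorname{tr}(D(u)D(v)^T)+\lambda\operatorname{div}u\operatorname{div}v$ and $D(u)=\frac12(\nabla u+(\nabla u)^T)$. Then there exist constants $C_0,c_1,c_2,\varepsilon_0>0$, depending only on $\mu,\lambda,\kappa,\phi_0,\chi$, such that for all $\delta\in(0,1)$, all $N\ge2$ and all $0<t\le\varepsilon_02^{-2N}$ the following hold. All $P_k(t),U_k(t),\Theta_k(t)$ are Schwartz functions of $x$, and they are pointwise differentiable in time with time derivatives that are Schwartz functions of $x$. 1. For every $k\ge1$, $$(t2^N)^{-1}\|P_k(t)\|_{M_{3,1}}+\|U_k(t)\|_{M_{3,1}}+2^{-N}\|\Theta_k(t)\|_{M_{3,1}}\le C_0^kt^{k-1}2^{(k-1)N}R^k.$$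 2. Consequently the expansion converges absolutely in $M_{3,1}$: writing $S_k(t)$ for the left-hand side above, $\sum_{k}S_k(t)<\infty$, and $\sum_{k\ge3}S_k(t)\le2C_0^3t^22^{2N}R^3$. 3. For every $k\ge1$, $$\|P_k(t)\|_{M_{3,1}}\le c_1^{k-1}c_2^kt^k2^{kN}R^k(1+k)^{-4},$$ $$\|U_k(t)\|_{M_{3,1}}+\|\partial_tU_k\|_{L^1(0,t;M_{3,1})}+\|\mathcal LU_k\|_{L^1(0,t;M_{3,1})}\le c_1^{k-1}c_2^{\max(k-1,1)}t^{k-1}2^{(k-1)N}R^k(1+k)^{-4},$$ $$\|\Theta_k(t)\|_{M_{3,1}}+\|\partial_t\Theta_k\|_{L^1(0,t;M_{3,1})}+\|\kappa\Delta\Theta_k\|_{L^1(0,t;M_{3,1})}\le c_1^{k-1}c_2^kt^{k-1}2^{kN}R^k(1+k)^{-4}.$$ -/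

import Mathlib

open MeasureTheory
open scoped ENNReal SchwartzMap FourierTransform ContDiff

noncomputable section

namespace IdealGas

/-- Physical space. -/
abbrev R3 := EuclideanSpace ℝ (Fin 3)

/-- Values of vector fields (complex scalars; real fields are a special case, and all
products below are bilinear, without conjugation). -/
abbrev C3 := EuclideanSpace ℂ (Fin 3)

/-- The coordinate vector `e_i`. -/
def e (i : Fin 3) : R3 := EuclideanSpace.single i 1

/-! ### Fourier transform and the function space -/

section Fourier

variable {F : Type*} [NormedAddCommGroup F] [NormedSpace ℂ F]

/-- The Fourier transform in angular frequency, `∫ exp (-i x·ξ) f(x) dx`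
(Mathlib's `𝓕` uses `exp (-2π i x·ξ)`). -/
def fourierAng (f : R3 → F) (ξ : R3) : F := 𝓕 f ((2 * Real.pi)⁻¹ • ξ)

/-- Its inverse, `(2π)⁻³ ∫ exp (i x·ξ) g(ξ) dξ`. -/
def fourierAngInv (g : R3 → F) (x : R3) : F := 𝓕⁻ (fun η : R3 => g ((2 * Real.pi) • η)) x

/-- The lattice point `k ∈ ℤ³` as a point of `ℝ³`. -/
def latticePoint (k : Fin 3 → ℤ) : R3 := WithLp.toLp 2 (fun i => (k i : ℝ))

/-- Admissible windows for the modulation space: `χ ∈ C₀^∞(ℝ³)`, `supp χ ⊆ [0,2)³`, and the integer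
translates of `χ` sum to one. -/
structure IsModulationWindow (χ : R3 → ℂ) : Prop where
  smooth : ContDiff ℝ ∞ χ
  compact : HasCompactSupport χ
  supp : tsupport χ ⊆ {ξ | ∀ i, ξ i ∈ Set.Ico (0 : ℝ) 2}
  sum_eq : ∀ ξ, HasSum (fun k : Fin 3 → ℤ => χ (ξ - latticePoint k)) 1

/-- The norm of `M_{3,1}(ℝ³)`: `∑_{k ∈ ℤ³} ‖𝓕⁻¹[χ(· - k) 𝓕 f]‖_{L³}`, in `[0,∞]`. -/
def modNorm (χ : R3 → ℂ) (f : R3 → F) : ℝ≥0∞ :=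
  ∑' k : Fin 3 → ℤ,
    eLpNorm (fourierAngInv (fun ξ => χ (ξ - latticePoint k) • fourierAng f ξ)) 3 volume

/-- The partial derivative `∂_i f`. -/
def pd (i : Fin 3) (f : R3 → F) (x : R3) : F := fderiv ℝ f x (e i)

/-- `(u · ∇) f`. -/
def advect (u : R3 → C3) (f : R3 → F) (x : R3) : F := ∑ i, u x i • pd i f x

/-- The time derivative of a function of time and space. -/
def timeDeriv (f : ℝ → R3 → F) (t : ℝ) (x : R3) : F := deriv (fun s => f s x) t

/-- At time `t` the function `f` is a Schwartz function of space, and it is differentiable in time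
at every point, the time derivative being a Schwartz function of space. -/
def IsRegularAt (f : ℝ → R3 → F) (t : ℝ) : Prop :=
  ∃ g h : 𝓢(R3, F), f t = g ∧ ∀ x, HasDerivAt (fun s => f s x) (h x) t

end Fourier

/-! ### Differential operators -/

/-- `∇ f`. -/
def grad (f : R3 → ℂ) (x : R3) : C3 := WithLp.toLp 2 (fun i => pd i f x)

/-- `div u`. -/
def dvg (u : R3 → C3) (x : R3) : ℂ := ∑ i, pd i (fun y => u y i) x

/-- The deformation tensor `D(u) = (∇u + (∇u)ᵀ)/2`. -/
def deform (u : R3 → C3) (x : R3) : Matrix (Fin 3) (Fin 3) ℂ :=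
  Matrix.of fun i j => (pd i (fun y => u y j) x + pd j (fun y => u y i) x) / 2

/-- `2μ tr(D(u) D(v)ᵀ) + λ div u div v`. -/
def dissip (μ lam : ℝ) (u v : R3 → C3) (x : R3) : ℂ :=
  2 * (μ : ℂ) * (deform u x * (deform v x).transpose).trace + (lam : ℂ) * (dvg u x * dvg v x)

/-- The Lamé operator `𝓛 u = μ Δ u + (λ + μ) ∇ div u`. -/
def lame (μ lam : ℝ) (u : R3 → C3) (x : R3) : C3 :=
  (μ : ℂ) • Laplacian.laplacian u x + ((lam + μ : ℝ) : ℂ) • grad (dvg u) x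

/-! ### Semigroups -/

/-- `e^{tκΔ}`: the Fourier multiplier `exp (-tκ|ξ|²)`. -/
def heatSg (κ t : ℝ) (f : R3 → ℂ) : R3 → ℂ :=
  fourierAngInv fun ξ => (Real.exp (-(t * κ * ‖ξ‖ ^ 2)) : ℂ) • fourierAng f ξ

/-- `ξ · v` for a real `ξ` and a complex `v`. -/
def rdot (ξ : R3) (v : C3) : ℂ := ∑ i, (ξ i : ℂ) * v i

/-- A real vector as a complex one. -/
def toC3 (ξ : R3) : C3 := WithLp.toLp 2 (fun i => (ξ i : ℂ))

/-- The orthogonal projection of `v` to the line through `ξ` (zero for `ξ = 0`). -/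
def longitudinal (ξ : R3) (v : C3) : C3 := (rdot ξ v / ((‖ξ‖ ^ 2 : ℝ) : ℂ)) • toC3 ξ

/-- The symbol of `e^{t𝓛}`, that is `exp (-t (μ|ξ|² + (λ+μ) ξ ⊗ ξ))` applied to `v`: the matrix
`μ|ξ|² + (λ+μ) ξ ⊗ ξ` has eigenvalue `(2μ+λ)|ξ|²` along `ξ` and `μ|ξ|²` across. -/
def lameSymbol (μ lam t : ℝ) (ξ : R3) (v : C3) : C3 :=
  (Real.exp (-(t * μ * ‖ξ‖ ^ 2)) : ℂ) • (v - longitudinal ξ v) +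
    (Real.exp (-(t * (2 * μ + lam) * ‖ξ‖ ^ 2)) : ℂ) • longitudinal ξ v

/-- `e^{t𝓛}`. -/
def lameSg (μ lam t : ℝ) (u : R3 → C3) : R3 → C3 :=
  fourierAngInv fun ξ => lameSymbol μ lam t ξ (fourierAng u ξ)

/-! ### The power series expansion -/

/-- One triple `(P_k, U_k, Θ_k)` of functions of time and space. -/
structure Terms where
  /-- density -/
  P : ℝ → R3 → ℂ
  /-- velocity -/
  U : ℝ → R3 → C3
  /-- temperature -/
  Th : ℝ → R3 → ℂ

/-- The source in the equation for `Θ_k`, built from the terms of index below `k`. -/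
def thetaSource (μ lam : ℝ) (a : ℕ → Terms) (k : ℕ) (s : ℝ) (x : R3) : ℂ :=
  - (∑ i ∈ Finset.Icc 1 (k - 1), advect ((a i).U s) ((a (k - i)).Th s) x)
  - (∑ i ∈ Finset.Icc 1 (k - 1), ∑ j ∈ Finset.Icc 1 (k - i),
      (a (k - (i + j))).P s x * advect ((a i).U s) ((a j).Th s) x)
  - ((∑ i ∈ Finset.Icc 1 (k - 1), (a i).Th s x * dvg ((a (k - i)).U s) x)
    + ∑ i ∈ Finset.Icc 1 (k - 1), ∑ j ∈ Finset.Icc 1 (k - i),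
      (a (k - (i + j))).P s x * (a i).Th s x * dvg ((a j).U s) x)
  - (∑ i ∈ Finset.Icc 1 (k - 1), (a i).P s x * timeDeriv (a (k - i)).Th s x)
  + ∑ i ∈ Finset.Icc 1 (k - 1), dissip μ lam ((a i).U s) ((a (k - i)).U s) x

/-- The source in the equation for `U_k`, built from `Θ_k` and the terms of index below `k`. -/
def velocitySource (a : ℕ → Terms) (Thk : ℝ → R3 → ℂ) (k : ℕ) (s : ℝ) (x : R3) : C3 :=
  - (∑ i ∈ Finset.Icc 1 (k - 1), advect ((a i).U s) ((a (k - i)).U s) x)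
  - (∑ i ∈ Finset.Icc 1 (k - 1), ∑ j ∈ Finset.Icc 1 (k - i),
      (a (k - (i + j))).P s x • advect ((a i).U s) ((a j).U s) x)
  - grad (fun y => Thk s y + ∑ i ∈ Finset.Icc 1 (k - 1), (a i).P s y * (a (k - i)).Th s y) x
  - ∑ i ∈ Finset.Icc 1 (k - 1), (a i).P s x • timeDeriv (a (k - i)).U s x

/-- The source in the equation for `P_k`, built from `U_k` and the terms of index below `k`. -/
def densitySource (a : ℕ → Terms) (Uk : ℝ → R3 → C3) (k : ℕ) (s : ℝ) (x : R3) : ℂ :=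
  dvg (Uk s) x + ∑ i ∈ Finset.Icc 1 (k - 1), dvg (fun y => (a i).P s y • (a (k - i)).U s y) x

/-- `Θ_k` from the terms of index below `k`. -/
def nextTh (μ lam κ : ℝ) (a : ℕ → Terms) (k : ℕ) (t : ℝ) (x : R3) : ℂ :=
  ∫ s in (0 : ℝ)..t, heatSg κ (t - s) (thetaSource μ lam a k s) x

/-- `U_k` from `Θ_k` and the terms of index below `k`. -/
def nextU (μ lam : ℝ) (a : ℕ → Terms) (Thk : ℝ → R3 → ℂ) (k : ℕ) (t : ℝ) (x : R3) : C3 :=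
  ∫ s in (0 : ℝ)..t, lameSg μ lam (t - s) (velocitySource a Thk k s) x

/-- `P_k` from `U_k` and the terms of index below `k`. -/
def nextP (a : ℕ → Terms) (Uk : ℝ → R3 → C3) (k : ℕ) (t : ℝ) (x : R3) : ℂ :=
  - ∫ s in (0 : ℝ)..t, densitySource a Uk k s x

/-- The triple of index `k ≥ 2` from those of smaller index. -/
def nextTerms (μ lam κ : ℝ) (a : ℕ → Terms) (k : ℕ) : Terms where
  Th := nextTh μ lam κ a k
  U := nextU μ lam a (nextTh μ lam κ a k) k
  P := nextP a (nextU μ lam a (nextTh μ lam κ a k) k) k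

/-- The terms `(P_k, U_k, Θ_k)` of the expansion with initial data `(0, u₀, 0)`. -/
def expansion (μ lam κ : ℝ) (u₀ : R3 → C3) : ℕ → Terms
  | 0 => ⟨fun _ _ => 0, fun _ _ => 0, fun _ _ => 0⟩
  | 1 => ⟨fun t x => - ∫ s in (0 : ℝ)..t, dvg (lameSg μ lam s u₀) x,
      fun t => lameSg μ lam t u₀, fun _ _ => 0⟩
  | k + 2 => nextTerms μ lam κ
      (fun i => if _h : i < k + 2 then expansion μ lam κ u₀ i
        else ⟨fun _ _ => 0, fun _ _ => 0, fun _ _ => 0⟩) (k + 2)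
termination_by k => k

theorem nextTerms_congr (μ lam κ : ℝ) (a b : ℕ → Terms) (k : ℕ) (hk : 1 ≤ k)
    (h : ∀ i < k, a i = b i) : nextTerms μ lam κ a k = nextTerms μ lam κ b k := by
  have h1 : ∀ i ∈ Finset.Icc 1 (k - 1), a i = b i := fun i hi => by
    rw [Finset.mem_Icc] at hi; exact h i (by omega)
  have h2 : ∀ i ∈ Finset.Icc 1 (k - 1), a (k - i) = b (k - i) := fun i hi => by
    rw [Finset.mem_Icc] at hi; exact h _ (by omega)
  have h3 : ∀ i ∈ Finset.Icc 1 (k - 1), ∀ j ∈ Finset.Icc 1 (k - i), a j = b j :=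
    fun i hi j hj => by
      rw [Finset.mem_Icc] at hi hj; exact h _ (by omega)
  have h4 : ∀ i ∈ Finset.Icc 1 (k - 1), ∀ j ∈ Finset.Icc 1 (k - i),
      a (k - (i + j)) = b (k - (i + j)) := fun i hi j hj => by
    rw [Finset.mem_Icc] at hi hj; exact h _ (by omega)
  have hT : thetaSource μ lam a k = thetaSource μ lam b k := by
    funext s x
    unfold thetaSource
    congr 1
    · congr 1
      · congr 1
        · congr 1
          · exact congrArg _ (Finset.sum_congr rfl fun i hi => by rw [h1 i hi, h2 i hi])
          · exact Finset.sum_congr rfl fun i hi => Finset.sum_congr rfl fun j hj => by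
              rw [h1 i hi, h3 i hi j hj, h4 i hi j hj]
        · congr 1
          · exact Finset.sum_congr rfl fun i hi => by rw [h1 i hi, h2 i hi]
          · exact Finset.sum_congr rfl fun i hi => Finset.sum_congr rfl fun j hj => by
              rw [h1 i hi, h3 i hi j hj, h4 i hi j hj]
      · exact Finset.sum_congr rfl fun i hi => by rw [h1 i hi, h2 i hi]
    · exact Finset.sum_congr rfl fun i hi => by rw [h1 i hi, h2 i hi]
  have hV : ∀ Z, velocitySource a Z k = velocitySource b Z k := by
    intro Z
    funext s x
    unfold velocitySource
    congr 1
    · congr 1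
      · congr 1
        · exact congrArg _ (Finset.sum_congr rfl fun i hi => by rw [h1 i hi, h2 i hi])
        · exact Finset.sum_congr rfl fun i hi => Finset.sum_congr rfl fun j hj => by
            rw [h1 i hi, h3 i hi j hj, h4 i hi j hj]
      · congr 1
        funext y
        congr 1
        exact Finset.sum_congr rfl fun i hi => by rw [h1 i hi, h2 i hi]
    · exact Finset.sum_congr rfl fun i hi => by rw [h1 i hi, h2 i hi]
  have hD : ∀ Z, densitySource a Z k = densitySource b Z k := by
    intro Z
    funext s x
    unfold densitySource
    congr 1
    exact Finset.sum_congr rfl fun i hi => by rw [h1 i hi, h2 i hi]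
  have hTh : nextTh μ lam κ a k = nextTh μ lam κ b k := by
    unfold nextTh; rw [hT]
  have hU : ∀ Z, nextU μ lam a Z k = nextU μ lam b Z k := by
    intro Z; unfold nextU; rw [hV]
  have hP : ∀ Z, nextP a Z k = nextP b Z k := by
    intro Z; unfold nextP; rw [hD]
  unfold nextTerms
  rw [hTh, hU, hP]

/-- The recursion for `k ≥ 2`. -/
theorem expansion_eq (μ lam κ : ℝ) (u₀ : R3 → C3) (k : ℕ) (hk : 2 ≤ k) :
    expansion μ lam κ u₀ k = nextTerms μ lam κ (expansion μ lam κ u₀) k := by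
  obtain ⟨m, rfl⟩ : ∃ m, k = m + 2 := ⟨k - 2, by omega⟩
  rw [expansion]
  refine nextTerms_congr _ _ _ _ _ _ (by omega) fun i hi => ?_
  simp [hi]

/-! ### The initial data -/

/-- `φ_j(x) = 2^{3j} φ₀(2^j x)`. -/
def dyadic (φ₀ : 𝓢(R3, ℂ)) (j : ℤ) (x : R3) : ℂ :=
  (((2 : ℝ) ^ (3 * j) : ℝ) : ℂ) * φ₀ ((2 : ℝ) ^ j • x)

/-- `φ₀` generates a homogeneous Littlewood–Paley decomposition of unity. -/
structure IsLittlewoodPaley (φ₀ : 𝓢(R3, ℂ)) : Prop where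
  supp : Function.support (fourierAng φ₀) ⊆ {ξ | 1 / 2 ≤ ‖ξ‖ ∧ ‖ξ‖ ≤ 2}
  sum_eq : ∀ ξ : R3, ξ ≠ 0 → HasSum (fun j : ℤ => fourierAng (dyadic φ₀ j) ξ) 1

/-- `R = (log N)⁻¹`. -/
def amp (N : ℕ) : ℝ := (Real.log N)⁻¹

/-- `u_{0,N,1}(x) =
R N^{-1/3} ∑_{-δN ≤ j ≤ 0} 2^{-2j} φ_j(x - 2^{|j|+2N} e₁) sin(2^N x₁)`. -/
def initialFirst (φ₀ : 𝓢(R3, ℂ)) (δ : ℝ) (N : ℕ) (x : R3) : ℂ :=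
  ((amp N * (N : ℝ) ^ (-(1 / 3) : ℝ) : ℝ) : ℂ) *
    ∑ j ∈ Finset.Icc ⌈-(δ * N)⌉ (0 : ℤ),
      (((2 : ℝ) ^ (-2 * j) : ℝ) : ℂ) * dyadic φ₀ j (x - (2 : ℝ) ^ (|j| + 2 * (N : ℤ)) • e 0) *
        ((Real.sin (2 ^ N * x 0) : ℝ) : ℂ)

/-- `u_{0,N} = (u_{0,N,1}, 0, 0)`. -/
def initialVelocity (φ₀ : 𝓢(R3, ℂ)) (δ : ℝ) (N : ℕ) (x : R3) : C3 :=
  EuclideanSpace.single 0 (initialFirst φ₀ δ N x)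

/-- `(t 2^N)⁻¹ ‖P(t)‖ + ‖U(t)‖ + 2^{-N} ‖Θ(t)‖`, all norms in `M_{3,1}`. -/
def termSize (χ : R3 → ℂ) (N : ℕ) (t : ℝ) (a : Terms) : ℝ≥0∞ :=
  ENNReal.ofReal ((t * 2 ^ N)⁻¹) * modNorm χ (a.P t) + modNorm χ (a.U t)
    + ENNReal.ofReal ((2 ^ N)⁻¹) * modNorm χ (a.Th t)

/-- The norm of `f` in `L¹(0,t; M_{3,1})`. -/
def modNormL1 {F : Type*} [NormedAddCommGroup F] [NormedSpace ℂ F]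
    (χ : R3 → ℂ) (t : ℝ) (f : ℝ → R3 → F) : ℝ≥0∞ :=
  ∫⁻ s in Set.Ioo 0 t, modNorm χ (f s)

end IdealGas

end

/-! Put `Λ = 2^N`. The data has spectrum in the ball of radius `Λ`, and products add spectral radii.
The terms of index `k` are therefore band-limited to radius `k Λ` and smooth in time (`IsBand`).
This gives the Schwartz regularity and justifies every exchange of integrals; it also makes a
derivative of a term of index `k` cost only a factor `k Λ`.

Three facts about `M_{3,1}` carry the estimates, all proved on unit frequency boxes with constants
independent of the box. The space is an algebra, because Bernstein bounds each box in `L^∞` by its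
`L³` norm (`IsBand.modNorm_bilin_le`). A derivative costs the bandwidth (`IsBand.modNorm_pd_le`).
The heat and Lamé equations have maximal regularity in `L¹(0,T; M_{3,1})` for `T ≤ 1`
(`IsBand.maximal_regularity`): on the box at `k` the symbol is frozen at `k`, the remainder has
order `1 + |k|`, and parabolic damping of rate `c |k|²` absorbs it. The endpoint `L¹` in time is
reached because the norm is an `ℓ¹` sum over boxes.

The data has norm at most a constant times `R` (`modNorm_initialVelocity_le`). Its dyadic pieces are
copies of one profile in the scaling that preserves `L³`. Their centres are so far apart that the
pieces are almost disjoint, so about `N` of them add up to `N^{1/3}`, which the prefactor cancels.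

The recursion is closed by strong induction with the majorants `wt q y k = q y^k / k³`: `P_k` is
bounded by `wt (tΛ)^k`, `U_k` by `wt (tΛ)^(k-1)` and `Θ_k` by `Λ` times the latter (`IsControlled`).
A product of two derivatives convolves `1/i²` with `1/j²`, which returns `8 q` times `k wt k`
(`convDeriv_le`). The surviving factor `k` is cancelled by integrating a power of time. The pressure
gradient has an additional factor `Λ`, paid for by `t Λ² ≤ 1`. Products of a density with a time
derivative lose no derivative, since maximal regularity controls time derivatives in `L¹`. Every
term of the induction contains a spare factor `q`, so a small `q` closes it (`isControlled_next`);
then `y` is taken proportional to `R`, large enough for the first term. -/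

open MeasureTheory
open scoped ENNReal SchwartzMap FourierTransform ContDiff

noncomputable section

namespace IdealGas

/-! ### Smoothness of parametric integrals -/

section Parametric

variable {P E : Type*} [NormedAddCommGroup P] [NormedSpace ℝ P] [NormedAddCommGroup E]
  [NormedSpace ℝ E]

/-- An integral with smooth integrand of uniformly compact support is smooth in the parameter. -/
theorem contDiff_integral_of_support {G : Type*} [NormedAddCommGroup G] [NormedSpace ℝ G]
    [FiniteDimensional ℝ G] [MeasurableSpace G] [BorelSpace G] {ν : Measure G} {w : G → ℝ}
    (hw : LocallyIntegrable w ν)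
    {h : P → G → E} (hc : ContDiff ℝ ∞ (fun q : P × G => h q.1 q.2)) (r : ℝ)
    (hs : ∀ p x, r < ‖x‖ → h p x = 0) : ContDiff ℝ ∞ (fun p => ∫ x, w x • h p x ∂ν) := by
  -- The integral is the value at `0` of the convolution of `w` with `z ↦ h p (-z)`, so smoothness
  -- of convolutions in a parameter applies.
  have key := contDiffOn_convolution_right_with_param (𝕜 := ℝ) (n := ⊤) (μ := ν) (f := w)
    (ContinuousLinearMap.lsmul ℝ ℝ : ℝ →L[ℝ] E →L[ℝ] E) (g := fun p z => h p (-z))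
    (s := Set.univ) (k := Metric.closedBall 0 r) isOpen_univ (isCompact_closedBall 0 r)
    (fun p x _ hx => hs p _ (by simpa using hx)) hw
    (by
      refine ContDiff.contDiffOn ?_
      exact hc.comp (contDiff_fst.prodMk contDiff_snd.neg))
  rw [Set.univ_prod_univ, contDiffOn_univ] at key
  have h2 := key.comp (contDiff_id.prodMk (contDiff_const (c := (0 : G))))
  convert h2 using 2 with p
  simp [convolution_def]

/-- An integral over the unit interval with smooth integrand is smooth in the parameter. -/
theorem contDiff_unitInterval_integral {h : P → ℝ → E}
    (hc : ContDiff ℝ ∞ (fun q : P × ℝ => h q.1 q.2)) :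
    ContDiff ℝ ∞ (fun p => ∫ x in (0 : ℝ)..1, h p x) := by
  -- The bump equals one on `[-2, 2]`. Multiplying by it gives compact support and leaves the
  -- integral over the unit interval unchanged.
  let b : ContDiffBump (0 : ℝ) := ⟨2, 3, by norm_num, by norm_num⟩
  have hw : LocallyIntegrable (Set.indicator (Set.Ioc (0 : ℝ) 1) fun _ => (1 : ℝ)) volume :=
    ((integrable_indicator_iff measurableSet_Ioc).2 (by simp)).locallyIntegrable
  have := contDiff_integral_of_support (ν := volume) hw (h := fun p x => b x • h p x)
    ((b.contDiff.comp contDiff_snd).smul hc) 3 (fun p x hx => by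
      have : b x = 0 := b.zero_of_le_dist (by simpa using hx.le)
      simp [this])
  convert this using 2 with p
  rw [intervalIntegral.integral_of_le zero_le_one, ← integral_indicator measurableSet_Ioc]
  refine integral_congr_ae (Filter.Eventually.of_forall fun x => ?_)
  by_cases hx : x ∈ Set.Ioc (0 : ℝ) 1
  · have : b x = 1 := b.one_of_mem_closedBall (by
      have := hx.1; have := hx.2
      simp only [Metric.mem_closedBall, dist_zero_right, Real.norm_eq_abs, b, abs_le]
      constructor <;> linarith)
    simp [hx, this]
  · simp [hx]

/-- A primitive in time of a jointly smooth function is jointly smooth. -/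
theorem contDiff_primitive {F : ℝ → P → E} (hF : ContDiff ℝ ∞ (fun q : ℝ × P => F q.1 q.2)) :
    ContDiff ℝ ∞ (fun q : ℝ × P => ∫ s in (0 : ℝ)..q.1, F s q.2) := by
  -- Rescaling `s` by the upper limit moves the time dependence from the domain of integration into
  -- the integrand.
  have h1 : ContDiff ℝ ∞ (fun q : ℝ × P => q.1 • ∫ s in (0 : ℝ)..1, F (q.1 * s) q.2) := by
    refine contDiff_fst.smul (contDiff_unitInterval_integral (h := fun (q : ℝ × P) s => F (q.1 * s) q.2) ?_)
    exact hF.comp (((contDiff_fst.comp contDiff_fst).mul contDiff_snd).prodMk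
      (contDiff_snd.comp contDiff_fst))
  convert h1 using 2 with q
  rw [intervalIntegral.smul_integral_comp_mul_left (fun s => F s q.2)]
  simp

end Parametric

/-! ### Fourier integrals of smooth compactly supported functions -/

section Symbols

variable {E : Type*} [NormedAddCommGroup E] [NormedSpace ℂ E]

/-- Smooth compactly supported functions of frequency. -/
structure IsSymbol (F : R3 → E) : Prop where
  smooth : ContDiff ℝ ∞ F
  compact : HasCompactSupport F

namespace IsSymbol

variable {F G : R3 → E}

/-- A symbol as a Schwartz function. -/
def schwartz (hF : IsSymbol F) : 𝓢(R3, E) := hF.compact.toSchwartzMap hF.smooth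

@[simp] theorem coe_schwartz (hF : IsSymbol F) : (hF.schwartz : R3 → E) = F := rfl

theorem continuous (hF : IsSymbol F) : Continuous F := hF.smooth.continuous

theorem integrable (hF : IsSymbol F) : Integrable F :=
  hF.continuous.integrable_of_hasCompactSupport hF.compact

theorem of_support (hF : ContDiff ℝ ∞ F) (r : ℝ) (h : ∀ η, r < ‖η‖ → F η = 0) : IsSymbol F :=
  ⟨hF, HasCompactSupport.intro (isCompact_closedBall (0 : R3) r) fun x hx => h x (by simpa using hx)⟩

theorem add (hF : IsSymbol F) (hG : IsSymbol G) : IsSymbol (fun η => F η + G η) :=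
  ⟨hF.smooth.add hG.smooth, hF.compact.add hG.compact⟩

theorem smul {m : R3 → ℂ} (hm : ContDiff ℝ ∞ m) (hF : IsSymbol F) :
    IsSymbol (fun η => m η • F η) :=
  ⟨hm.smul hF.smooth, hF.compact.smul_left (f := m)⟩

theorem smul_right {m : R3 → ℂ} (hm : IsSymbol m) (hF : ContDiff ℝ ∞ F) :
    IsSymbol (fun η => m η • F η) :=
  ⟨hm.smooth.smul hF, hm.compact.smul_right (f' := F)⟩

theorem coe_fourierInv [CompleteSpace E] (hF : IsSymbol F) :
    ((𝓕⁻ hF.schwartz : 𝓢(R3, E)) : R3 → E) = 𝓕⁻ F := by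
  rw [SchwartzMap.fourierInv_coe]; rfl

theorem fourier_fourierInv [CompleteSpace E] (hF : IsSymbol F) : 𝓕 (𝓕⁻ F) = F := by
  rw [← hF.coe_fourierInv, ← SchwartzMap.fourier_coe]
  simp

theorem integrable_fourierInv [CompleteSpace E] (hF : IsSymbol F) : Integrable (𝓕⁻ F) := by
  rw [← hF.coe_fourierInv]
  exact SchwartzMap.integrable _

theorem continuous_fourierInv [CompleteSpace E] (hF : IsSymbol F) : Continuous (𝓕⁻ F) := by
  rw [← hF.coe_fourierInv]
  exact SchwartzMap.continuous _

theorem fourierAng_fourierInv [CompleteSpace E] (hF : IsSymbol F) (ξ : R3) :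
    fourierAng (𝓕⁻ F) ξ = F ((2 * Real.pi)⁻¹ • ξ) := by
  rw [fourierAng, hF.fourier_fourierInv]

theorem integrable_exp_smul (hF : IsSymbol F) (x : R3) :
    Integrable (fun v => Complex.exp (↑(2 * Real.pi * inner ℝ v x) * Complex.I) • F v) := by
  refine Continuous.integrable_of_hasCompactSupport ?_ (hF.compact.smul_left (f := fun v => _))
  have := hF.continuous
  fun_prop

theorem fourierInv_add (hF : IsSymbol F) (hG : IsSymbol G) (x : R3) :
    𝓕⁻ (fun η => F η + G η) x = 𝓕⁻ F x + 𝓕⁻ G x := by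
  simp only [Real.fourierInv_eq', smul_add]
  exact integral_add (hF.integrable_exp_smul x) (hG.integrable_exp_smul x)

theorem fourierInv_clm {E' : Type*} [NormedAddCommGroup E'] [NormedSpace ℂ E'] [CompleteSpace E]
    [CompleteSpace E'] (hF : IsSymbol F) (T : E →L[ℂ] E') (x : R3) :
    𝓕⁻ (fun η => T (F η)) x = T (𝓕⁻ F x) := by
  simp only [Real.fourierInv_eq']
  rw [← T.integral_comp_comm (hF.integrable_exp_smul x)]
  simp

theorem norm_fourierInv_le (F : R3 → E) (x : R3) : ‖𝓕⁻ F x‖ ≤ ∫ η, ‖F η‖ := by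
  rw [Real.fourierInv_eq']
  refine (norm_integral_le_integral_norm _).trans (le_of_eq ?_)
  congr 1; ext v
  rw [norm_smul, Complex.norm_exp_ofReal_mul_I, one_mul]

/-- Multiplication of the symbol by `m` is convolution with the inverse transform of `m`. -/
theorem fourierInv_smul [CompleteSpace E] {m : R3 → ℂ} (hm : IsSymbol m) (hF : IsSymbol F)
    (x : R3) : 𝓕⁻ (fun η => m η • F η) x = ∫ y, 𝓕⁻ m y • 𝓕⁻ F (x - y) := by
  have h1 := SchwartzMap.fourier_convolution
    (ContinuousLinearMap.lsmul ℂ ℂ : ℂ →L[ℂ] E →L[ℂ] E) (𝓕⁻ hm.schwartz) (𝓕⁻ hF.schwartz)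
  have h2 := congrArg (fun f => 𝓕⁻ f) h1
  simp only [FourierTransform.fourierInv_fourier_eq] at h2
  have h3 := congrArg (fun f : 𝓢(R3, E) => f x) h2
  simp only [SchwartzMap.convolution_apply] at h3
  rw [convolution_def] at h3
  simp only [hm.coe_fourierInv, hF.coe_fourierInv] at h3
  rw [SchwartzMap.fourierInv_coe] at h3
  simp only [FourierTransform.fourier_fourierInv_eq] at h3
  rw [show (fun η => m η • F η) = (SchwartzMap.pairing
    (ContinuousLinearMap.lsmul ℂ ℂ : ℂ →L[ℂ] E →L[ℂ] E) hm.schwartz hF.schwartz : R3 → E) from ?_]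
  · rw [← h3]; rfl
  · ext η; simp

/-- Products of inverse transforms. -/
theorem fourierInv_bilin {E₁ E₂ : Type*} [NormedAddCommGroup E₁] [NormedSpace ℂ E₁]
    [NormedAddCommGroup E₂] [NormedSpace ℂ E₂] [CompleteSpace E] [CompleteSpace E₁]
    [CompleteSpace E₂] (B : E →L[ℂ] E₁ →L[ℂ] E₂) {G : R3 → E₁}
    (hF : IsSymbol F) (hG : IsSymbol G) (x : R3) :
    𝓕⁻ (fun η => ∫ ζ, B (F ζ) (G (η - ζ))) x = B (𝓕⁻ F x) (𝓕⁻ G x) := by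
  have := Real.fourier_bilin_convolution_eq B hF.integrable hG.integrable (-x)
  simp only [← Real.fourierInv_eq_fourier_neg] at this
  exact this

theorem fderiv_fourierInv [CompleteSpace E] (hF : IsSymbol F) (x v : R3) :
    fderiv ℝ (𝓕⁻ F) x v
      = 𝓕⁻ (fun η => (2 * Real.pi * Complex.I * (inner ℝ η v : ℝ) : ℂ) • F η) x := by
  have h1 := SchwartzMap.lineDerivOp_fourierInv_eq hF.schwartz v
  have h2 := congrArg (fun f : 𝓢(R3, E) => f x) h1
  simp only [SchwartzMap.lineDerivOp_apply_eq_fderiv, SchwartzMap.fourierInv_coe] at h2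
  rw [← hF.coe_fourierInv, SchwartzMap.fourierInv_coe, h2]
  refine congrFun (congrArg _ (funext fun η => ?_)) x
  rw [smul_apply, SchwartzMap.smulLeftCLM_apply_apply (by fun_prop)]
  simp [mul_smul]

theorem pd_fourierInv [CompleteSpace E] (hF : IsSymbol F) (i : Fin 3) :
    pd i (𝓕⁻ F) = 𝓕⁻ (fun η => (2 * Real.pi * Complex.I * (η i : ℝ) : ℂ) • F η) := by
  ext x
  rw [pd, hF.fderiv_fourierInv]
  simp [e, EuclideanSpace.inner_single_right]

end IsSymbol

end Symbols

/-! ### Band-limited functions of time and space -/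

section Band

variable {E : Type*} [NormedAddCommGroup E] [NormedSpace ℂ E]

/-- Jointly smooth functions of time and frequency that vanish for frequencies outside the
ball of radius `r`. -/
structure IsBandSymbol (r : ℝ) (F : ℝ → R3 → E) : Prop where
  smooth : ContDiff ℝ ∞ (fun q : ℝ × R3 => F q.1 q.2)
  supp : ∀ t η, r < ‖η‖ → F t η = 0

/-- Functions of time and space whose spatial spectrum depends smoothly on time and lies in the
ball of radius `r` at all times. -/
def IsBand (r : ℝ) (f : ℝ → R3 → E) : Prop :=
  ∃ F : ℝ → R3 → E, IsBandSymbol r F ∧ ∀ t, f t = 𝓕⁻ (F t)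

namespace IsBandSymbol

variable {r : ℝ} {F G : ℝ → R3 → E}

theorem isSymbol (hF : IsBandSymbol r F) (t : ℝ) : IsSymbol (F t) :=
  IsSymbol.of_support (hF.smooth.comp (contDiff_const.prodMk contDiff_id)) r (hF.supp t)

theorem isBand (hF : IsBandSymbol r F) : IsBand r (fun t => 𝓕⁻ (F t)) := ⟨F, hF, fun _ => rfl⟩

theorem add (hF : IsBandSymbol r F) (hG : IsBandSymbol r G) :
    IsBandSymbol r (fun t η => F t η + G t η) :=
  ⟨hF.smooth.add hG.smooth, fun t η h => by simp [hF.supp t η h, hG.supp t η h]⟩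

theorem smul {m : ℝ → R3 → ℂ} (hm : ContDiff ℝ ∞ (fun q : ℝ × R3 => m q.1 q.2))
    (hF : IsBandSymbol r F) : IsBandSymbol r (fun t η => m t η • F t η) :=
  ⟨hm.smul hF.smooth, fun t η h => by simp [hF.supp t η h]⟩

theorem op {E' : Type*} [NormedAddCommGroup E'] [NormedSpace ℂ E'] {S : ℝ → R3 → E →L[ℂ] E'}
    (hS : ContDiff ℝ ∞ (fun q : ℝ × R3 => S q.1 q.2)) (hF : IsBandSymbol r F) :
    IsBandSymbol r (fun t η => S t η (F t η)) := by
  refine ⟨?_, fun t η h => by simp [hF.supp t η h]⟩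
  have h1 : ContDiff ℝ ∞ (fun q : ℝ × R3 =>
      ContinuousLinearMap.restrictScalarsL ℂ E E' ℝ ℝ (S q.1 q.2)) :=
    (ContinuousLinearMap.contDiff _).comp hS
  exact h1.clm_apply hF.smooth

theorem primitive (hF : IsBandSymbol r F) :
    IsBandSymbol r (fun t η => ∫ s in (0 : ℝ)..t, F s η) :=
  ⟨contDiff_primitive hF.smooth, fun t η h => by simp [hF.supp _ η h]⟩

theorem hasDerivAt (hF : IsBandSymbol r F) (t : ℝ) (η : R3) :
    HasDerivAt (fun s => F s η) (fderiv ℝ (fun q : ℝ × R3 => F q.1 q.2) (t, η) (1, 0)) t := by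
  have h1 : HasFDerivAt (fun q : ℝ × R3 => F q.1 q.2) _ (t, η) :=
    ((hF.smooth.differentiable (by simp)) (t, η)).hasFDerivAt
  have h2 : HasDerivAt (fun s : ℝ => (s, η)) ((1 : ℝ), (0 : R3)) t :=
    (hasDerivAt_id t).prodMk (hasDerivAt_const t η)
  exact h1.comp_hasDerivAt t h2

theorem timeDeriv (hF : IsBandSymbol r F) :
    IsBandSymbol r (fun t η => deriv (fun s => F s η) t) := by
  have h : (fun q : ℝ × R3 => deriv (fun s => F s q.2) q.1)
      = fun q => fderiv ℝ (fun q : ℝ × R3 => F q.1 q.2) q (1, 0) :=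
    funext fun q => (hF.hasDerivAt q.1 q.2).deriv
  refine ⟨?_, fun t η hη => ?_⟩
  · rw [h]
    exact (hF.smooth.fderiv_right (m := ∞) (by simp)).clm_apply contDiff_const
  · simp [hF.supp _ η hη]

/-- The inverse transform commutes with time integration. -/
theorem fourierInv_primitive (hF : IsBandSymbol r F) (t : ℝ) (x : R3) :
    𝓕⁻ (fun η => ∫ s in (0 : ℝ)..t, F s η) x = ∫ s in (0 : ℝ)..t, 𝓕⁻ (F s) x := by
  simp only [Real.fourierInv_eq', ← intervalIntegral.integral_smul]
  have hc : Continuous (fun q : ℝ × R3 =>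
      Complex.exp (↑(2 * Real.pi * inner ℝ q.2 x) * Complex.I) • F q.1 q.2) := by
    refine Continuous.smul ?_ hF.smooth.continuous
    fun_prop
  rw [intervalIntegral_integral_swap]
  have h1 : IntegrableOn (fun q : ℝ × R3 =>
      Complex.exp (↑(2 * Real.pi * inner ℝ q.2 x) * Complex.I) • F q.1 q.2)
      (Set.uIcc 0 t ×ˢ Metric.closedBall 0 r) (volume.prod volume) :=
    hc.continuousOn.integrableOn_compact (isCompact_uIcc.prod (isCompact_closedBall 0 r))
  -- Fubini needs integrability on the whole frequency space; beyond the ball of radius `r` the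
  -- integrand vanishes, so the compact piece suffices.
  have h2 := h1.of_forall_sdiff_eq_zero (t := Set.uIoc 0 t ×ˢ Set.univ)
    (measurableSet_uIoc.prod MeasurableSet.univ) (fun q hq => by
      have h3 : r < ‖q.2‖ := by
        by_contra h4
        exact hq.2 ⟨Set.uIoc_subset_uIcc hq.1.1, by simpa using h4⟩
      simp [hF.supp _ _ h3])
  rw [IntegrableOn, ← Measure.prod_restrict, Measure.restrict_univ] at h2
  exact h2

/-- The inverse transform of a band symbol is jointly smooth in time and space. -/
theorem contDiff_fourierInv (hF : IsBandSymbol r F) :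
    ContDiff ℝ ∞ (fun q : ℝ × R3 => 𝓕⁻ (F q.1) q.2) := by
  have := contDiff_integral_of_support (ν := (volume : Measure R3)) (w := fun _ => 1)
    (locallyIntegrable_const 1)
    (h := fun (q : ℝ × R3) η => Complex.exp (↑(2 * Real.pi * inner ℝ η q.2) * Complex.I) • F q.1 η)
    (by
      refine ContDiff.smul ?_
        (hF.smooth.comp ((contDiff_fst.comp contDiff_fst).prodMk contDiff_snd))
      refine Complex.contDiff_exp.comp (ContDiff.mul ?_ contDiff_const)
      refine Complex.ofRealCLM.contDiff.comp (contDiff_const.mul ?_)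
      exact contDiff_snd.inner ℝ (contDiff_snd.comp contDiff_fst))
    r (fun q η h => by simp [hF.supp _ _ h])
  convert this using 2 with q
  simp [Real.fourierInv_eq']

/-- Write the symbol as its value at time zero plus the primitive of its time derivative. Inverse
transform and time integration commute, so the fundamental theorem of calculus replaces
differentiation under the Fourier integral. -/
theorem fourierInv_hasDerivAt [CompleteSpace E] (hF : IsBandSymbol r F) (t : ℝ) (x : R3) :
    HasDerivAt (fun s => 𝓕⁻ (F s) x) (𝓕⁻ (fun η => deriv (fun s => F s η) t) x) t := by
  have hd := hF.timeDeriv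
  have h0 : IsBandSymbol r (fun _ : ℝ => F 0) :=
    ⟨(hF.isSymbol 0).smooth.comp contDiff_snd, fun t η h => hF.supp 0 η h⟩
  have h1 : ∀ s, 𝓕⁻ (F s) x
      = 𝓕⁻ (F 0) x + ∫ u in (0 : ℝ)..s, 𝓕⁻ (fun η => deriv (fun s => F s η) u) x := by
    intro s
    rw [← hd.fourierInv_primitive s x, ← (h0.isSymbol 0).fourierInv_add (hd.primitive.isSymbol s)]
    refine congrFun (congrArg _ (funext fun η => ?_)) x
    rw [intervalIntegral.integral_deriv_eq_sub (fun u _ => (hF.hasDerivAt u η).differentiableAt)]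
    · simp
    · exact (hd.smooth.continuous.comp (Continuous.prodMk_left η)).intervalIntegrable _ _
  rw [show (fun s => 𝓕⁻ (F s) x) = _ from funext h1]
  refine HasDerivAt.const_add _ (intervalIntegral.integral_hasDerivAt_right ?_ ?_ ?_)
  · exact (hd.contDiff_fourierInv.continuous.comp (Continuous.prodMk_left x)).intervalIntegrable _ _
  · exact (hd.contDiff_fourierInv.continuous.comp
      (Continuous.prodMk_left x)).stronglyMeasurableAtFilter _ _
  · exact (hd.contDiff_fourierInv.continuous.comp (Continuous.prodMk_left x)).continuousAt

/-- A product in space is a convolution in frequency. Smoothness holds because `ζ` is confined to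
the ball of radius `r` for all parameters, and the support statement is the triangle inequality. -/
theorem bilin {E₁ E₂ : Type*} [NormedAddCommGroup E₁] [NormedSpace ℂ E₁]
    [NormedAddCommGroup E₂] [NormedSpace ℂ E₂] (B : E →L[ℂ] E₁ →L[ℂ] E₂) {r' : ℝ}
    {H : ℝ → R3 → E₁} (hF : IsBandSymbol r F) (hH : IsBandSymbol r' H) :
    IsBandSymbol (r + r') (fun t η => ∫ ζ, B (F t ζ) (H t (η - ζ))) := by
  constructor
  · have := contDiff_integral_of_support (ν := (volume : Measure R3)) (w := fun _ => 1)
      (locallyIntegrable_const 1)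
      (h := fun (q : ℝ × R3) ζ => B (F q.1 ζ) (H q.1 (q.2 - ζ)))
      (by
        have h1 : ContDiff ℝ ∞ (fun p : (ℝ × R3) × R3 => F p.1.1 p.2) :=
          hF.smooth.comp ((contDiff_fst.comp contDiff_fst).prodMk contDiff_snd)
        have h2 : ContDiff ℝ ∞ (fun p : (ℝ × R3) × R3 => H p.1.1 (p.1.2 - p.2)) :=
          hH.smooth.comp ((contDiff_fst.comp contDiff_fst).prodMk
            ((contDiff_snd.comp contDiff_fst).sub contDiff_snd))
        exact (B.bilinearRestrictScalars ℝ).isBoundedBilinearMap.contDiff.comp (h1.prodMk h2))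
      r (fun q η h => by simp [hF.supp _ _ h])
    convert this using 2 with q
    simp
  · intro t η h
    refine integral_eq_zero_of_ae (Filter.Eventually.of_forall fun ζ => ?_)
    rcases lt_or_ge r ‖ζ‖ with h1 | h1
    · simp [hF.supp t ζ h1]
    · have : r' < ‖η - ζ‖ := by
        have := norm_sub_norm_le η ζ
        linarith
      simp [hH.supp t _ this]

end IsBandSymbol

namespace IsBand

variable {r : ℝ} {f g : ℝ → R3 → E}

theorem symbol (hf : IsBand r f) : ∃ F : ℝ → R3 → E, IsBandSymbol r F ∧ f = fun t => 𝓕⁻ (F t) :=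
  let ⟨F, h, h'⟩ := hf; ⟨F, h, funext h'⟩

theorem mono {r' : ℝ} (hf : IsBand r f) (h : r ≤ r') : IsBand r' f :=
  let ⟨F, h1, h2⟩ := hf; ⟨F, ⟨h1.smooth, fun t η hη => h1.supp t η (h.trans_lt hη)⟩, h2⟩

theorem zero (r : ℝ) : IsBand r (fun _ _ => (0 : E)) :=
  ⟨fun _ _ => 0, ⟨contDiff_const, fun _ _ _ => rfl⟩, fun _ => by
    ext; simp [Real.fourierInv_eq']⟩

theorem add (hf : IsBand r f) (hg : IsBand r g) : IsBand r (fun t x => f t x + g t x) := by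
  obtain ⟨F, hF, rfl⟩ := hf.symbol
  obtain ⟨G, hG, rfl⟩ := hg.symbol
  exact ⟨_, hF.add hG, fun t => funext fun x =>
    ((hF.isSymbol t).fourierInv_add (hG.isSymbol t) x).symm⟩

theorem contDiff (hf : IsBand r f) : ContDiff ℝ ∞ (fun q : ℝ × R3 => f q.1 q.2) := by
  obtain ⟨F, hF, rfl⟩ := hf.symbol
  exact hF.contDiff_fourierInv

theorem contDiff_space (hf : IsBand r f) (t : ℝ) : ContDiff ℝ ∞ (f t) :=
  hf.contDiff.comp (contDiff_const.prodMk contDiff_id)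

theorem primitive (hf : IsBand r f) : IsBand r (fun t x => ∫ s in (0 : ℝ)..t, f s x) := by
  obtain ⟨F, hF, rfl⟩ := hf.symbol
  exact ⟨_, hF.primitive, fun t => funext fun x => (hF.fourierInv_primitive t x).symm⟩

variable [CompleteSpace E]

theorem clm {E' : Type*} [NormedAddCommGroup E'] [NormedSpace ℂ E'] [CompleteSpace E']
    (hf : IsBand r f) (T : E →L[ℂ] E') : IsBand r (fun t x => T (f t x)) := by
  obtain ⟨F, hF, rfl⟩ := hf.symbol
  refine ⟨_, hF.op (S := fun _ _ => T) contDiff_const, fun t => funext fun x => ?_⟩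
  exact ((hF.isSymbol t).fourierInv_clm T x).symm

theorem const_smul (hf : IsBand r f) (c : ℂ) : IsBand r (fun t x => c • f t x) :=
  hf.clm (c • ContinuousLinearMap.id ℂ E)

theorem neg (hf : IsBand r f) : IsBand r (fun t x => - f t x) := by
  simpa using hf.const_smul (-1)

theorem sub (hf : IsBand r f) (hg : IsBand r g) : IsBand r (fun t x => f t x - g t x) := by
  simpa [sub_eq_add_neg] using hf.add hg.neg

theorem sum {ι : Type*} (s : Finset ι) {f : ι → ℝ → R3 → E} (hf : ∀ i ∈ s, IsBand r (f i)) :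
    IsBand r (fun t x => ∑ i ∈ s, f i t x) := by
  classical
  induction s using Finset.induction_on with
  | empty => simpa using zero r
  | insert a s ha ih =>
    simp only [Finset.sum_insert ha]
    exact (hf a (by simp)).add (ih fun i hi => hf i (by simp [hi]))

theorem pd (hf : IsBand r f) (i : Fin 3) : IsBand r (fun t => pd i (f t)) := by
  obtain ⟨F, hF, rfl⟩ := hf.symbol
  refine ⟨_, hF.smul (m := fun _ η => (2 * Real.pi * Complex.I * (η i : ℝ) : ℂ)) ?_,
    fun t => (hF.isSymbol t).pd_fourierInv i⟩
  refine contDiff_const.mul (Complex.ofRealCLM.contDiff.comp ?_)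
  exact (EuclideanSpace.proj (𝕜 := ℝ) i).contDiff.comp contDiff_snd

theorem bilin {E₁ E₂ : Type*} [NormedAddCommGroup E₁] [NormedSpace ℂ E₁]
    [NormedAddCommGroup E₂] [NormedSpace ℂ E₂] [CompleteSpace E₁] [CompleteSpace E₂]
    (B : E →L[ℂ] E₁ →L[ℂ] E₂) {r' : ℝ}
    {h : ℝ → R3 → E₁} (hf : IsBand r f) (hh : IsBand r' h) :
    IsBand (r + r') (fun t x => B (f t x) (h t x)) := by
  obtain ⟨F, hF, rfl⟩ := hf.symbol
  obtain ⟨H, hH, rfl⟩ := hh.symbol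
  exact ⟨_, hF.bilin B hH, fun t => funext fun x =>
    ((hF.isSymbol t).fourierInv_bilin B (hH.isSymbol t) x).symm⟩

theorem hasDerivAt (hf : IsBand r f) (t : ℝ) (x : R3) :
    HasDerivAt (fun s => f s x) (timeDeriv f t x) t := by
  have : DifferentiableAt ℝ (fun s => f s x) t :=
    (hf.contDiff.comp (contDiff_prodMk_left x)).differentiable (by simp) t
  exact this.hasDerivAt

theorem timeDeriv (hf : IsBand r f) : IsBand r (timeDeriv f) := by
  obtain ⟨F, hF, rfl⟩ := hf.symbol
  exact ⟨_, hF.timeDeriv, fun t => funext fun x => (hF.fourierInv_hasDerivAt t x).deriv⟩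

/-- Smooth compactly supported symbols are Schwartz, and the time derivative of a band-limited
function is band-limited again. -/
theorem isRegularAt (hf : IsBand r f) (t : ℝ) : IsRegularAt f t := by
  have key : ∀ {g : ℝ → R3 → E}, IsBand r g → ∃ h : 𝓢(R3, E), g t = h := by
    rintro g hg
    obtain ⟨F, hF, rfl⟩ := hg.symbol
    exact ⟨_, ((hF.isSymbol t).coe_fourierInv).symm⟩
  obtain ⟨g, hg⟩ := key hf
  obtain ⟨h, hh⟩ := key hf.timeDeriv
  exact ⟨g, h, hg, fun x => hh ▸ hf.hasDerivAt t x⟩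

end IsBand

end Band

/-! ### Integral inequalities in `L³` -/

section IntegralInequalities

/-- Hölder with three exponents `1/3`, in the form required when the cube of an integral is
expanded. -/
theorem lintegral_mul_mul_le_cube {X : Type*} [MeasurableSpace X] (μ : Measure X)
    {f g h : X → ℝ≥0∞} (hf : Measurable f) (hg : Measurable g) (hh : Measurable h) :
    ∫⁻ x, f x * g x * h x ∂μ ≤ (∫⁻ x, f x ^ 3 ∂μ) ^ (1 / 3 : ℝ) *
      (∫⁻ x, g x ^ 3 ∂μ) ^ (1 / 3 : ℝ) * (∫⁻ x, h x ^ 3 ∂μ) ^ (1 / 3 : ℝ) := by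
  have key := ENNReal.lintegral_prod_norm_pow_le (μ := μ) (Finset.univ : Finset (Fin 3))
    (f := ![fun x => f x ^ 3, fun x => g x ^ 3, fun x => h x ^ 3])
    (by
      intro i _
      fin_cases i
      · exact (hf.pow_const 3).aemeasurable
      · exact (hg.pow_const 3).aemeasurable
      · exact (hh.pow_const 3).aemeasurable)
    (p := fun _ => 1 / 3) (by simp) (fun i _ => by norm_num)
  have h3 : ∀ a : ℝ≥0∞, (a ^ 3) ^ (3⁻¹ : ℝ) = a := fun a => by
    rw [← ENNReal.rpow_natCast, ← ENNReal.rpow_mul]; norm_num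
  simp only [Fin.prod_univ_three, Matrix.cons_val_zero, Matrix.cons_val_one, Matrix.cons_val,
    one_div, h3] at key
  simpa only [one_div] using key

/-- Minkowski's integral inequality in `L³` for nonnegative functions. -/
theorem lintegral_lintegral_cube_le {S X : Type*} [MeasurableSpace S] [MeasurableSpace X]
    (ν : Measure S) (μ : Measure X) [SFinite ν] [SFinite μ] {F : S → X → ℝ≥0∞}
    (hF : Measurable (Function.uncurry F)) :
    ∫⁻ x, (∫⁻ s, F s x ∂ν) ^ 3 ∂μ ≤ (∫⁻ s, (∫⁻ x, F s x ^ 3 ∂μ) ^ (1 / 3 : ℝ) ∂ν) ^ 3 := by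
  set n : S → ℝ≥0∞ := fun s => (∫⁻ x, F s x ^ 3 ∂μ) ^ (1 / 3 : ℝ) with hn
  have hFs : ∀ s, Measurable (F s) := fun s => hF.comp measurable_prodMk_left
  have hA : Measurable (fun x => ∫⁻ s, F s x ∂ν) := hF.lintegral_prod_left'
  have hnm : Measurable n :=
    (Measurable.lintegral_prod_right' (f := fun p : S × X => F p.1 p.2 ^ 3)
      (hF.pow_const 3)).pow_const _
  have step : ∀ G : X → ℝ≥0∞, Measurable G →
      ∫⁻ x, G x * (∫⁻ s, F s x ∂ν) ∂μ = ∫⁻ s, ∫⁻ x, G x * F s x ∂μ ∂ν := by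
    intro G hG
    rw [lintegral_lintegral_swap]
    · refine lintegral_congr fun x => ?_
      exact (lintegral_const_mul (G x) (f := fun s => F s x) (hF.comp measurable_prodMk_right)).symm
    · exact ((hG.comp measurable_snd).mul hF).aemeasurable
  -- The integer exponent makes duality unnecessary: the cube is a triple integral over `S`, Fubini
  -- moves the integral over `x` innermost, and Hölder applies there.
  calc ∫⁻ x, (∫⁻ s, F s x ∂ν) ^ 3 ∂μ
      = ∫⁻ x, ((∫⁻ s, F s x ∂ν) * ∫⁻ s, F s x ∂ν) * (∫⁻ s, F s x ∂ν) ∂μ := by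
        refine lintegral_congr fun x => by ring
    _ = ∫⁻ s, ∫⁻ x, F s x * (∫⁻ s, F s x ∂ν) * (∫⁻ s, F s x ∂ν) ∂μ ∂ν := by
        rw [step (fun x => (∫⁻ s, F s x ∂ν) * ∫⁻ s, F s x ∂ν) (hA.mul hA)]
        refine lintegral_congr fun s => lintegral_congr fun x => by ring
    _ = ∫⁻ s, ∫⁻ s', ∫⁻ x, F s x * F s' x * (∫⁻ s, F s x ∂ν) ∂μ ∂ν ∂ν := by
        refine lintegral_congr fun s => ?_
        rw [step (fun x => F s x * ∫⁻ s, F s x ∂ν) ((hFs s).mul hA)]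
        refine lintegral_congr fun s => lintegral_congr fun x => by ring
    _ = ∫⁻ s, ∫⁻ s', ∫⁻ s'', ∫⁻ x, F s x * F s' x * F s'' x ∂μ ∂ν ∂ν ∂ν := by
        refine lintegral_congr fun s => lintegral_congr fun s' => ?_
        exact step (fun x => F s x * F s' x) ((hFs s).mul (hFs s'))
    _ ≤ ∫⁻ s, ∫⁻ s', ∫⁻ s'', n s * n s' * n s'' ∂ν ∂ν ∂ν := by
        refine lintegral_mono fun s => lintegral_mono fun s' => lintegral_mono fun s'' => ?_
        exact lintegral_mul_mul_le_cube μ (hFs s) (hFs s') (hFs s'')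
    _ = (∫⁻ s, n s ∂ν) ^ 3 := by
        have e1 : ∀ c d, ∫⁻ s, c * n s * d ∂ν = c * (∫⁻ s, n s ∂ν) * d := fun c d => by
          rw [lintegral_mul_const d (hnm.const_mul c), lintegral_const_mul c hnm]
        have e2 : ∀ c, ∫⁻ s, c * n s ∂ν = c * (∫⁻ s, n s ∂ν) := fun c => lintegral_const_mul c hnm
        have e3 : ∀ c, ∫⁻ s, n s * c ∂ν = (∫⁻ s, n s ∂ν) * c := fun c => lintegral_mul_const c hnm
        calc _ = ∫⁻ s, ∫⁻ s', n s * n s' * (∫⁻ s, n s ∂ν) ∂ν ∂ν :=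
              lintegral_congr fun s => lintegral_congr fun s' => e2 _
          _ = ∫⁻ s, n s * ((∫⁻ s, n s ∂ν) * ∫⁻ s, n s ∂ν) ∂ν :=
              lintegral_congr fun s => (e1 _ _).trans (mul_assoc _ _ _)
          _ = _ := by rw [e3]; ring

variable {E : Type*} [NormedAddCommGroup E]

theorem eLpNorm_three {X : Type*} [MeasurableSpace X] (μ : Measure X) (f : X → E) :
    eLpNorm f 3 μ = (∫⁻ x, ‖f x‖ₑ ^ 3 ∂μ) ^ (1 / 3 : ℝ) := by
  rw [eLpNorm_eq_lintegral_rpow_enorm_toReal (by norm_num) (by norm_num)]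
  norm_num

theorem le_lintegral_cube_root {a b : ℝ≥0∞} (h : a ≤ b ^ 3) : a ^ (1 / 3 : ℝ) ≤ b := by
  calc a ^ (1 / 3 : ℝ) ≤ (b ^ 3) ^ (1 / 3 : ℝ) := ENNReal.rpow_le_rpow h (by norm_num)
    _ = b := by rw [← ENNReal.rpow_natCast, ← ENNReal.rpow_mul]; norm_num

/-- Minkowski's integral inequality in `L³`, for a function dominated by an integral of norms. -/
theorem eLpNorm_three_le_lintegral {S X F : Type*} [MeasurableSpace S] [MeasurableSpace X]
    [NormedAddCommGroup F]
    (ν : Measure S) (μ : Measure X) [SFinite ν] [SFinite μ] {f : S → X → E} {g : X → F}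
    (hf : Measurable (fun p : S × X => ‖f p.1 p.2‖ₑ)) (hg : ∀ x, ‖g x‖ₑ ≤ ∫⁻ s, ‖f s x‖ₑ ∂ν) :
    eLpNorm g 3 μ ≤ ∫⁻ s, eLpNorm (f s) 3 μ ∂ν := by
  rw [eLpNorm_three]
  simp only [eLpNorm_three]
  refine le_lintegral_cube_root (le_trans (lintegral_mono fun x => ?_)
    (lintegral_lintegral_cube_le ν μ (F := fun s x => ‖f s x‖ₑ) hf))
  gcongr
  exact hg x

variable [NormedSpace ℂ E]

/-- Young's inequality `L¹ * L³ ⊆ L³`. -/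
theorem eLpNorm_three_convolution_le {K : R3 → ℂ} {g : R3 → E} (hK : Continuous K)
    (hg : Continuous g) :
    eLpNorm (fun x => ∫ y, K y • g (x - y)) 3 volume
      ≤ (∫⁻ y, ‖K y‖ₑ) * eLpNorm g 3 volume := by
  have hc : Continuous (fun p : R3 × R3 => K p.1 • g (p.2 - p.1)) :=
    (hK.comp continuous_fst).smul (hg.comp (continuous_snd.sub continuous_fst))
  refine (eLpNorm_three_le_lintegral volume volume (f := fun y x => K y • g (x - y))
    hc.enorm.measurable fun x => enorm_integral_le_lintegral_enorm _).trans (le_of_eq ?_)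
  rw [← lintegral_mul_const _ hK.enorm.measurable]
  refine lintegral_congr fun y => ?_
  have h1 : eLpNorm (fun x => g (x - y)) 3 volume = eLpNorm g 3 volume :=
    eLpNorm_comp_measurePreserving hg.aestronglyMeasurable
      (measurePreserving_sub_right volume y)
  rw [← h1]
  exact eLpNorm_const_smul (K y) (fun x => g (x - y)) 3 volume

/-- Hölder's inequality for a convolution: `L^{3/2} * L³ ⊆ L^∞`. -/
theorem enorm_convolution_le {K : R3 → ℂ} {g : R3 → E} (hK : Continuous K)
    (hg : Continuous g) (x : R3) :
    ‖∫ y, K y • g (x - y)‖ₑ ≤ eLpNorm K (3 / 2) volume * eLpNorm g 3 volume := by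
  refine (enorm_integral_le_lintegral_enorm _).trans ?_
  have hp : (3 / 2 : ℝ).HolderConjugate 3 := by
    rw [Real.holderConjugate_iff]; norm_num
  have h := ENNReal.lintegral_mul_le_Lp_mul_Lq (volume : Measure R3) hp
    (f := fun y => ‖K y‖ₑ) (g := fun y => ‖g (x - y)‖ₑ) hK.enorm.measurable.aemeasurable
    (hg.comp (continuous_const.sub continuous_id)).enorm.measurable.aemeasurable
  have h1 : ∫⁻ y, ‖g (x - y)‖ₑ ^ (3 : ℝ) = ∫⁻ y, ‖g y‖ₑ ^ (3 : ℝ) :=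
    lintegral_sub_left_eq_self (fun y => ‖g y‖ₑ ^ (3 : ℝ)) x
  rw [h1] at h
  have h2 : (3 / 2 : ℝ≥0∞).toReal = 3 / 2 := by simp
  rw [eLpNorm_three, eLpNorm_eq_lintegral_rpow_enorm_toReal (by norm_num)
    (ENNReal.div_ne_top (by norm_num) (by norm_num)), h2]
  refine le_trans (le_of_eq (lintegral_congr fun y => ?_)) (h.trans (le_of_eq ?_))
  · simp [enorm_smul]
  · norm_num

end IntegralInequalities

/-! ### Unit-scale frequency localization -/

section Window

variable {E : Type*} [NormedAddCommGroup E] [NormedSpace ℂ E]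

/-- The angular frequency relative to the lattice point `k`. -/
def relFreq (k : Fin 3 → ℤ) (η : R3) : R3 := (2 * Real.pi) • η - latticePoint k

theorem relFreq_apply (k : Fin 3 → ℤ) (η : R3) (i : Fin 3) :
    relFreq k η i = 2 * Real.pi * η i - k i := by
  simp [relFreq, latticePoint]

theorem contDiff_relFreq (k : Fin 3 → ℤ) : ContDiff ℝ ∞ (relFreq k) :=
  (contDiff_id.const_smul (2 * Real.pi)).sub contDiff_const

theorem IsSymbol.exists_radius {F : R3 → E} (hF : IsSymbol F) :
    ∃ r : ℝ, 0 ≤ r ∧ ∀ η, r < ‖η‖ → F η = 0 := by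
  obtain ⟨r, hr⟩ := hF.compact.isBounded.subset_closedBall (0 : R3)
  refine ⟨max r 0, le_max_right _ _, fun η h => ?_⟩
  by_contra h0
  have := hr (subset_tsupport F h0)
  rw [Metric.mem_closedBall, dist_zero_right] at this
  exact absurd (this.trans (le_max_left r 0)) (not_le.2 h)

theorem IsSymbol.comp_relFreq {m : R3 → E} (hm : IsSymbol m) (k : Fin 3 → ℤ) :
    IsSymbol (fun η => m (relFreq k η)) := by
  obtain ⟨r, -, hr⟩ := hm.exists_radius
  refine IsSymbol.of_support (hm.smooth.comp (contDiff_relFreq k))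
    ((r + ‖latticePoint k‖) / (2 * Real.pi)) fun η h => hr _ ?_
  have hpi : 0 < 2 * Real.pi := by positivity
  rw [div_lt_iff₀ hpi] at h
  have h1 := norm_sub_norm_le ((2 * Real.pi) • η) (latticePoint k)
  rw [norm_smul, Real.norm_of_nonneg hpi.le] at h1
  rw [relFreq]
  linarith

/-- Translating a symbol multiplies its kernel by a character of modulus one. This is why no
constant on a frequency box depends on the box. -/
theorem enorm_fourierInv_comp_relFreq (m : R3 → E) (k : Fin 3 → ℤ) (x : R3) :
    ‖𝓕⁻ (fun η => m (relFreq k η)) x‖ₑ = ‖𝓕⁻ (fun η => m (relFreq 0 η)) x‖ₑ := by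
  have h0 : ∀ η, relFreq k (η + (2 * Real.pi)⁻¹ • latticePoint k) = relFreq 0 η := by
    intro η
    have hpi : (2 * Real.pi) ≠ 0 := by positivity
    ext i
    simp only [relFreq_apply]
    simp [latticePoint]
    field_simp
    ring
  simp only [Real.fourierInv_eq']
  rw [← integral_add_right_eq_self _ ((2 * Real.pi)⁻¹ • latticePoint k)]
  simp only [h0, inner_add_left, mul_add, Complex.ofReal_add, add_mul, Complex.exp_add]
  rw [show (∫ v, (Complex.exp (↑(2 * Real.pi * inner ℝ v x) * Complex.I) *
      Complex.exp (↑(2 * Real.pi * inner ℝ ((2 * Real.pi)⁻¹ • latticePoint k) x) * Complex.I)) •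
        m (relFreq 0 v)) = ∫ v,
      Complex.exp (↑(2 * Real.pi * inner ℝ ((2 * Real.pi)⁻¹ • latticePoint k) x) * Complex.I) •
      (Complex.exp (↑(2 * Real.pi * inner ℝ v x) * Complex.I) • m (relFreq 0 v)) from
    integral_congr_ae (Filter.Eventually.of_forall fun v => by
      simp only [smul_smul]; rw [mul_comm]), integral_smul, enorm_smul]
  rw [← ofReal_norm, Complex.norm_exp_ofReal_mul_I]
  simp

/-- The `L¹` norm of the convolution kernel with angular symbol `m`. -/
def kernelNorm (m : R3 → ℂ) : ℝ≥0∞ := ∫⁻ x, ‖𝓕⁻ (fun η => m (relFreq 0 η)) x‖ₑ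

theorem kernelNorm_lt_top {m : R3 → ℂ} (hm : IsSymbol m) : kernelNorm m < ⊤ :=
  (hm.comp_relFreq 0).integrable_fourierInv.2

variable [CompleteSpace E]

/-- Convolution with a modulated kernel is bounded on `L³`, uniformly in the modulation. -/
theorem eLpNorm_multiplier_le {m : R3 → ℂ} (hm : IsSymbol m) (k : Fin 3 → ℤ) {F : R3 → E}
    (hF : IsSymbol F) :
    eLpNorm (𝓕⁻ (fun η => m (relFreq k η) • F η)) 3 volume
      ≤ kernelNorm m * eLpNorm (𝓕⁻ F) 3 volume := by
  have h := eLpNorm_three_convolution_le (hm.comp_relFreq k).continuous_fourierInv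
    hF.continuous_fourierInv
  simp only [enorm_fourierInv_comp_relFreq m k] at h
  rwa [show 𝓕⁻ (fun η => m (relFreq k η) • F η) = _ from
    funext fun x => (hm.comp_relFreq k).fourierInv_smul hF x]

/-- A smooth cutoff that equals one on the support of every window. -/
def fatWindow : ContDiffBump (0 : R3) := ⟨4, 5, by norm_num, by norm_num⟩

/-- The cutoff as a complex-valued function. -/
def fat (ζ : R3) : ℂ := (fatWindow ζ : ℝ)

theorem isSymbol_fat : IsSymbol fat :=
  ⟨Complex.ofRealCLM.contDiff.comp fatWindow.contDiff,
    fatWindow.hasCompactSupport.comp_left (g := fun x : ℝ => (x : ℂ)) Complex.ofReal_zero⟩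

theorem IsModulationWindow.isSymbol {χ : R3 → ℂ} (hχ : IsModulationWindow χ) : IsSymbol χ :=
  ⟨hχ.smooth, hχ.compact⟩

theorem IsModulationWindow.mem_Ico {χ : R3 → ℂ} (hχ : IsModulationWindow χ) {ζ : R3}
    (h : χ ζ ≠ 0) (i : Fin 3) : 0 ≤ ζ i ∧ ζ i < 2 :=
  hχ.supp (subset_tsupport χ h) i

theorem IsModulationWindow.fat_mul {χ : R3 → ℂ} (hχ : IsModulationWindow χ) (ζ : R3) :
    fat ζ * χ ζ = χ ζ := by
  by_cases h : χ ζ = 0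
  · simp [h]
  · have h1 : fatWindow ζ = 1 := by
      refine fatWindow.one_of_mem_closedBall ?_
      have h2 := hχ.mem_Ico h
      -- Three coordinates in `[0, 2)` give `|ζ|² ≤ 12 < 16`, hence the inner radius `4` of the
      -- cutoff.
      have h3 : ‖ζ‖ ^ 2 ≤ 4 ^ 2 := by
        rw [EuclideanSpace.norm_sq_eq, Fin.sum_univ_three]
        simp only [Real.norm_eq_abs, sq_abs]
        have := h2 0; have := h2 1; have := h2 2
        nlinarith
      simpa [fatWindow] using abs_le_of_sq_le_sq h3 (by norm_num)
    simp [fat, h1]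

/-- The component of a symbol near the lattice point `k`. -/
def boxed (χ : R3 → ℂ) (k : Fin 3 → ℤ) (F : R3 → E) (η : R3) : E := χ (relFreq k η) • F η

/-- The `L³` norm of the component near the lattice point `k`. -/
def boxNorm (χ : R3 → ℂ) (k : Fin 3 → ℤ) (F : R3 → E) : ℝ≥0∞ :=
  eLpNorm (𝓕⁻ (boxed χ k F)) 3 volume

theorem IsSymbol.eLpNorm_lt_top {F : R3 → E} (hF : IsSymbol F) :
    eLpNorm (𝓕⁻ F) 3 volume < ⊤ := by
  rw [← hF.coe_fourierInv]
  exact SchwartzMap.eLpNorm_lt_top _ _ _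

variable {χ : R3 → ℂ}

/-- The factors `2π` of the angular convention cancel here. From now on the modulation norm is the
sum of the norms over boxes, with Mathlib's frequency variable `η`. -/
theorem modNorm_fourierInv (χ : R3 → ℂ) {F : R3 → E} (hF : IsSymbol F) :
    modNorm χ (𝓕⁻ F) = ∑' k, boxNorm χ k F := by
  refine tsum_congr fun k => congrArg (fun f => eLpNorm f 3 volume) (funext fun x => ?_)
  rw [fourierAngInv]
  refine congrFun (congrArg _ (funext fun η => ?_)) x
  rw [hF.fourierAng_fourierInv, smul_smul, inv_mul_cancel₀ (by positivity), one_smul]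
  rfl

theorem IsSymbol.boxed {F : R3 → E} (hF : IsSymbol F) (hχ : IsModulationWindow χ) (k : Fin 3 → ℤ) :
    IsSymbol (boxed χ k F) :=
  (hχ.isSymbol.comp_relFreq k).smul_right hF.smooth

/-- Multipliers acting on a frequency box are bounded uniformly in the box. -/
theorem eLpNorm_boxed_le (hχ : IsModulationWindow χ) {p : R3 → ℂ} (hp : ContDiff ℝ ∞ p)
    (k : Fin 3 → ℤ) {F : R3 → E} (hF : IsSymbol F) :
    eLpNorm (𝓕⁻ (fun η => p (relFreq k η) • IdealGas.boxed χ k F η)) 3 volume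
      ≤ kernelNorm (fun ζ => p ζ • fat ζ) * boxNorm χ k F := by
  refine le_trans (le_of_eq ?_) (eLpNorm_multiplier_le (isSymbol_fat.smul hp) k (hF.boxed hχ k))
  refine congrArg (fun f => eLpNorm (𝓕⁻ f) 3 volume) (funext fun η => ?_)
  simp only [IdealGas.boxed, smul_smul, smul_eq_mul]
  rw [mul_assoc (p _), hχ.fat_mul]

/-- Bernstein's inequality on a frequency box. -/
theorem enorm_fourierInv_boxed_le (hχ : IsModulationWindow χ) (k : Fin 3 → ℤ) {F : R3 → E}
    (hF : IsSymbol F) (x : R3) :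
    ‖𝓕⁻ (IdealGas.boxed χ k F) x‖ₑ
      ≤ eLpNorm (𝓕⁻ (fun η => fat (relFreq 0 η))) (3 / 2) volume * boxNorm χ k F := by
  have h1 : IdealGas.boxed χ k F = fun η => fat (relFreq k η) • IdealGas.boxed χ k F η := by
    ext1 η
    simp only [IdealGas.boxed, smul_smul, hχ.fat_mul]
  have h2 := enorm_convolution_le (isSymbol_fat.comp_relFreq k).continuous_fourierInv
    (hF.boxed hχ k).continuous_fourierInv x
  rw [← (isSymbol_fat.comp_relFreq k).fourierInv_smul (hF.boxed hχ k), ← h1] at h2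
  refine h2.trans (le_of_eq ?_)
  congr 1
  exact eLpNorm_congr_enorm_ae (Filter.Eventually.of_forall
    fun x => enorm_fourierInv_comp_relFreq fat k x)

/-- Components of a symbol near far away lattice points vanish. -/
theorem abs_le_of_boxed_ne_zero (hχ : IsModulationWindow χ) {F : R3 → E} {r : ℝ}
    (hF : ∀ η, r < ‖η‖ → F η = 0)
    {k : Fin 3 → ℤ} {η : R3} (h : IdealGas.boxed χ k F η ≠ 0) (i : Fin 3) :
    |(k i : ℝ)| ≤ 2 * Real.pi * r + 2 := by
  have h1 : χ (relFreq k η) ≠ 0 := fun h' => h (by simp [IdealGas.boxed, h'])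
  have h2 : ‖η‖ ≤ r := by
    by_contra h'
    exact h (by simp [IdealGas.boxed, hF η (not_le.1 h')])
  have h3 := hχ.mem_Ico h1 i
  rw [relFreq_apply] at h3
  have h4 : |η i| ≤ r := (PiLp.norm_apply_le η i).trans h2
  have h5 : |2 * Real.pi * η i| ≤ 2 * Real.pi * r := by
    rw [abs_mul, abs_of_pos (by positivity : 0 < 2 * Real.pi)]
    gcongr
  rw [abs_le] at h5 ⊢
  constructor <;> linarith [h5.1, h5.2, h3.1, h3.2]

/-- The lattice points that meet the ball of radius `r` in frequency. -/
theorem exists_lattice_finset (hχ : IsModulationWindow χ) (r : ℝ) :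
    ∃ S : Finset (Fin 3 → ℤ), ∀ F : R3 → E,
    (∀ η, r < ‖η‖ → F η = 0) → ∀ k ∉ S, IdealGas.boxed χ k F = 0 := by
  obtain ⟨M, hM⟩ := exists_nat_ge (2 * Real.pi * r + 2)
  refine ⟨Fintype.piFinset fun _ => Finset.Icc (-(M : ℤ)) M, fun F hF k hk => ?_⟩
  by_contra h
  obtain ⟨η, hη⟩ := Function.ne_iff.1 h
  refine hk (Fintype.mem_piFinset.2 fun i => ?_)
  have h1 := (abs_le_of_boxed_ne_zero hχ hF hη i).trans hM
  rw [Finset.mem_Icc, ← abs_le]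
  exact_mod_cast h1

/-- The integer translates of `χ` sum to one, and only the finitely many boxes in `S` contribute. -/
theorem sum_boxed (hχ : IsModulationWindow χ) {F : R3 → E} {S : Finset (Fin 3 → ℤ)}
    (hS : ∀ k ∉ S, IdealGas.boxed χ k F = 0) (η : R3) :
    ∑ k ∈ S, IdealGas.boxed χ k F η = F η := by
  have h1 : HasSum (fun k => IdealGas.boxed χ k F η) ((1 : ℂ) • F η) :=
    (hχ.sum_eq ((2 * Real.pi) • η)).smul_const (F η)
  rw [one_smul] at h1
  exact (hasSum_sum_of_ne_finset_zero fun k hk => congrFun (hS k hk) η).unique h1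

end Window

/-! ### Estimates in the modulation space -/

section Estimates

variable {E : Type*} [NormedAddCommGroup E] [NormedSpace ℂ E] [CompleteSpace E] {χ : R3 → ℂ}

theorem boxNorm_add_le (hχ : IsModulationWindow χ) (k : Fin 3 → ℤ) {F G : R3 → E}
    (hF : IsSymbol F) (hG : IsSymbol G) :
    boxNorm χ k (fun η => F η + G η) ≤ boxNorm χ k F + boxNorm χ k G := by
  have h1 : boxed χ k (fun η => F η + G η) = fun η => boxed χ k F η + boxed χ k G η :=
    funext fun η => smul_add _ _ _
  rw [boxNorm, h1, show 𝓕⁻ (fun η => boxed χ k F η + boxed χ k G η) = _ from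
    funext fun x => (hF.boxed hχ k).fourierInv_add (hG.boxed hχ k) x]
  exact eLpNorm_add_le (hF.boxed hχ k).continuous_fourierInv.aestronglyMeasurable
    (hG.boxed hχ k).continuous_fourierInv.aestronglyMeasurable (by norm_num)

theorem boxNorm_clm_le (hχ : IsModulationWindow χ) (k : Fin 3 → ℤ) {F : R3 → E}
    {E' : Type*} [NormedAddCommGroup E'] [NormedSpace ℂ E'] [CompleteSpace E'] (T : E →L[ℂ] E')
    (hF : IsSymbol F) : boxNorm χ k (fun η => T (F η)) ≤ ‖T‖ₑ * boxNorm χ k F := by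
  have h1 : boxed χ k (fun η => T (F η)) = fun η => T (boxed χ k F η) :=
    funext fun η => (T.map_smul _ _).symm
  rw [boxNorm, h1, show 𝓕⁻ (fun η => T (boxed χ k F η)) = _ from
    funext fun x => (hF.boxed hχ k).fourierInv_clm T x]
  exact eLpNorm_le_mul_eLpNorm_of_ae_le_mul' (c := ‖T‖₊)
    (Filter.Eventually.of_forall fun x => T.le_opENorm _) 3

theorem boxNorm_le (hχ : IsModulationWindow χ) (k : Fin 3 → ℤ) {F : R3 → E} (hF : IsSymbol F) :
    boxNorm χ k F ≤ kernelNorm χ * eLpNorm (𝓕⁻ F) 3 volume :=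
  eLpNorm_multiplier_le hχ.isSymbol k hF

theorem boxNorm_eq_zero {k : Fin 3 → ℤ} {F : R3 → E} (h : boxed χ k F = 0) :
    boxNorm χ k F = 0 := by
  have : 𝓕⁻ (0 : R3 → E) = 0 := by
    ext; simp [Real.fourierInv_eq']
  rw [boxNorm, h, this, eLpNorm_zero]

/-- The norm of the kernels of first order operators on a frequency box. -/
def derivConst : ℝ≥0∞ :=
  ∑ i, kernelNorm (fun ζ => (ζ i : ℂ) • fat ζ) + ENNReal.ofReal (2 * Real.pi + 2)

theorem contDiff_coord (i : Fin 3) : ContDiff ℝ ∞ (fun ζ : R3 => ((ζ i : ℝ) : ℂ)) :=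
  Complex.ofRealCLM.contDiff.comp (EuclideanSpace.proj (𝕜 := ℝ) i).contDiff

theorem derivConst_lt_top : derivConst < ⊤ := by
  refine ENNReal.add_lt_top.2 ⟨ENNReal.sum_lt_top.2 fun i _ => ?_, ENNReal.ofReal_lt_top⟩
  exact kernelNorm_lt_top (isSymbol_fat.smul (contDiff_coord i))

/-- On the box at `k` write `2π η i` as `relFreq k η i` plus `k i`. The relative part, cut off by
`fat`, is a multiplier bounded uniformly in `k`. The constant `k i` is at most `(2π + 2) r` as soon
as the box meets the spectrum; boxes that miss it are treated separately. -/
theorem boxNorm_pd_le (hχ : IsModulationWindow χ) (k : Fin 3 → ℤ) {F : R3 → E} (hF : IsSymbol F)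
    {r : ℝ} (hr : 1 ≤ r) (hFr : ∀ η, r < ‖η‖ → F η = 0) (i : Fin 3) :
    boxNorm χ k (fun η => (2 * Real.pi * Complex.I * (η i : ℝ) : ℂ) • F η)
      ≤ derivConst * ENNReal.ofReal r * boxNorm χ k F := by
  by_cases h0 : boxed χ k F = 0
  · have : boxed χ k (fun η => (2 * Real.pi * Complex.I * (η i : ℝ) : ℂ) • F η) = 0 := by
      ext1 η
      have := congrFun h0 η
      rw [boxed] at this ⊢
      rw [smul_comm, this]
      simp
    rw [boxNorm_eq_zero this]
    exact zero_le
  obtain ⟨η₀, h₀⟩ := Function.ne_iff.1 h0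
  have hk := abs_le_of_boxed_ne_zero hχ hFr h₀ i
  have h1 : boxed χ k (fun η => (2 * Real.pi * Complex.I * (η i : ℝ) : ℂ) • F η) = fun η =>
      Complex.I • ((relFreq k η i : ℂ) • boxed χ k F η)
        + ((k i : ℂ) * Complex.I) • boxed χ k F η := by
    ext1 η
    simp only [boxed, relFreq_apply, smul_smul, ← add_smul]
    congr 1
    push_cast
    ring
  have hb := hF.boxed hχ k
  have hb' : IsSymbol (fun η => (relFreq k η i : ℂ) • boxed χ k F η) :=
    hb.smul ((contDiff_coord i).comp (contDiff_relFreq k))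
  rw [boxNorm, h1, show 𝓕⁻ (fun η => Complex.I • ((relFreq k η i : ℂ) • boxed χ k F η)
        + ((k i : ℂ) * Complex.I) • boxed χ k F η) = fun x =>
        Complex.I • 𝓕⁻ (fun η => (relFreq k η i : ℂ) • boxed χ k F η) x
          + ((k i : ℂ) * Complex.I) • 𝓕⁻ (boxed χ k F) x from funext fun x => by
      rw [(hb'.smul contDiff_const).fourierInv_add (hb.smul contDiff_const)]
      exact congrArg₂ (· + ·)
        (hb'.fourierInv_clm (Complex.I • ContinuousLinearMap.id ℂ E) x)
        (hb.fourierInv_clm (((k i : ℂ) * Complex.I) • ContinuousLinearMap.id ℂ E) x)]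
  refine (eLpNorm_add_le (hb'.continuous_fourierInv.const_smul _).aestronglyMeasurable
    (hb.continuous_fourierInv.const_smul _).aestronglyMeasurable (by norm_num)).trans ?_
  have e1 := eLpNorm_const_smul Complex.I
    (𝓕⁻ (fun η => (relFreq k η i : ℂ) • boxed χ k F η)) 3 (volume : Measure R3)
  have e2 := eLpNorm_const_smul ((k i : ℂ) * Complex.I) (𝓕⁻ (boxed χ k F)) 3 (volume : Measure R3)
  have e3 : ‖(k i : ℂ) * Complex.I‖ₑ ≤ ENNReal.ofReal ((2 * Real.pi + 2) * r) := by
    rw [← ofReal_norm]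
    refine ENNReal.ofReal_le_ofReal ?_
    rw [norm_mul, Complex.norm_I, mul_one, Complex.norm_intCast]
    nlinarith
  have e4 : ‖Complex.I‖ₑ = 1 := by rw [← ofReal_norm, Complex.norm_I, ENNReal.ofReal_one]
  have e5 := eLpNorm_boxed_le hχ (p := fun ζ => (ζ i : ℂ)) (contDiff_coord i) k hF
  have e6 : kernelNorm (fun ζ => (ζ i : ℂ) • fat ζ)
      ≤ (∑ i, kernelNorm (fun ζ => (ζ i : ℂ) • fat ζ)) * ENNReal.ofReal r := by
    refine (Finset.single_le_sum (f := fun i => kernelNorm (fun ζ => (ζ i : ℂ) • fat ζ))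
      (fun i _ => zero_le) (Finset.mem_univ i)).trans ?_
    exact le_mul_of_one_le_right' (by rw [← ENNReal.ofReal_one]; exact ENNReal.ofReal_le_ofReal hr)
  calc _ ≤ ‖Complex.I‖ₑ * eLpNorm (𝓕⁻ (fun η => (relFreq k η i : ℂ) • boxed χ k F η)) 3 volume
        + ‖(k i : ℂ) * Complex.I‖ₑ * boxNorm χ k F := add_le_add e1.le e2.le
    _ ≤ 1 * ((∑ i, kernelNorm (fun ζ => (ζ i : ℂ) • fat ζ)) * ENNReal.ofReal r * boxNorm χ k F)
        + ENNReal.ofReal ((2 * Real.pi + 2) * r) * boxNorm χ k F := by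
        rw [e4]
        gcongr
        exact e5.trans (by gcongr)
    _ = _ := by
        rw [derivConst, ENNReal.ofReal_mul (by positivity)]
        ring

/-- The constant in the product estimate. -/
def prodConst (χ : R3 → ℂ) : ℝ≥0∞ :=
  125 * (kernelNorm χ * eLpNorm (𝓕⁻ (fun η => fat (relFreq 0 η))) (3 / 2) volume)

theorem prodConst_lt_top (hχ : IsModulationWindow χ) : prodConst χ < ⊤ := by
  refine ENNReal.mul_lt_top (by simp) (ENNReal.mul_lt_top (kernelNorm_lt_top hχ.isSymbol) ?_)
  rw [← (isSymbol_fat.comp_relFreq 0).coe_fourierInv]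
  exact SchwartzMap.eLpNorm_lt_top _ _ _

theorem IsSymbol.fourierInv_sum {ι : Type*} (s : Finset ι) {F : ι → R3 → E}
    (hF : ∀ i ∈ s, IsSymbol (F i)) :
    IsSymbol (fun η => ∑ i ∈ s, F i η) ∧
      ∀ x, 𝓕⁻ (fun η => ∑ i ∈ s, F i η) x = ∑ i ∈ s, 𝓕⁻ (F i) x := by
  classical
  induction s using Finset.induction_on with
  | empty =>
    refine ⟨⟨by simpa using contDiff_const, HasCompactSupport.zero⟩, fun x => ?_⟩
    simp [Real.fourierInv_eq']
  | insert a s ha ih =>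
    have h1 := ih fun i hi => hF i (by simp [hi])
    have h2 := hF a (by simp)
    simp only [Finset.sum_insert ha]
    exact ⟨h2.add h1.1, fun x => by rw [h2.fourierInv_add h1.1, h1.2]⟩

theorem IsSymbol.bilin {E₁ E₂ : Type*} [NormedAddCommGroup E₁] [NormedSpace ℂ E₁]
    [NormedAddCommGroup E₂] [NormedSpace ℂ E₂] (B : E →L[ℂ] E₁ →L[ℂ] E₂)
    {F : R3 → E} {G : R3 → E₁} (hF : IsSymbol F) (hG : IsSymbol G) :
    IsSymbol (fun η => ∫ ζ, B (F ζ) (G (η - ζ))) := by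
  obtain ⟨r, -, hr⟩ := hF.exists_radius
  obtain ⟨r', -, hr'⟩ := hG.exists_radius
  have h1 : IsBandSymbol r (fun _ : ℝ => F) := ⟨hF.smooth.comp contDiff_snd, fun _ => hr⟩
  have h2 : IsBandSymbol r' (fun _ : ℝ => G) := ⟨hG.smooth.comp contDiff_snd, fun _ => hr'⟩
  exact (h1.bilin B h2).isSymbol 0

/-- The interaction of two frequency boxes. -/
theorem boxed_bilin_eq_zero (hχ : IsModulationWindow χ) {E₁ E₂ : Type*} [NormedAddCommGroup E₁]
    [NormedSpace ℂ E₁] [NormedAddCommGroup E₂] [NormedSpace ℂ E₂] (B : E →L[ℂ] E₁ →L[ℂ] E₂)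
    {F : R3 → E} {G : R3 → E₁} {k l m : Fin 3 → ℤ}
    (h : k - (l + m) ∉ Fintype.piFinset fun _ => Finset.Icc (-1 : ℤ) 3) :
    boxed χ k (fun η => ∫ ζ, B (boxed χ l F ζ) (boxed χ m G (η - ζ))) = 0 := by
  ext1 η
  by_cases hk : χ (relFreq k η) = 0
  · simp [boxed, hk]
  rw [boxed, show (∫ ζ, B (boxed χ l F ζ) (boxed χ m G (η - ζ))) = 0 from ?_, smul_zero]
  · rfl
  refine integral_eq_zero_of_ae (Filter.Eventually.of_forall fun ζ => ?_)
  by_cases hl : χ (relFreq l ζ) = 0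
  · simp [boxed, hl]
  by_cases hm : χ (relFreq m (η - ζ)) = 0
  · simp [boxed, hm]
  refine absurd (Fintype.mem_piFinset.2 fun i => ?_) h
  have h1 := hχ.mem_Ico hk i
  have h2 := hχ.mem_Ico hl i
  have h3 := hχ.mem_Ico hm i
  simp only [relFreq_apply, PiLp.sub_apply] at h1 h2 h3
  -- The coordinates of `k - (l + m)` are the relative frequencies of `l` and `m` added and that of
  -- `k` subtracted. All three lie in `[0, 2)`, so the result is in `(-2, 4)`, which leaves the five
  -- integers from `-1` to `3`.
  have h4 : (-2 : ℝ) < ((k - (l + m)) i : ℤ) := by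
    simp only [Pi.sub_apply, Pi.add_apply]; push_cast; linarith
  have h5 : (((k - (l + m)) i : ℤ) : ℝ) < 4 := by
    simp only [Pi.sub_apply, Pi.add_apply]; push_cast; linarith
  rw [Finset.mem_Icc]
  constructor
  · have : (-2 : ℤ) < (k - (l + m)) i := by exact_mod_cast h4
    omega
  · have : (k - (l + m)) i < (4 : ℤ) := by exact_mod_cast h5
    omega

/-- Products in the modulation space. -/
theorem tsum_boxNorm_bilin_le (hχ : IsModulationWindow χ) {E₁ E₂ : Type*} [NormedAddCommGroup E₁]
    [NormedSpace ℂ E₁] [CompleteSpace E₁] [NormedAddCommGroup E₂] [NormedSpace ℂ E₂]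
    [CompleteSpace E₂] (B : E →L[ℂ] E₁ →L[ℂ] E₂) {F : R3 → E} {G : R3 → E₁}
    (hF : IsSymbol F) (hG : IsSymbol G) :
    ∑' k, boxNorm χ k (fun η => ∫ ζ, B (F ζ) (G (η - ζ)))
      ≤ prodConst χ * ‖B‖ₑ * (∑' k, boxNorm χ k F) * ∑' k, boxNorm χ k G := by
  classical
  obtain ⟨r, -, hr⟩ := hF.exists_radius
  obtain ⟨r', -, hr'⟩ := hG.exists_radius
  obtain ⟨S, hS⟩ := exists_lattice_finset (E := E) hχ r
  obtain ⟨S', hS'⟩ := exists_lattice_finset (E := E₁) hχ r'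
  set D : Finset (Fin 3 → ℤ) := Fintype.piFinset fun _ => Finset.Icc (-1 : ℤ) 3 with hD
  set c := eLpNorm (𝓕⁻ (fun η => fat (relFreq 0 η))) (3 / 2) (volume : Measure R3)
  have hpiece : ∀ l m, IsSymbol (fun η => ∫ ζ, B (boxed χ l F ζ) (boxed χ m G (η - ζ))) :=
    fun l m => (hF.boxed hχ l).bilin B (hG.boxed hχ m)
  have hsum : (fun η => ∫ ζ, B (F ζ) (G (η - ζ))) = fun η => ∑ p ∈ S ×ˢ S',
      ∫ ζ, B (boxed χ p.1 F ζ) (boxed χ p.2 G (η - ζ)) := by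
    ext1 η
    rw [← integral_finsetSum]
    · refine integral_congr_ae (Filter.Eventually.of_forall fun ζ => ?_)
      simp only
      rw [← sum_boxed hχ (hS F hr) ζ, ← sum_boxed hχ (hS' G hr') (η - ζ), Finset.sum_product]
      simp only [map_sum, sum_apply]
      rw [Finset.sum_comm]
    · intro p _
      have h1 : Continuous fun ζ => B (boxed χ p.1 F ζ) (boxed χ p.2 G (η - ζ)) :=
        (B.continuous.comp (hF.boxed hχ p.1).continuous).clm_apply
          ((hG.boxed hχ p.2).continuous.comp (continuous_const.sub continuous_id))
      refine h1.integrable_of_hasCompactSupport ((hF.boxed hχ p.1).compact.mono fun ζ h h' => ?_)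
      exact h (by simp only; rw [h']; simp)
  have hbound : ∀ k l m, boxNorm χ k (fun η => ∫ ζ, B (boxed χ l F ζ) (boxed χ m G (η - ζ)))
      ≤ if k - (l + m) ∈ D then
        kernelNorm χ * c * ‖B‖ₑ * (boxNorm χ l F * boxNorm χ m G) else 0 := by
    intro k l m
    split_ifs with h
    -- The piece at `l` is kept in `L³`, and the piece at `m` is put into `L^∞` by Bernstein.
    · refine (boxNorm_le hχ k (hpiece l m)).trans ?_
      have h1 : eLpNorm (𝓕⁻ (fun η => ∫ ζ, B (boxed χ l F ζ) (boxed χ m G (η - ζ)))) 3 volume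
          ≤ (‖B‖ₑ * (c * boxNorm χ m G)) * boxNorm χ l F := by
        by_cases htop : ‖B‖ₑ * (c * boxNorm χ m G) = ⊤
        · exfalso
          refine ENNReal.mul_ne_top enorm_ne_top (ENNReal.mul_ne_top ?_
            (hG.boxed hχ m).eLpNorm_lt_top.ne) htop
          simp only [c]
          rw [← (isSymbol_fat.comp_relFreq 0).coe_fourierInv]
          exact (SchwartzMap.eLpNorm_lt_top _ _ _).ne
        lift ‖B‖ₑ * (c * boxNorm χ m G) to NNReal using htop with C hC
        refine eLpNorm_le_mul_eLpNorm_of_ae_le_mul' (Filter.Eventually.of_forall fun x => ?_) 3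
        rw [(hF.boxed hχ l).fourierInv_bilin B (hG.boxed hχ m), hC]
        have h2 := enorm_fourierInv_boxed_le hχ m hG x
        calc ‖B (𝓕⁻ (boxed χ l F) x) (𝓕⁻ (boxed χ m G) x)‖ₑ
            ≤ ‖B‖ₑ * ‖𝓕⁻ (boxed χ l F) x‖ₑ * ‖𝓕⁻ (boxed χ m G) x‖ₑ := by
              simp only [← ofReal_norm, ← ENNReal.ofReal_mul (norm_nonneg _),
                ← ENNReal.ofReal_mul (mul_nonneg (norm_nonneg _) (norm_nonneg _))]
              exact ENNReal.ofReal_le_ofReal (B.le_opNorm₂ _ _)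
          _ ≤ ‖B‖ₑ * ‖𝓕⁻ (boxed χ l F) x‖ₑ * (c * boxNorm χ m G) := by gcongr
          _ = _ := by ring
      calc _ ≤ kernelNorm χ * ((‖B‖ₑ * (c * boxNorm χ m G)) * boxNorm χ l F) := by gcongr
        _ = _ := by ring
    · exact (boxNorm_eq_zero (boxed_bilin_eq_zero hχ B h)).le
  have hbox : ∀ k, boxNorm χ k (fun η => ∫ ζ, B (F ζ) (G (η - ζ))) ≤ ∑ p ∈ S ×ˢ S',
      if k - (p.1 + p.2) ∈ D then
        kernelNorm χ * c * ‖B‖ₑ * (boxNorm χ p.1 F * boxNorm χ p.2 G) else 0 := by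
    intro k
    rw [hsum]
    refine le_trans ?_ (Finset.sum_le_sum fun p _ => hbound k p.1 p.2)
    have h1 : ∀ T : Finset ((Fin 3 → ℤ) × (Fin 3 → ℤ)), boxNorm χ k (fun η => ∑ p ∈ T,
        ∫ ζ, B (boxed χ p.1 F ζ) (boxed χ p.2 G (η - ζ))) ≤ ∑ p ∈ T,
        boxNorm χ k (fun η => ∫ ζ, B (boxed χ p.1 F ζ) (boxed χ p.2 G (η - ζ))) := by
      intro T
      induction T using Finset.induction_on with
      | empty =>
        simp only [Finset.sum_empty]
        exact (boxNorm_eq_zero (by ext; simp [boxed])).le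
      | insert a T ha ih =>
        simp only [Finset.sum_insert ha]
        exact (boxNorm_add_le hχ k (hpiece a.1 a.2) (IsSymbol.fourierInv_sum T
          fun p _ => hpiece p.1 p.2).1).trans (by gcongr)
    exact h1 _
  have hcard : D.card = 125 := by
    rw [hD, Fintype.card_piFinset]
    simp
  -- A given pair of boxes reaches at most `5³ = 125` output boxes, so summing over `k` costs only
  -- this constant.
  have hcount : ∀ (q : Fin 3 → ℤ) (a : ℝ≥0∞), ∑' k, (if k - q ∈ D then a else 0) = 125 * a := by
    intro q a
    have h1 := (Equiv.subRight q).tsum_eq (fun k => if k ∈ D then a else 0)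
    simp only [Equiv.subRight_apply] at h1
    rw [h1, tsum_eq_sum (s := D) (fun k hk => if_neg hk), Finset.sum_congr rfl fun k hk => if_pos hk]
    simp [hcard]
  calc ∑' k, boxNorm χ k (fun η => ∫ ζ, B (F ζ) (G (η - ζ)))
      ≤ ∑' k, ∑ p ∈ S ×ˢ S', if k - (p.1 + p.2) ∈ D then
        kernelNorm χ * c * ‖B‖ₑ * (boxNorm χ p.1 F * boxNorm χ p.2 G) else 0 :=
        ENNReal.tsum_le_tsum hbox
    _ = ∑ p ∈ S ×ˢ S', 125 *
        (kernelNorm χ * c * ‖B‖ₑ * (boxNorm χ p.1 F * boxNorm χ p.2 G)) := by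
        rw [Summable.tsum_finsetSum fun _ _ => ENNReal.summable]
        exact Finset.sum_congr rfl fun p _ => hcount _ _
    _ = prodConst χ * ‖B‖ₑ * (∑ l ∈ S, boxNorm χ l F) * ∑ m ∈ S', boxNorm χ m G := by
        rw [mul_assoc (prodConst χ * ‖B‖ₑ), Finset.sum_mul_sum, ← Finset.sum_product',
          Finset.mul_sum]
        refine Finset.sum_congr rfl fun p _ => ?_
        rw [prodConst]
        ring
    _ ≤ _ := by
        gcongr
        · exact ENNReal.sum_le_tsum S
        · exact ENNReal.sum_le_tsum S'

end Estimates

/-! ### Modulation norms of band-limited functions -/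

section BandNorms

variable {E : Type*} [NormedAddCommGroup E] [NormedSpace ℂ E] [CompleteSpace E] {χ : R3 → ℂ}

namespace IsBand

variable {r r' : ℝ} {f g : ℝ → R3 → E}

theorem modNorm_add_le (hχ : IsModulationWindow χ) (hf : IsBand r f) (hg : IsBand r' g) (t : ℝ) :
    modNorm χ (fun x => f t x + g t x) ≤ modNorm χ (f t) + modNorm χ (g t) := by
  obtain ⟨F, hF, rfl⟩ := hf.symbol
  obtain ⟨G, hG, rfl⟩ := hg.symbol
  have hF' := hF.isSymbol t
  have hG' := hG.isSymbol t
  rw [show (fun x => 𝓕⁻ (F t) x + 𝓕⁻ (G t) x) = _ from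
    funext fun x => (hF'.fourierInv_add hG' x).symm, modNorm_fourierInv χ (hF'.add hG'),
    modNorm_fourierInv χ hF', modNorm_fourierInv χ hG', ← ENNReal.tsum_add]
  exact ENNReal.tsum_le_tsum fun k => boxNorm_add_le hχ k hF' hG'

theorem modNorm_clm_le (hχ : IsModulationWindow χ) {E' : Type*} [NormedAddCommGroup E']
    [NormedSpace ℂ E'] [CompleteSpace E'] (T : E →L[ℂ] E') (hf : IsBand r f) (t : ℝ) :
    modNorm χ (fun x => T (f t x)) ≤ ‖T‖ₑ * modNorm χ (f t) := by
  obtain ⟨F, hF, rfl⟩ := hf.symbol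
  have hF' := hF.isSymbol t
  have hT : IsSymbol (fun η => T (F t η)) := (hF.op (S := fun _ _ => T) contDiff_const).isSymbol t
  rw [show (fun x => T (𝓕⁻ (F t) x)) = _ from
    funext fun x => (hF'.fourierInv_clm T x).symm, modNorm_fourierInv χ hT,
    modNorm_fourierInv χ hF', ← ENNReal.tsum_mul_left]
  exact ENNReal.tsum_le_tsum fun k => boxNorm_clm_le hχ k T hF'

theorem modNorm_const_smul_le (hχ : IsModulationWindow χ) (c : ℂ) (hf : IsBand r f) (t : ℝ) :
    modNorm χ (fun x => c • f t x) ≤ ‖c‖ₑ * modNorm χ (f t) := by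
  refine (hf.modNorm_clm_le hχ (c • ContinuousLinearMap.id ℂ E) t).trans ?_
  gcongr
  rw [← ofReal_norm, ← ofReal_norm]
  refine ENNReal.ofReal_le_ofReal (ContinuousLinearMap.opNorm_le_bound _ (norm_nonneg _) fun x => ?_)
  simp [norm_smul]

theorem modNorm_neg_le (hχ : IsModulationWindow χ) (hf : IsBand r f) (t : ℝ) :
    modNorm χ (fun x => - f t x) ≤ modNorm χ (f t) := by
  simpa using hf.modNorm_const_smul_le hχ (-1) t

theorem modNorm_sub_le (hχ : IsModulationWindow χ) (hf : IsBand r f) (hg : IsBand r' g) (t : ℝ) :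
    modNorm χ (fun x => f t x - g t x) ≤ modNorm χ (f t) + modNorm χ (g t) := by
  have := (hf.modNorm_add_le hχ hg.neg t).trans (add_le_add_right (hg.modNorm_neg_le hχ t) _)
  simpa only [sub_eq_add_neg] using this

theorem modNorm_zero (χ : R3 → ℂ) : modNorm χ (fun _ => (0 : E)) = 0 := by
  have h1 : IsSymbol (fun _ : R3 => (0 : E)) := IsSymbol.of_support contDiff_const 0 fun _ _ => rfl
  have h2 : (fun _ => (0 : E)) = 𝓕⁻ (fun _ : R3 => (0 : E)) := by
    ext; simp [Real.fourierInv_eq']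
  rw [h2, modNorm_fourierInv χ h1]
  exact ENNReal.tsum_eq_zero.2 fun k => boxNorm_eq_zero (by ext; simp [boxed])

theorem modNorm_sum_le (hχ : IsModulationWindow χ) {ι : Type*} (s : Finset ι)
    {f : ι → ℝ → R3 → E} (hf : ∀ i ∈ s, IsBand r (f i)) (t : ℝ) :
    modNorm χ (fun x => ∑ i ∈ s, f i t x) ≤ ∑ i ∈ s, modNorm χ (f i t) := by
  classical
  induction s using Finset.induction_on with
  | empty => simp [modNorm_zero]
  | insert a s ha ih =>
    simp only [Finset.sum_insert ha]
    have h1 : ∀ i ∈ s, IsBand r (f i) := fun i hi => hf i (by simp [hi])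
    exact ((hf a (by simp)).modNorm_add_le hχ (IsBand.sum s h1) t).trans
      (add_le_add_right (ih h1) _)

/-- A derivative costs the bandwidth. -/
theorem modNorm_pd_le (hχ : IsModulationWindow χ) (hr : 1 ≤ r) (hf : IsBand r f) (i : Fin 3)
    (t : ℝ) :
    modNorm χ (IdealGas.pd i (f t)) ≤ derivConst * ENNReal.ofReal r * modNorm χ (f t) := by
  obtain ⟨F, hF, rfl⟩ := hf.symbol
  have hF' := hF.isSymbol t
  have h1 : IsSymbol fun η => (2 * Real.pi * Complex.I * (η i : ℝ) : ℂ) • F t η :=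
    hF'.smul (contDiff_const.mul (contDiff_coord i))
  rw [hF'.pd_fourierInv i, modNorm_fourierInv χ h1, modNorm_fourierInv χ hF',
    ← ENNReal.tsum_mul_left]
  exact ENNReal.tsum_le_tsum fun k => boxNorm_pd_le hχ k hF' hr (hF.supp t) i

/-- The modulation space is an algebra. -/
theorem modNorm_bilin_le (hχ : IsModulationWindow χ) {E₁ E₂ : Type*} [NormedAddCommGroup E₁]
    [NormedSpace ℂ E₁] [CompleteSpace E₁] [NormedAddCommGroup E₂] [NormedSpace ℂ E₂]
    [CompleteSpace E₂] (B : E →L[ℂ] E₁ →L[ℂ] E₂) {h : ℝ → R3 → E₁} (hf : IsBand r f)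
    (hh : IsBand r' h) (t : ℝ) :
    modNorm χ (fun x => B (f t x) (h t x))
      ≤ prodConst χ * ‖B‖ₑ * modNorm χ (f t) * modNorm χ (h t) := by
  obtain ⟨F, hF, rfl⟩ := hf.symbol
  obtain ⟨H, hH, rfl⟩ := hh.symbol
  have hF' := hF.isSymbol t
  have hH' := hH.isSymbol t
  rw [show (fun x => B (𝓕⁻ (F t) x) (𝓕⁻ (H t) x)) = _ from
    funext fun x => (hF'.fourierInv_bilin B hH' x).symm, modNorm_fourierInv χ (hF'.bilin B hH'),
    modNorm_fourierInv χ hF', modNorm_fourierInv χ hH']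
  exact tsum_boxNorm_bilin_le hχ B hF' hH'

theorem modNorm_smul_le (hχ : IsModulationWindow χ) {a : ℝ → R3 → ℂ} (ha : IsBand r a)
    (hf : IsBand r' f) (t : ℝ) :
    modNorm χ (fun x => a t x • f t x) ≤ prodConst χ * modNorm χ (a t) * modNorm χ (f t) := by
  refine (ha.modNorm_bilin_le hχ (ContinuousLinearMap.lsmul ℂ ℂ) hf t).trans ?_
  have : ‖(ContinuousLinearMap.lsmul ℂ ℂ : ℂ →L[ℂ] E →L[ℂ] E)‖ₑ ≤ 1 := by
    rw [← ofReal_norm, ← ENNReal.ofReal_one]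
    exact ENNReal.ofReal_le_ofReal ContinuousLinearMap.opNorm_lsmul_le
  calc _ ≤ prodConst χ * 1 * modNorm χ (a t) * modNorm χ (f t) := by gcongr
    _ = _ := by rw [mul_one]

theorem smul {a : ℝ → R3 → ℂ} (ha : IsBand r a) (hf : IsBand r' f) :
    IsBand (r + r') (fun t x => a t x • f t x) :=
  ha.bilin (ContinuousLinearMap.lsmul ℂ ℂ : ℂ →L[ℂ] E →L[ℂ] E) hf

end IsBand

theorem IsBandSymbol.boxed {r : ℝ} {F : ℝ → R3 → E} (hF : IsBandSymbol r F)
    (hχ : IsModulationWindow χ) (k : Fin 3 → ℤ) :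
    IsBandSymbol r (fun t => IdealGas.boxed χ k (F t)) :=
  hF.smul (m := fun _ η => χ (relFreq k η))
    ((hχ.smooth.comp (contDiff_relFreq k)).comp contDiff_snd)

theorem IsBandSymbol.measurable_eLpNorm {r : ℝ} {F : ℝ → R3 → E} (hF : IsBandSymbol r F) :
    Measurable (fun t => eLpNorm (𝓕⁻ (F t)) 3 volume) := by
  simp only [eLpNorm_three]
  refine Measurable.pow_const ?_ _
  exact Measurable.lintegral_prod_right' (f := fun p : ℝ × R3 => ‖𝓕⁻ (F p.1) p.2‖ₑ ^ 3)
    (hF.contDiff_fourierInv.continuous.enorm.measurable.pow_const 3)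

theorem IsBandSymbol.measurable_boxNorm {r : ℝ} {F : ℝ → R3 → E} (hF : IsBandSymbol r F)
    (hχ : IsModulationWindow χ) (k : Fin 3 → ℤ) : Measurable (fun t => boxNorm χ k (F t)) :=
  (hF.boxed hχ k).measurable_eLpNorm

theorem IsBand.measurable_modNorm (hχ : IsModulationWindow χ) {r : ℝ} {f : ℝ → R3 → E}
    (hf : IsBand r f) : Measurable (fun t => modNorm χ (f t)) := by
  obtain ⟨F, hF, rfl⟩ := hf.symbol
  simp only [modNorm_fourierInv χ (hF.isSymbol _)]
  exact Measurable.tsum fun k => hF.measurable_boxNorm hχ k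

/-- Minkowski's inequality for time integrals of band-limited functions. -/
theorem IsBand.modNorm_integral_le (hχ : IsModulationWindow χ) {r : ℝ} {f : ℝ → R3 → E}
    (hf : IsBand r f) {t : ℝ} (ht : 0 ≤ t) :
    modNorm χ (fun x => ∫ s in (0 : ℝ)..t, f s x) ≤ modNormL1 χ t f := by
  obtain ⟨F, hF, rfl⟩ := hf.symbol
  rw [show (fun x => ∫ s in (0 : ℝ)..t, 𝓕⁻ (F s) x) = _ from
    funext fun x => (hF.fourierInv_primitive t x).symm,
    modNorm_fourierInv χ (hF.primitive.isSymbol t), modNormL1]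
  simp only [modNorm_fourierInv χ (hF.isSymbol _)]
  rw [lintegral_tsum fun k => (hF.measurable_boxNorm hχ k).aemeasurable]
  refine ENNReal.tsum_le_tsum fun k => ?_
  have hb := hF.boxed hχ k
  have h1 : IdealGas.boxed χ k (fun η => ∫ s in (0 : ℝ)..t, F s η)
      = fun η => ∫ s in (0 : ℝ)..t, IdealGas.boxed χ k (F s) η :=
    funext fun η => (intervalIntegral.integral_smul _ _).symm
  rw [boxNorm, h1, restrict_Ioo_eq_restrict_Ioc]
  refine eLpNorm_three_le_lintegral _ volume (f := fun s x => 𝓕⁻ (IdealGas.boxed χ k (F s)) x)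
    hb.contDiff_fourierInv.continuous.enorm.measurable fun x => ?_
  rw [hb.fourierInv_primitive t x, intervalIntegral.integral_of_le ht]
  exact enorm_integral_le_lintegral_enorm _

end BandNorms

/-! ### Linear evolution equations with constant coefficients -/

section Propagator

variable {E : Type*} [NormedAddCommGroup E] [InnerProductSpace ℂ E] [CompleteSpace E]

/-- The propagator `exp (-tA)`. -/
def propagator (A : E →L[ℂ] E) (t : ℝ) : E →L[ℂ] E := NormedSpace.exp (t • (-A))

@[simp] theorem propagator_zero (A : E →L[ℂ] E) : propagator A 0 = 1 := by
  simp [propagator]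

theorem hasDerivAt_propagator (A : E →L[ℂ] E) (t : ℝ) :
    HasDerivAt (propagator A) (propagator A t * (-A)) t :=
  hasDerivAt_exp_smul_const (-A) t

theorem hasDerivAt_propagator' (A : E →L[ℂ] E) (t : ℝ) :
    HasDerivAt (propagator A) ((-A) * propagator A t) t :=
  hasDerivAt_exp_smul_const' (-A) t

theorem propagator_add (A : E →L[ℂ] E) (s t : ℝ) :
    propagator A (s + t) = propagator A s * propagator A t := by
  rw [propagator, propagator, propagator, add_smul]
  let _ := NormedAlgebra.restrictScalars ℚ ℝ (E →L[ℂ] E)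
  exact NormedSpace.exp_add_of_commute
    (((Commute.refl (-A)).smul_left s).smul_right t)

theorem hasDerivAt_apply {S : ℝ → E →L[ℂ] E} {S' : E →L[ℂ] E} {u : ℝ → E} {u' : E} {t : ℝ}
    (hS : HasDerivAt S S' t) (hu : HasDerivAt u u' t) :
    HasDerivAt (fun s => S s (u s)) (S' (u t) + S t u') t := by
  have h1 : HasDerivAt (fun s => (S s).restrictScalars ℝ) (S'.restrictScalars ℝ) t :=
    (ContinuousLinearMap.restrictScalarsL ℂ E E ℝ ℝ).hasFDerivAt.comp_hasDerivAt t hS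
  exact h1.clm_apply hu

/-- Decay of the propagator of a coercive operator. -/
theorem norm_propagator_apply_le {A : E →L[ℂ] E} {c : ℝ}
    (hA : ∀ v, c * ‖v‖ ^ 2 ≤ (inner ℂ v (A v)).re) {t : ℝ} (ht : 0 ≤ t) (v : E) :
    ‖propagator A t v‖ ≤ Real.exp (-(c * t)) * ‖v‖ := by
  have hu : ∀ s, HasDerivAt (fun s => propagator A s v) (-(A (propagator A s v))) s := fun s => by
    simpa using hasDerivAt_apply (hasDerivAt_propagator' A s) (hasDerivAt_const s v)
  have hn : ∀ s, HasDerivAt (fun s => ‖propagator A s v‖ ^ 2)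
      (-2 * (inner ℂ (propagator A s v) (A (propagator A s v))).re) s := fun s => by
    have h1 := (hu s).inner ℂ (hu s)
    have h2 := Complex.reCLM.hasFDerivAt.comp_hasDerivAt s h1
    have h3 : (Complex.reCLM ∘ fun t => inner ℂ (propagator A t v) (propagator A t v))
        = fun s => ‖propagator A s v‖ ^ 2 := by
      ext s
      simp only [Function.comp, Complex.reCLM_apply]
      exact inner_self_eq_norm_sq (𝕜 := ℂ) _
    rw [h3] at h2
    refine HasDerivAt.congr_deriv (f' := (inner ℂ (propagator A s v) (-(A (propagator A s v)))
      + inner ℂ (-(A (propagator A s v))) (propagator A s v)).re) h2 ?_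
    rw [inner_neg_left, inner_neg_right, Complex.add_re, Complex.neg_re, Complex.neg_re]
    have : (inner ℂ (A (propagator A s v)) (propagator A s v)).re
        = (inner ℂ (propagator A s v) (A (propagator A s v))).re := inner_re_symm (𝕜 := ℂ) _ _
    rw [this]; ring
  have hφ : ∀ s, HasDerivAt (fun s => Real.exp (2 * c * s) * ‖propagator A s v‖ ^ 2)
      (Real.exp (2 * c * s) * (2 * c) * ‖propagator A s v‖ ^ 2 + Real.exp (2 * c * s) *
        (-2 * (inner ℂ (propagator A s v) (A (propagator A s v))).re)) s := fun s => by
    have h1 : HasDerivAt (fun s => Real.exp (2 * c * s)) (Real.exp (2 * c * s) * (2 * c)) s := by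
      simpa using ((hasDerivAt_id s).const_mul (2 * c)).exp
    exact h1.mul (hn s)
  -- By coercivity, `exp (2cs)` times the squared norm does not increase along the flow.
  have hanti : Antitone (fun s => Real.exp (2 * c * s) * ‖propagator A s v‖ ^ 2) := by
    refine antitone_of_hasDerivAt_nonpos hφ fun s => ?_
    have := hA (propagator A s v)
    have he := Real.exp_pos (2 * c * s)
    change _ ≤ (0 : ℝ)
    nlinarith
  have h := hanti ht
  simp only [mul_zero, Real.exp_zero, propagator_zero, one_apply_eq_self, one_mul] at h
  have he : Real.exp (2 * c * t) = Real.exp (c * t) ^ 2 := by rw [← Real.exp_nat_mul]; ring_nf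
  rw [he, ← mul_pow] at h
  have h2 := abs_le_of_sq_le_sq h (norm_nonneg v)
  rw [Real.exp_neg, inv_mul_eq_div, le_div_iff₀ (Real.exp_pos _), mul_comm]
  exact (le_abs_self _).trans h2

/-- Duhamel's formula. -/
theorem eq_duhamel (A : E →L[ℂ] E) {v h : ℝ → E} (hh : Continuous h)
    (hv : ∀ s, HasDerivAt v (-(A (v s)) + h s) s) (t : ℝ) :
    v t = propagator A t (v 0) + ∫ s in (0 : ℝ)..t, propagator A (t - s) (h s) := by
  have hS : Continuous (propagator A) :=
    continuous_iff_continuousAt.2 fun s => (hasDerivAt_propagator A s).continuousAt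
  -- In the derivative of `propagator A (t - s) (v s)` the two terms containing `A` cancel, and only
  -- the source remains.
  have hd : ∀ s, HasDerivAt (fun s => propagator A (t - s) (v s))
      (propagator A (t - s) (h s)) s := by
    intro s
    have h1 : HasDerivAt (fun s => propagator A (t - s)) (propagator A (t - s) * A) s := by
      have := (hasDerivAt_propagator A (t - s)).scomp s ((hasDerivAt_id s).const_sub t)
      simpa [Function.comp_def] using this
    have h2 := hasDerivAt_apply h1 (hv s)
    simpa using h2
  have := intervalIntegral.integral_eq_sub_of_hasDerivAt (a := 0) (b := t)
    (fun s _ => hd s)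
    (((hS.comp (continuous_const.sub continuous_id)).clm_apply hh).intervalIntegrable _ _)
  rw [this]
  simp

/-- Joint smoothness of the propagator in time and in parameters. -/
theorem contDiff_propagator {P : Type*} [NormedAddCommGroup P] [NormedSpace ℝ P]
    {A : P → E →L[ℂ] E} (hA : ContDiff ℝ ∞ A) {τ : P → ℝ} (hτ : ContDiff ℝ ∞ τ) :
    ContDiff ℝ ∞ (fun p => propagator (A p) (τ p)) := by
  have hexp : ContDiff ℝ ∞ (NormedSpace.exp : (E →L[ℂ] E) → (E →L[ℂ] E)) :=
    contDiff_iff_contDiffAt.2 fun x => (NormedSpace.exp_analytic (𝕂 := ℝ) x).contDiffAt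
  exact hexp.comp (hτ.smul hA.neg)

end Propagator

/-! ### A weighted Volterra inequality -/

section Volterra

/-- The weight `exp (-at)` with values in `[0,∞]`. -/
def expWeight (a t : ℝ) : ℝ≥0∞ := ENNReal.ofReal (Real.exp (-(a * t)))

theorem measurable_expWeight (a : ℝ) : Measurable (expWeight a) := by
  unfold expWeight; fun_prop

theorem expWeight_le_one {a t : ℝ} (ha : 0 ≤ a) (ht : 0 ≤ t) : expWeight a t ≤ 1 := by
  rw [expWeight, ← ENNReal.ofReal_one]
  exact ENNReal.ofReal_le_ofReal (Real.exp_le_one_iff.2 (by nlinarith))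

theorem lintegral_expWeight_le {a : ℝ} (ha : 0 < a) (s : ℝ) :
    ∫⁻ t in Set.Ioi s, expWeight a (t - s) ≤ ENNReal.ofReal a⁻¹ := by
  have h1 : ∀ t, expWeight a (t - s) = ENNReal.ofReal (Real.exp (a * s) * Real.exp (-a * t)) :=
    fun t => by rw [expWeight, ← Real.exp_add]; ring_nf
  simp only [h1]
  have h2 : IntegrableOn (fun t => Real.exp (a * s) * Real.exp (-a * t)) (Set.Ioi s) :=
    (exp_neg_integrableOn_Ioi s ha).const_mul _
  rw [← ofReal_integral_eq_lintegral_ofReal h2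
    (Filter.Eventually.of_forall fun t => by positivity)]
  refine ENNReal.ofReal_le_ofReal (le_of_eq ?_)
  rw [integral_const_mul, integral_exp_mul_Ioi (by linarith) s]
  have : Real.exp (a * s) * Real.exp (-a * s) = 1 := by rw [← Real.exp_add]; simp
  rw [neg_mul] at this ⊢
  field_simp
  linarith

/-- If `y` is bounded by the response of an exponentially damped system to a source that contains
a small multiple of `y`, then `y` and its integral are controlled by the data. -/
theorem volterra_bound {y g : ℝ → ℝ≥0∞} (hy : Measurable y) (hg : Measurable g) {y₀ : ℝ≥0∞}
    {a b T : ℝ} (ha : 0 < a) (hab : 2 * b ≤ a) (hT : 0 ≤ T)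
    (h : ∀ t ∈ Set.Icc 0 T, y t ≤ expWeight a t * y₀ +
      ∫⁻ s in Set.Ioo 0 t, expWeight a (t - s) * (g s + ENNReal.ofReal b * y s))
    (hfin : ∫⁻ s in Set.Ioo 0 T, y s ≠ ⊤) :
    y T ≤ 2 * (y₀ + ∫⁻ s in Set.Ioo 0 T, g s) ∧
      ∫⁻ s in Set.Ioo 0 T, y s ≤
        ENNReal.ofReal (2 / a) * (y₀ + ∫⁻ s in Set.Ioo 0 T, g s) := by
  set Y := ∫⁻ s in Set.Ioo 0 T, y s with hY
  set I := ∫⁻ s in Set.Ioo 0 T, g s with hI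
  have hG : Measurable (fun s => g s + ENNReal.ofReal b * y s) := hg.add (hy.const_mul _)
  have hGint : ∫⁻ s in Set.Ioo 0 T, (g s + ENNReal.ofReal b * y s) = I + ENNReal.ofReal b * Y := by
    rw [lintegral_add_left hg, lintegral_const_mul _ hy]
  -- Young's inequality in time: after exchanging the integrals, the kernel contributes its `L¹`
  -- norm, at most `1/a`.
  have hdouble : ∫⁻ t in Set.Ioo 0 T, ∫⁻ s in Set.Ioo 0 t,
      expWeight a (t - s) * (g s + ENNReal.ofReal b * y s)
      ≤ ENNReal.ofReal a⁻¹ * (I + ENNReal.ofReal b * Y) := by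
    have h1 : ∀ t ∈ Set.Ioo 0 T, ∫⁻ s in Set.Ioo 0 t,
        expWeight a (t - s) * (g s + ENNReal.ofReal b * y s) = ∫⁻ s in Set.Ioo 0 T,
        Set.indicator {q : ℝ × ℝ | q.2 < q.1}
          (fun q => expWeight a (q.1 - q.2) * (g q.2 + ENNReal.ofReal b * y q.2)) (t, s) := by
      intro t ht
      rw [← lintegral_indicator measurableSet_Ioo, ← lintegral_indicator measurableSet_Ioo]
      refine lintegral_congr fun s => ?_
      simp only [Set.indicator_apply, Set.mem_Ioo, Set.mem_ofPred_eq]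
      have := ht.2
      by_cases h1 : 0 < s <;> by_cases h2 : s < t
      · simp [h1, h2, h2.trans this]
      · simp [h2]
      · simp [h1]
      · simp [h1]
    rw [setLIntegral_congr_fun measurableSet_Ioo h1, lintegral_lintegral_swap]
    · rw [← hGint, ← lintegral_const_mul _ hG]
      refine lintegral_mono fun s => ?_
      calc _ ≤ ∫⁻ t, Set.indicator (Set.Ioi s) (fun t => expWeight a (t - s) *
            (g s + ENNReal.ofReal b * y s)) t := by
            refine (setLIntegral_le_lintegral _ _).trans (lintegral_mono fun t => le_of_eq ?_)
            simp [Set.indicator_apply]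
        _ = (∫⁻ t in Set.Ioi s, expWeight a (t - s)) * (g s + ENNReal.ofReal b * y s) := by
            rw [lintegral_indicator measurableSet_Ioi, lintegral_mul_const]
            exact (measurable_expWeight a).comp (measurable_id.sub_const s)
        _ ≤ _ := by
            gcongr
            exact lintegral_expWeight_le ha s
    · refine (Measurable.indicator ?_ (measurableSet_lt measurable_snd measurable_fst)).aemeasurable
      exact ((measurable_expWeight a).comp (measurable_fst.sub measurable_snd)).mul
        (hG.comp measurable_snd)
  have hY1 : Y ≤ ENNReal.ofReal a⁻¹ * y₀ + ENNReal.ofReal a⁻¹ * (I + ENNReal.ofReal b * Y) := by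
    calc Y ≤ ∫⁻ t in Set.Ioo 0 T, (expWeight a t * y₀ + ∫⁻ s in Set.Ioo 0 t,
          expWeight a (t - s) * (g s + ENNReal.ofReal b * y s)) :=
          setLIntegral_mono' measurableSet_Ioo fun t ht => h t ⟨ht.1.le, ht.2.le⟩
      _ = (∫⁻ t in Set.Ioo 0 T, expWeight a t * y₀) + ∫⁻ t in Set.Ioo 0 T, ∫⁻ s in Set.Ioo 0 t,
          expWeight a (t - s) * (g s + ENNReal.ofReal b * y s) :=
          lintegral_add_left ((measurable_expWeight a).mul_const _) _
      _ ≤ _ := by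
          refine add_le_add ?_ hdouble
          rw [lintegral_mul_const _ (measurable_expWeight a)]
          gcongr
          refine (lintegral_mono_set Set.Ioo_subset_Ioi_self).trans ?_
          simpa using lintegral_expWeight_le ha 0
  -- The condition `2b ≤ a` makes the feedback at most half of `Y`, so it can be absorbed.
  have hsmall : ENNReal.ofReal a⁻¹ * ENNReal.ofReal b ≤ 2⁻¹ := by
    rw [← ENNReal.ofReal_mul (by positivity)]
    have : a⁻¹ * b ≤ 2⁻¹ := by
      rw [inv_mul_eq_div, div_le_iff₀ ha]; linarith
    refine (ENNReal.ofReal_le_ofReal this).trans (le_of_eq ?_)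
    rw [ENNReal.ofReal_inv_of_pos (by norm_num)]; simp
  have hYbound : Y ≤ ENNReal.ofReal (2 / a) * (y₀ + I) := by
    have h1 : Y ≤ ENNReal.ofReal a⁻¹ * (y₀ + I) + 2⁻¹ * Y := by
      calc Y ≤ _ := hY1
        _ = ENNReal.ofReal a⁻¹ * (y₀ + I) + (ENNReal.ofReal a⁻¹ * ENNReal.ofReal b) * Y := by ring
        _ ≤ _ := by gcongr
    have h2 : 2⁻¹ * Y ≤ ENNReal.ofReal a⁻¹ * (y₀ + I) := by
      -- Cancelling half of `Y` in `[0,∞]` requires it to be finite, which is the purpose of `hfin`.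
      have h3 : 2⁻¹ * Y ≠ ⊤ := ENNReal.mul_ne_top (by simp) hfin
      have h4 : 2⁻¹ * Y + 2⁻¹ * Y = Y := by
        rw [← add_mul, ENNReal.inv_two_add_inv_two, one_mul]
      rw [← ENNReal.add_le_add_iff_right h3, h4]
      exact h1
    calc Y = 2 * (2⁻¹ * Y) := by
          rw [← mul_assoc, ENNReal.mul_inv_cancel (by simp) (by simp), one_mul]
      _ ≤ 2 * (ENNReal.ofReal a⁻¹ * (y₀ + I)) := by gcongr
      _ = _ := by
          rw [div_eq_mul_inv, ENNReal.ofReal_mul (by norm_num), ENNReal.ofReal_ofNat]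
          ring
  refine ⟨?_, hYbound⟩
  calc y T ≤ _ := h T ⟨hT, le_rfl⟩
    _ ≤ 1 * y₀ + ∫⁻ s in Set.Ioo 0 T, 1 * (g s + ENNReal.ofReal b * y s) := by
        refine add_le_add (by gcongr; exact expWeight_le_one ha.le hT) ?_
        refine setLIntegral_mono' measurableSet_Ioo fun s hs => ?_
        gcongr
        exact expWeight_le_one ha.le (by linarith [hs.2])
    _ = y₀ + I + ENNReal.ofReal b * Y := by simp only [one_mul, hGint]; ring
    _ ≤ y₀ + I + ENNReal.ofReal b * (ENNReal.ofReal (2 / a) * (y₀ + I)) := by gcongr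
    _ = y₀ + I + (2 * (ENNReal.ofReal a⁻¹ * ENNReal.ofReal b)) * (y₀ + I) := by
        rw [div_eq_mul_inv, ENNReal.ofReal_mul (by norm_num), ENNReal.ofReal_ofNat]
        ring
    _ ≤ y₀ + I + (2 * 2⁻¹) * (y₀ + I) := by gcongr
    _ = 2 * (y₀ + I) := by
        rw [ENNReal.mul_inv_cancel (by simp) (by simp)]; ring

end Volterra

/-! ### Evolution on a frequency box -/

section BoxEvolution

variable {E : Type*} [NormedAddCommGroup E] [InnerProductSpace ℂ E] [CompleteSpace E] {χ : R3 → ℂ}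

/-- The `L³` norm of the inverse Fourier transform. -/
def hatNorm (F : R3 → E) : ℝ≥0∞ := eLpNorm (𝓕⁻ F) 3 volume

theorem hatNorm_add_le {F G : R3 → E} (hF : IsSymbol F) (hG : IsSymbol G) :
    hatNorm (fun η => F η + G η) ≤ hatNorm F + hatNorm G := by
  rw [hatNorm, show 𝓕⁻ (fun η => F η + G η) = _ from funext fun x => hF.fourierInv_add hG x]
  exact eLpNorm_add_le hF.continuous_fourierInv.aestronglyMeasurable
    hG.continuous_fourierInv.aestronglyMeasurable (by norm_num)

theorem hatNorm_sum_le {ι : Type*} (s : Finset ι) {F : ι → R3 → E}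
    (hF : ∀ i ∈ s, IsSymbol (F i)) :
    hatNorm (fun η => ∑ i ∈ s, F i η) ≤ ∑ i ∈ s, hatNorm (F i) := by
  rw [hatNorm, show 𝓕⁻ (fun η => ∑ i ∈ s, F i η) = ∑ i ∈ s, 𝓕⁻ (F i) from
    funext fun x => by rw [(IsSymbol.fourierInv_sum s hF).2 x, Finset.sum_apply]]
  exact eLpNorm_sum_le (fun i hi => (hF i hi).continuous_fourierInv.aestronglyMeasurable)
    (by norm_num)

theorem hatNorm_clm_le (T : E →L[ℂ] E) {F : R3 → E} (hF : IsSymbol F) :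
    hatNorm (fun η => T (F η)) ≤ ‖T‖ₑ * hatNorm F := by
  rw [hatNorm, show 𝓕⁻ (fun η => T (F η)) = _ from funext fun x => hF.fourierInv_clm T x]
  exact eLpNorm_le_mul_eLpNorm_of_ae_le_mul' (c := ‖T‖₊)
    (Filter.Eventually.of_forall fun x => T.le_opENorm _) 3

theorem hatNorm_const_smul_le (c : ℂ) {F : R3 → E} (hF : IsSymbol F) :
    hatNorm (fun η => c • F η) ≤ ‖c‖ₑ * hatNorm F := by
  have := hatNorm_clm_le (c • ContinuousLinearMap.id ℂ E) hF
  refine this.trans ?_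
  gcongr
  rw [← ofReal_norm, ← ofReal_norm]
  refine ENNReal.ofReal_le_ofReal (ContinuousLinearMap.opNorm_le_bound _ (norm_nonneg _) fun x => ?_)
  simp [norm_smul]

/-- The `L³` norms of a band-limited function are bounded on bounded time intervals. -/
theorem IsBandSymbol.exists_hatNorm_le {r : ℝ} {F : ℝ → R3 → E} (hF : IsBandSymbol r F) (T : ℝ) :
    ∃ C : NNReal, ∀ t ∈ Set.Icc 0 T, hatNorm (F t) ≤ C := by
  obtain ⟨M, hM⟩ := ((isCompact_Icc (a := (0 : ℝ)) (b := T)).prod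
    (isCompact_closedBall (0 : R3) r)).exists_bound_of_continuousOn
    hF.smooth.continuous.continuousOn
  set m := max M 0
  have hb : ∀ t ∈ Set.Icc 0 T, ∀ η,
      ‖F t η‖ ≤ (Metric.closedBall (0 : R3) r).indicator (fun _ => m) η := by
    intro t ht η
    by_cases h : η ∈ Metric.closedBall (0 : R3) r
    · rw [Set.indicator_of_mem h]
      exact (hM (t, η) ⟨ht, h⟩).trans (le_max_left _ _)
    · rw [Set.indicator_of_notMem h, hF.supp t η (by simpa using h)]
      simp
  set vol := (volume (Metric.closedBall (0 : R3) r)).toReal with hvol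
  have hmeas := measurableSet_closedBall (x := (0 : R3)) (ε := r)
  have hfin : volume (Metric.closedBall (0 : R3) r) ≠ ⊤ := measure_closedBall_lt_top.ne
  have hint : ∀ a : ℝ, Integrable ((Metric.closedBall (0 : R3) r).indicator fun _ => a) := fun a =>
    (integrable_indicator_iff hmeas).2 (by simpa using Or.inr hfin.lt_top)
  have hintv : ∀ a : ℝ, ∫ η, (Metric.closedBall (0 : R3) r).indicator (fun _ => a) η = vol * a := by
    intro a
    rw [integral_indicator hmeas, setIntegral_const]
    rfl
  -- The integral of `|f|³` is at most `sup |f|` times the integral of `|f|²`. The supremum is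
  -- bounded by the `L¹` norm of the symbol and the square integral by Plancherel. The value is
  -- immaterial: only finiteness matters, as an a priori bound for the Volterra argument.
  refine ⟨Real.toNNReal ((vol * m * (vol * m ^ 2)) ^ (1 / 3 : ℝ)), fun t ht => ?_⟩
  have hs := hF.isSymbol t
  have h1 : ∀ x, ‖𝓕⁻ (F t) x‖ ≤ vol * m := fun x => by
    refine (IsSymbol.norm_fourierInv_le _ x).trans ?_
    rw [← hintv]
    exact integral_mono hs.integrable.norm (hint m) (hb t ht)
  have h2 : ∫ x, ‖𝓕⁻ (F t) x‖ ^ 2 ≤ vol * m ^ 2 := by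
    have h3 := SchwartzMap.integral_norm_sq_fourier (𝓕⁻ hs.schwartz)
    rw [FourierTransform.fourier_fourierInv_eq] at h3
    rw [← hs.coe_fourierInv, ← h3, ← hintv]
    refine integral_mono_of_nonneg (Filter.Eventually.of_forall fun η => by positivity)
      (hint _) (Filter.Eventually.of_forall fun η => ?_)
    have h4 := hb t ht η
    simp only [hs.coe_schwartz]
    by_cases h : η ∈ Metric.closedBall (0 : R3) r
    · rw [Set.indicator_of_mem h] at h4 ⊢
      exact pow_le_pow_left₀ (norm_nonneg _) h4 2
    · rw [Set.indicator_of_notMem h] at h4 ⊢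
      simp [le_antisymm h4 (norm_nonneg _)]
  have hi2 : Integrable fun x => ‖𝓕⁻ (F t) x‖ ^ 2 := by
    rw [← hs.coe_fourierInv]
    exact ((𝓕⁻ hs.schwartz).memLp 2 volume).integrable_norm_pow (by norm_num)
  rw [hatNorm, eLpNorm_three, ← ENNReal.ofReal, ← ENNReal.ofReal_rpow_of_nonneg (by positivity)
    (by norm_num)]
  refine ENNReal.rpow_le_rpow ?_ (by norm_num)
  calc ∫⁻ x, ‖𝓕⁻ (F t) x‖ₑ ^ 3 ≤ ∫⁻ x, ENNReal.ofReal (vol * m * ‖𝓕⁻ (F t) x‖ ^ 2) := by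
        refine lintegral_mono fun x => ?_
        rw [← ofReal_norm, ← ENNReal.ofReal_pow (norm_nonneg _)]
        refine ENNReal.ofReal_le_ofReal ?_
        rw [pow_succ']
        exact mul_le_mul_of_nonneg_right (h1 x) (by positivity)
    _ = ENNReal.ofReal (∫ x, vol * m * ‖𝓕⁻ (F t) x‖ ^ 2) :=
        (ofReal_integral_eq_lintegral_ofReal (hi2.const_mul _)
          (Filter.Eventually.of_forall fun x => by positivity)).symm
    _ ≤ _ := by
        refine ENNReal.ofReal_le_ofReal ?_
        rw [integral_const_mul]
        exact mul_le_mul_of_nonneg_left h2 (by positivity)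

/-- The quadratic symbol with matrix coefficients `Q`. -/
def quadSymbol (Q : Fin 3 → Fin 3 → E →L[ℂ] E) (ξ : R3) : E →L[ℂ] E :=
  ∑ i, ∑ j, ((ξ i * ξ j : ℝ) : ℂ) • Q i j

theorem contDiff_quadSymbol (Q : Fin 3 → Fin 3 → E →L[ℂ] E) : ContDiff ℝ ∞ (quadSymbol Q) := by
  refine ContDiff.sum fun i _ => ContDiff.sum fun j _ => ?_
  have h : ContDiff ℝ ∞ fun ξ : R3 => ((ξ i * ξ j : ℝ) : ℂ) := by
    simp only [Complex.ofReal_mul]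
    exact (contDiff_coord i).mul (contDiff_coord j)
  exact h.smul contDiff_const

/-- The variation of a quadratic symbol over a frequency box. -/
def quadVariation (Q : Fin 3 → Fin 3 → E →L[ℂ] E) (k : Fin 3 → ℤ) (η : R3) : E →L[ℂ] E :=
  quadSymbol Q ((2 * Real.pi) • η) - quadSymbol Q (latticePoint k)

/-- The constant in `hatNorm_quadVariation_le`. -/
def quadConst (Q : Fin 3 → Fin 3 → E →L[ℂ] E) : ℝ≥0∞ :=
  ∑ i, ∑ j, ‖Q i j‖ₑ * (kernelNorm (fun ζ => ((ζ i : ℂ) * (ζ j : ℂ)) • fat ζ)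
    + kernelNorm (fun ζ => (ζ i : ℂ) • fat ζ) + kernelNorm (fun ζ => (ζ j : ℂ) • fat ζ))

theorem quadConst_lt_top (Q : Fin 3 → Fin 3 → E →L[ℂ] E) : quadConst Q < ⊤ := by
  refine ENNReal.sum_lt_top.2 fun i _ => ENNReal.sum_lt_top.2 fun j _ =>
    ENNReal.mul_lt_top enorm_lt_top ?_
  have h1 := fun i => kernelNorm_lt_top (isSymbol_fat.smul (contDiff_coord i))
  exact ENNReal.add_lt_top.2 ⟨ENNReal.add_lt_top.2 ⟨kernelNorm_lt_top
    (isSymbol_fat.smul ((contDiff_coord i).mul (contDiff_coord j))), h1 i⟩, h1 j⟩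

/-- With `ρ` the relative frequency, `ξ i ξ j - k i k j = ρ i ρ j + k i ρ j + k j ρ i`. The part
quadratic in `k` cancels, and on the box each `ρ` is a bounded multiplier. Hence only one power of
`|k|` is lost, which the parabolic damping can absorb. -/
theorem hatNorm_quadVariation_le (hχ : IsModulationWindow χ) (Q : Fin 3 → Fin 3 → E →L[ℂ] E)
    (k : Fin 3 → ℤ) {F : R3 → E} (hF : IsSymbol F) :
    hatNorm (fun η => quadVariation Q k η (boxed χ k F η))
      ≤ quadConst Q * ENNReal.ofReal (1 + ‖latticePoint k‖) * boxNorm χ k F := by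
  set κ := ENNReal.ofReal (1 + ‖latticePoint k‖) with hκ
  have hb := hF.boxed hχ k
  have hκ1 : 1 ≤ κ := by
    rw [hκ, ← ENNReal.ofReal_one]
    exact ENNReal.ofReal_le_ofReal (by linarith [norm_nonneg (latticePoint k)])
  have hκk : ∀ i, ‖(k i : ℂ)‖ₑ ≤ κ := fun i => by
    rw [← ofReal_norm, hκ]
    refine ENNReal.ofReal_le_ofReal ?_
    have := PiLp.norm_apply_le (latticePoint k) i
    rw [Complex.norm_intCast]
    simp only [latticePoint, Real.norm_eq_abs] at this ⊢
    linarith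
  have hc : ∀ i, ContDiff ℝ ∞ (fun η => ((relFreq k η i : ℝ) : ℂ)) := fun i =>
    (contDiff_coord i).comp (contDiff_relFreq k)
  have hmul : ∀ i j, IsSymbol (fun η =>
      (((relFreq k η i : ℂ) * (relFreq k η j : ℂ)) • boxed χ k F η)) := fun i j =>
    hb.smul ((hc i).mul (hc j))
  have hlin : ∀ i, IsSymbol (fun η => (relFreq k η i : ℂ) • boxed χ k F η) := fun i =>
    hb.smul (hc i)
  set p : Fin 3 → Fin 3 → R3 → E := fun i j η =>
    ((relFreq k η i : ℂ) * (relFreq k η j : ℂ)) • boxed χ k F η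
      + ((k i : ℂ) • ((relFreq k η j : ℂ) • boxed χ k F η)
      + (k j : ℂ) • ((relFreq k η i : ℂ) • boxed χ k F η)) with hp
  have hl' : ∀ i (c : ℂ), IsSymbol (fun η => c • ((relFreq k η i : ℂ) • boxed χ k F η)) :=
    fun i c => (hlin i).smul contDiff_const
  have hpS : ∀ i j, IsSymbol (p i j) := fun i j =>
    (hmul i j).add ((hl' j _).add (hl' i _))
  have hpn : ∀ i j, hatNorm (p i j) ≤
      (kernelNorm (fun ζ => ((ζ i : ℂ) * (ζ j : ℂ)) • fat ζ)
        + kernelNorm (fun ζ => (ζ i : ℂ) • fat ζ) + kernelNorm (fun ζ => (ζ j : ℂ) • fat ζ))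
        * κ * boxNorm χ k F := by
    intro i j
    have e2 : ∀ i, hatNorm (fun η => (relFreq k η i : ℂ) • boxed χ k F η)
        ≤ kernelNorm (fun ζ => (ζ i : ℂ) • fat ζ) * boxNorm χ k F := fun i =>
      eLpNorm_boxed_le hχ (p := fun ζ => (ζ i : ℂ)) (contDiff_coord i) k hF
    have e1 : hatNorm (fun η => ((relFreq k η i : ℂ) * (relFreq k η j : ℂ)) • boxed χ k F η)
        ≤ kernelNorm (fun ζ => ((ζ i : ℂ) * (ζ j : ℂ)) • fat ζ) * boxNorm χ k F :=
      eLpNorm_boxed_le hχ (p := fun ζ => (ζ i : ℂ) * (ζ j : ℂ))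
        ((contDiff_coord i).mul (contDiff_coord j)) k hF
    calc hatNorm (p i j) ≤ _ := hatNorm_add_le (hmul i j) ((hl' j _).add (hl' i _))
      _ ≤ kernelNorm (fun ζ => ((ζ i : ℂ) * (ζ j : ℂ)) • fat ζ) * boxNorm χ k F
          + (κ * (kernelNorm (fun ζ => (ζ j : ℂ) • fat ζ) * boxNorm χ k F)
          + κ * (kernelNorm (fun ζ => (ζ i : ℂ) • fat ζ) * boxNorm χ k F)) := by
          refine add_le_add e1 ((hatNorm_add_le (hl' j _) (hl' i _)).trans (add_le_add ?_ ?_))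
          · exact (hatNorm_const_smul_le _ (hlin j)).trans (mul_le_mul' (hκk i) (e2 j))
          · exact (hatNorm_const_smul_le _ (hlin i)).trans (mul_le_mul' (hκk j) (e2 i))
      _ ≤ κ * (kernelNorm (fun ζ => ((ζ i : ℂ) * (ζ j : ℂ)) • fat ζ) * boxNorm χ k F)
          + (κ * (kernelNorm (fun ζ => (ζ j : ℂ) • fat ζ) * boxNorm χ k F)
          + κ * (kernelNorm (fun ζ => (ζ i : ℂ) • fat ζ) * boxNorm χ k F)) := by
          exact add_le_add (le_mul_of_one_le_left' hκ1) le_rfl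
      _ = _ := by ring
  have hQp : ∀ i j, IsSymbol (fun η => Q i j (p i j η)) := fun i j =>
    ⟨(((Q i j).restrictScalars ℝ).contDiff.comp (hpS i j).smooth),
      (hpS i j).compact.comp_left (g := fun x => Q i j x) (map_zero _)⟩
  have hexp : (fun η => quadVariation Q k η (boxed χ k F η))
      = fun η => ∑ i, ∑ j, Q i j (p i j η) := by
    ext1 η
    have hpt : ∀ i j, p i j η = (((((2 * Real.pi) • η) i * ((2 * Real.pi) • η) j : ℝ) : ℂ)
        - ((latticePoint k i * latticePoint k j : ℝ) : ℂ)) • boxed χ k F η := by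
      intro i j
      simp only [hp, relFreq_apply, smul_smul, ← add_smul]
      congr 1
      simp only [latticePoint, PiLp.smul_apply, smul_eq_mul]
      push_cast
      ring
    simp only [quadVariation, quadSymbol, ← Finset.sum_sub_distrib, ← sub_smul,
      sum_apply, smul_apply, hpt, map_smul]
  rw [hexp]
  have hsumj : ∀ i, IsSymbol (fun η => ∑ j, Q i j (p i j η)) := fun i =>
    (IsSymbol.fourierInv_sum Finset.univ fun j _ => hQp i j).1
  calc _ ≤ ∑ i, hatNorm (fun η => ∑ j, Q i j (p i j η)) :=
        hatNorm_sum_le _ fun i _ => hsumj i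
    _ ≤ ∑ i, ∑ j, hatNorm (fun η => Q i j (p i j η)) :=
        Finset.sum_le_sum fun i _ => hatNorm_sum_le _ fun j _ => hQp i j
    _ ≤ ∑ i, ∑ j, ‖Q i j‖ₑ * ((kernelNorm (fun ζ => ((ζ i : ℂ) * (ζ j : ℂ)) • fat ζ)
        + kernelNorm (fun ζ => (ζ i : ℂ) • fat ζ) + kernelNorm (fun ζ => (ζ j : ℂ) • fat ζ))
        * κ * boxNorm χ k F) :=
        Finset.sum_le_sum fun i _ => Finset.sum_le_sum fun j _ =>
          (hatNorm_clm_le _ (hpS i j)).trans (mul_le_mul_right (hpn i j) _)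
    _ = _ := by
        rw [quadConst, Finset.sum_mul, Finset.sum_mul]
        refine Finset.sum_congr rfl fun i _ => ?_
        rw [Finset.sum_mul, Finset.sum_mul]
        refine Finset.sum_congr rfl fun j _ => ?_
        ring

end BoxEvolution

/-! ### Maximal regularity -/

section MaximalRegularity

variable {E : Type*} [NormedAddCommGroup E] [InnerProductSpace ℂ E] [CompleteSpace E] {χ : R3 → ℂ}

/-- Coercivity of the operator with coefficients `Q`. -/
def IsCoercive (Q : Fin 3 → Fin 3 → E →L[ℂ] E) (c : ℝ) : Prop :=
  ∀ ξ v, c * ‖ξ‖ ^ 2 * ‖v‖ ^ 2 ≤ (inner ℂ v (quadSymbol Q ξ v)).re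

/-- The Fourier side of the equation `∂_t V = - quadSymbol Q (-i∇) V + G`. -/
def IsEvolution (Q : Fin 3 → Fin 3 → E →L[ℂ] E) (V G : ℝ → R3 → E) : Prop :=
  ∀ t η, HasDerivAt (fun s => V s η) (-(quadSymbol Q ((2 * Real.pi) • η) (V t η)) + G t η) t

variable {Q : Fin 3 → Fin 3 → E →L[ℂ] E} {c r : ℝ} {V G : ℝ → R3 → E}

theorem IsBandSymbol.quadSymbol (hV : IsBandSymbol r V) (Q : Fin 3 → Fin 3 → E →L[ℂ] E) :
    IsBandSymbol r (fun t η => quadSymbol Q ((2 * Real.pi) • η) (V t η)) :=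
  hV.op (S := fun _ η => IdealGas.quadSymbol Q ((2 * Real.pi) • η))
    ((contDiff_quadSymbol Q).comp (contDiff_snd.const_smul (2 * Real.pi)))

theorem IsBandSymbol.quadVariation (hV : IsBandSymbol r V) (Q : Fin 3 → Fin 3 → E →L[ℂ] E)
    (k : Fin 3 → ℤ) : IsBandSymbol r (fun t η => quadVariation Q k η (V t η)) :=
  hV.op (S := fun _ η => IdealGas.quadVariation Q k η)
    (((contDiff_quadSymbol Q).comp (contDiff_snd.const_smul (2 * Real.pi))).sub contDiff_const)

/-- The source in the equation for the component near `k`, with coefficients frozen at `k`. -/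
def boxSource (χ : R3 → ℂ) (Q : Fin 3 → Fin 3 → E →L[ℂ] E) (k : Fin 3 → ℤ) (V G : ℝ → R3 → E)
    (s : ℝ) (η : R3) : E :=
  boxed χ k (G s) η + (-1 : ℂ) • quadVariation Q k η (boxed χ k (V s) η)

theorem IsBandSymbol.boxSource (hχ : IsModulationWindow χ) (Q : Fin 3 → Fin 3 → E →L[ℂ] E)
    (k : Fin 3 → ℤ) (hV : IsBandSymbol r V) (hG : IsBandSymbol r G) :
    IsBandSymbol r (boxSource χ Q k V G) :=
  (hG.boxed hχ k).add
    (((hV.boxed hχ k).quadVariation Q k).smul (m := fun _ _ => -1) contDiff_const)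

theorem hatNorm_boxSource_le (hχ : IsModulationWindow χ) (Q : Fin 3 → Fin 3 → E →L[ℂ] E)
    (k : Fin 3 → ℤ) (hV : IsBandSymbol r V) (hG : IsBandSymbol r G) (s : ℝ) :
    hatNorm (boxSource χ Q k V G s) ≤ boxNorm χ k (G s) +
        quadConst Q * ENNReal.ofReal (1 + ‖latticePoint k‖) * boxNorm χ k (V s) := by
  have hVk := ((hV.boxed hχ k).quadVariation Q k).isSymbol s
  refine (hatNorm_add_le ((hG.boxed hχ k).isSymbol s) (hVk.smul contDiff_const)).trans ?_
  refine add_le_add le_rfl ((hatNorm_const_smul_le (-1) hVk).trans ?_)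
  rw [show ‖(-1 : ℂ)‖ₑ = 1 by rw [← ofReal_norm]; simp, one_mul]
  exact hatNorm_quadVariation_le hχ Q k (hV.isSymbol s)

/-- Once the symbol is frozen at `k` it is a constant operator on `E`. The localized equation thus
becomes, for each fixed `x`, an ordinary differential equation in `E`, with the variation of the
symbol moved into the source. -/
theorem hasDerivAt_fourierInv_boxed (hχ : IsModulationWindow χ)
    (hV : IsBandSymbol r V) (hG : IsBandSymbol r G) (hVG : IsEvolution Q V G)
    (k : Fin 3 → ℤ) (x : R3) (s : ℝ) :
    HasDerivAt (fun s => 𝓕⁻ (boxed χ k (V s)) x)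
      (-(quadSymbol Q (latticePoint k) (𝓕⁻ (boxed χ k (V s)) x))
        + 𝓕⁻ (boxSource χ Q k V G s) x) s := by
  have hVk := hV.boxed hχ k
  refine (hVk.fourierInv_hasDerivAt s x).congr_deriv ?_
  have h1 : (fun η => deriv (fun s => boxed χ k (V s) η) s)
      = fun η => (-quadSymbol Q (latticePoint k)) (boxed χ k (V s) η)
        + boxSource χ Q k V G s η := by
    ext1 η
    have h2 := ((hVG s η).const_smul (χ (relFreq k η))).deriv
    refine h2.trans ?_
    simp only [boxSource, boxed, quadVariation, smul_add, smul_neg, sub_apply, neg_apply,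
      map_smul, neg_smul, one_smul, smul_sub]
    abel
  have hs := hVk.isSymbol s
  have h3 : IsSymbol (fun η => (-quadSymbol Q (latticePoint k)) (boxed χ k (V s) η)) :=
    (hVk.op (S := fun _ _ => -quadSymbol Q (latticePoint k)) contDiff_const).isSymbol s
  rw [h1, h3.fourierInv_add ((hV.boxSource hχ Q k hG).isSymbol s), hs.fourierInv_clm]
  simp

/-- Duhamel's formula estimated in `L³`. -/
theorem eLpNorm_duhamel_le {A : E →L[ℂ] E} {a : ℝ} (hA : ∀ v, a * ‖v‖ ^ 2 ≤ (inner ℂ v (A v)).re)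
    {v h : ℝ → R3 → E} (hv0 : Continuous (v 0)) (hh : Continuous (fun q : ℝ × R3 => h q.1 q.2))
    (hv : ∀ x s, HasDerivAt (fun s => v s x) (-(A (v s x)) + h s x) s) {t : ℝ} (ht : 0 ≤ t) :
    eLpNorm (v t) 3 volume ≤ expWeight a t * eLpNorm (v 0) 3 volume +
      ∫⁻ s in Set.Ioo 0 t, expWeight a (t - s) * eLpNorm (h s) 3 volume := by
  have hS : Continuous (propagator A) :=
    continuous_iff_continuousAt.2 fun s => (hasDerivAt_propagator A s).continuousAt
  have hduh : v t = fun x => propagator A t (v 0 x)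
      + ∫ s in (0 : ℝ)..t, propagator A (t - s) (h s x) :=
    funext fun x => eq_duhamel A (hh.comp (Continuous.prodMk_left x)) (hv x) t
  have hjoint : Continuous (fun q : ℝ × R3 => propagator A (t - q.1) (h q.1 q.2)) :=
    (hS.comp (continuous_const.sub continuous_fst)).clm_apply hh
  have hc0 : Continuous (fun x => propagator A t (v 0 x)) :=
    (propagator A t).continuous.comp hv0
  have hcI : Continuous (fun x => ∫ s in (0 : ℝ)..t, propagator A (t - s) (h s x)) :=
    intervalIntegral.continuous_parametric_intervalIntegral_of_continuous'
      (f := fun x s => propagator A (t - s) (h s x)) (hjoint.comp continuous_swap) 0 t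
  have hL : ∀ τ, 0 ≤ τ → ∀ f : R3 → E, eLpNorm (fun x => propagator A τ (f x)) 3 volume
      ≤ expWeight a τ * eLpNorm f 3 volume := fun τ hτ f => by
    refine eLpNorm_le_mul_eLpNorm_of_ae_le_mul' (c := Real.toNNReal (Real.exp (-(a * τ))))
      (Filter.Eventually.of_forall fun x => ?_) 3
    rw [← ENNReal.ofReal, ← ofReal_norm, ← ofReal_norm, ← ENNReal.ofReal_mul (Real.exp_pos _).le]
    exact ENNReal.ofReal_le_ofReal (norm_propagator_apply_le hA hτ (f x))
  rw [hduh]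
  refine (eLpNorm_add_le hc0.aestronglyMeasurable hcI.aestronglyMeasurable (by norm_num)).trans
    (add_le_add (hL t ht _) ?_)
  refine (eLpNorm_three_le_lintegral (volume.restrict (Set.Ioc 0 t)) volume
      (f := fun s x => propagator A (t - s) (h s x)) hjoint.enorm.measurable fun x => ?_).trans ?_
  · rw [intervalIntegral.integral_of_le ht]
    exact enorm_integral_le_lintegral_enorm _
  · rw [← restrict_Ioo_eq_restrict_Ioc]
    exact setLIntegral_mono' measurableSet_Ioo fun s hs => hL (t - s) (by linarith [hs.2]) _

/-- Duhamel with frozen coefficients: coercivity damps at rate `c |k|²`, whereas the variation of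
the symbol feeds back with strength of order `1 + |k|` only. -/
theorem box_evolution (hχ : IsModulationWindow χ) (hQ : IsCoercive Q c)
    (hV : IsBandSymbol r V) (hG : IsBandSymbol r G) (hVG : IsEvolution Q V G)
    (k : Fin 3 → ℤ) {t : ℝ} (ht : 0 ≤ t) :
    boxNorm χ k (V t) ≤ expWeight (c * ‖latticePoint k‖ ^ 2) t * boxNorm χ k (V 0) +
      ∫⁻ s in Set.Ioo 0 t, expWeight (c * ‖latticePoint k‖ ^ 2) (t - s) * (boxNorm χ k (G s) +
        quadConst Q * ENNReal.ofReal (1 + ‖latticePoint k‖) * boxNorm χ k (V s)) := by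
  refine (eLpNorm_duhamel_le (hQ (latticePoint k)) (v := fun s => 𝓕⁻ (boxed χ k (V s)))
    ((hV.boxed hχ k).isSymbol 0).continuous_fourierInv
    (hV.boxSource hχ Q k hG).contDiff_fourierInv.continuous
    (fun x s => hasDerivAt_fourierInv_boxed hχ hV hG hVG k x s) ht).trans ?_
  refine add_le_add le_rfl (lintegral_mono fun s => ?_)
  exact mul_le_mul_right (hatNorm_boxSource_le hχ Q k hV hG s) _

end MaximalRegularity

/-! ### Maximal regularity on a single frequency box, with constants independent of the box -/

section MaximalRegularitySum

variable {E : Type*} [NormedAddCommGroup E] [InnerProductSpace ℂ E] [CompleteSpace E] {χ : R3 → ℂ}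
variable {Q : Fin 3 → Fin 3 → E →L[ℂ] E} {c r : ℝ} {V G : ℝ → R3 → E}

/-- The damping that absorbs the variation of the symbol over frequency boxes. -/
def dampingRate (Q : Fin 3 → Fin 3 → E →L[ℂ] E) (c : ℝ) : ℝ :=
  2 * (quadConst Q).toReal + (quadConst Q).toReal ^ 2 / c + 1

theorem dampingRate_pos (Q : Fin 3 → Fin 3 → E →L[ℂ] E) (hc : 0 < c) : 1 ≤ dampingRate Q c := by
  have : 0 ≤ (quadConst Q).toReal := ENNReal.toReal_nonneg
  have : 0 ≤ (quadConst Q).toReal ^ 2 / c := by positivity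
  rw [dampingRate]; linarith

theorem expWeight_add (a b t : ℝ) : expWeight (a + b) t = expWeight a t * expWeight b t := by
  rw [expWeight, expWeight, expWeight, ← ENNReal.ofReal_mul (Real.exp_pos _).le, ← Real.exp_add]
  ring_nf

theorem expWeight_sub_mul (a t s : ℝ) : expWeight a t = expWeight a (t - s) * expWeight a s := by
  rw [expWeight, expWeight, expWeight, ← ENNReal.ofReal_mul (Real.exp_pos _).le, ← Real.exp_add]
  ring_nf

/-- For small `|k|` the damping `c |k|²` does not dominate the feedback. The weight `exp (-Lt)` adds
`L = dampingRate Q c` to the rate, so that the Volterra inequality applies on every box. Since `T ≤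
1`, removing the weight costs only the factor `exp L`. -/
theorem box_maximal_regularity (hχ : IsModulationWindow χ) (hQ : IsCoercive Q c) (hc : 0 < c)
    (hV : IsBandSymbol r V) (hG : IsBandSymbol r G) (hVG : IsEvolution Q V G)
    (k : Fin 3 → ℤ) {T : ℝ} (hT : 0 ≤ T) (hT1 : T ≤ 1) :
    boxNorm χ k (V T) ≤ ENNReal.ofReal (2 * Real.exp (dampingRate Q c)) *
        (boxNorm χ k (V 0) + ∫⁻ s in Set.Ioo 0 T, boxNorm χ k (G s)) ∧
      ENNReal.ofReal (1 + ‖latticePoint k‖ ^ 2) * ∫⁻ s in Set.Ioo 0 T, boxNorm χ k (V s) ≤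
        ENNReal.ofReal ((2 / c + 2) * Real.exp (dampingRate Q c)) *
        (boxNorm χ k (V 0) + ∫⁻ s in Set.Ioo 0 T, boxNorm χ k (G s)) := by
  set L := dampingRate Q c with hL
  set κ := ‖latticePoint k‖ with hκ
  set D := (quadConst Q).toReal with hD
  have hL1 : 1 ≤ L := dampingRate_pos Q hc
  have hκ0 : 0 ≤ κ := norm_nonneg _
  have hD0 : 0 ≤ D := ENNReal.toReal_nonneg
  have hVm := hV.measurable_boxNorm hχ k
  have hGm := hG.measurable_boxNorm hχ k
  have ha : 0 < c * κ ^ 2 + L := by positivity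
  -- The square `(cκ - D)² ≥ 0` bounds `2Dκ` by `cκ² + D²/c`. Together with the remaining `2D`, this
  -- dictates the definition of `dampingRate`.
  have hab : 2 * (D * (1 + κ)) ≤ c * κ ^ 2 + L := by
    have h1 : 2 * (D * κ) ≤ c * κ ^ 2 + D ^ 2 / c := by
      have h2 : c * κ ^ 2 + D ^ 2 / c - 2 * (D * κ) = (c * κ - D) ^ 2 / c := by
        field_simp; ring
      have : 0 ≤ (c * κ - D) ^ 2 / c := by positivity
      linarith
    rw [hL, dampingRate]
    linarith
  have hquad : quadConst Q * ENNReal.ofReal (1 + κ) = ENNReal.ofReal (D * (1 + κ)) := by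
    rw [ENNReal.ofReal_mul hD0, hD, ENNReal.ofReal_toReal (quadConst_lt_top Q).ne]
  have hexp1 : ∀ s, 0 ≤ s → expWeight L s ≤ 1 := fun s hs => expWeight_le_one (by linarith) hs
  obtain ⟨C, hC⟩ := (hV.boxed hχ k).exists_hatNorm_le T
  -- A priori finiteness, to be used in the absorption step of `volterra_bound`.
  have hfin : ∫⁻ s in Set.Ioo 0 T, expWeight L s * boxNorm χ k (V s) ≠ ⊤ := by
    refine ne_top_of_le_ne_top (b := ∫⁻ s in Set.Ioo 0 T, (C : ℝ≥0∞)) ?_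
      (setLIntegral_mono' measurableSet_Ioo fun s hs => ?_)
    · rw [setLIntegral_const]
      exact ENNReal.mul_ne_top ENNReal.coe_ne_top (by simp)
    · exact (mul_le_of_le_one_left' (hexp1 s hs.1.le)).trans (hC s ⟨hs.1.le, hs.2.le⟩)
  have key := volterra_bound (y := fun s => expWeight L s * boxNorm χ k (V s))
    (g := fun s => boxNorm χ k (G s)) ((measurable_expWeight L).mul hVm) hGm
    (y₀ := boxNorm χ k (V 0)) ha hab hT (fun t ht => by
      have h1 := box_evolution hχ hQ hV hG hVG k ht.1
      rw [← hκ, hquad] at h1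
      calc expWeight L t * boxNorm χ k (V t)
          ≤ expWeight L t * (expWeight (c * κ ^ 2) t * boxNorm χ k (V 0) +
            ∫⁻ s in Set.Ioo 0 t, expWeight (c * κ ^ 2) (t - s) *
              (boxNorm χ k (G s) + ENNReal.ofReal (D * (1 + κ)) * boxNorm χ k (V s))) := by gcongr
        _ = expWeight (c * κ ^ 2 + L) t * boxNorm χ k (V 0) +
            ∫⁻ s in Set.Ioo 0 t, expWeight L t * (expWeight (c * κ ^ 2) (t - s) *
              (boxNorm χ k (G s) + ENNReal.ofReal (D * (1 + κ)) * boxNorm χ k (V s))) := by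
            rw [mul_add, expWeight_add, lintegral_const_mul]
            · ring
            · exact ((measurable_expWeight _).comp (measurable_const.sub measurable_id)).mul
                (hGm.add (hVm.const_mul _))
        _ ≤ _ := by
            refine add_le_add le_rfl (setLIntegral_mono' measurableSet_Ioo fun s hs => ?_)
            rw [expWeight_sub_mul L t s, expWeight_add]
            calc _ = expWeight (c * κ ^ 2) (t - s) * expWeight L (t - s) *
                  (expWeight L s * boxNorm χ k (G s) +
                    ENNReal.ofReal (D * (1 + κ)) * (expWeight L s * boxNorm χ k (V s))) := by ring
              _ ≤ _ := by
                gcongr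
                exact mul_le_of_le_one_left' (hexp1 s hs.1.le)) hfin
  set data := boxNorm χ k (V 0) + ∫⁻ s in Set.Ioo 0 T, boxNorm χ k (G s)
  have hundo : ∀ s, 0 ≤ s → s ≤ 1 → ∀ y : ℝ≥0∞,
      y ≤ ENNReal.ofReal (Real.exp L) * (expWeight L s * y) := by
    intro s _ hs1 y
    rw [← mul_assoc]
    refine le_mul_of_one_le_left' ?_
    rw [expWeight, ← ENNReal.ofReal_mul (Real.exp_pos _).le, ← Real.exp_add, ← ENNReal.ofReal_one]
    refine ENNReal.ofReal_le_ofReal (Real.one_le_exp ?_)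
    nlinarith
  constructor
  · calc boxNorm χ k (V T) ≤ _ := hundo T hT hT1 _
      _ ≤ ENNReal.ofReal (Real.exp L) * (2 * data) := mul_le_mul_right key.1 _
      _ = _ := by
        rw [ENNReal.ofReal_mul (by norm_num), ENNReal.ofReal_ofNat]; ring
  · have h1 : ∫⁻ s in Set.Ioo 0 T, boxNorm χ k (V s) ≤ ENNReal.ofReal (Real.exp L) *
        (ENNReal.ofReal (2 / (c * κ ^ 2 + L)) * data) := by
      calc _ ≤ ∫⁻ s in Set.Ioo 0 T, ENNReal.ofReal (Real.exp L) *
            (expWeight L s * boxNorm χ k (V s)) :=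
            setLIntegral_mono' measurableSet_Ioo fun s hs =>
              hundo s hs.1.le (hs.2.le.trans hT1) _
        _ = ENNReal.ofReal (Real.exp L) * ∫⁻ s in Set.Ioo 0 T,
            (expWeight L s * boxNorm χ k (V s)) :=
            lintegral_const_mul _ ((measurable_expWeight L).mul hVm)
        _ ≤ _ := by gcongr; exact key.2
    calc _ ≤ ENNReal.ofReal (1 + κ ^ 2) * (ENNReal.ofReal (Real.exp L) *
        (ENNReal.ofReal (2 / (c * κ ^ 2 + L)) * data)) := by gcongr
      _ = ENNReal.ofReal ((1 + κ ^ 2) * Real.exp L * (2 / (c * κ ^ 2 + L))) * data := by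
        rw [ENNReal.ofReal_mul (by positivity), ENNReal.ofReal_mul (by positivity)]; ring
      _ ≤ _ := by
        gcongr ENNReal.ofReal ?_ * _
        -- Integration in time gains the inverse of the rate `cκ² + L`. This compensates two
        -- derivatives, uniformly down to `κ = 0`, because `L ≥ 1`.
        have h2 : (1 + κ ^ 2) * (2 / (c * κ ^ 2 + L)) ≤ 2 / c + 2 := by
          rw [mul_div_assoc', div_le_iff₀ ha]
          have h3 : (2 / c + 2) * (c * κ ^ 2 + L)
              = 2 * κ ^ 2 + 2 * L / c + 2 * c * κ ^ 2 + 2 * L := by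
            field_simp
            ring
          have : 0 ≤ 2 * L / c := by positivity
          have : 0 ≤ 2 * c * κ ^ 2 := by positivity
          rw [h3]; linarith
        calc _ = (1 + κ ^ 2) * (2 / (c * κ ^ 2 + L)) * Real.exp L := by ring
          _ ≤ _ := by gcongr

/-- The constant in the bound of a quadratic symbol on a frequency box. -/
def quadBound (Q : Fin 3 → Fin 3 → E →L[ℂ] E) : ℝ≥0∞ :=
  ∑ i, ∑ j, ‖Q i j‖ₑ + 2 * quadConst Q

theorem quadBound_lt_top (Q : Fin 3 → Fin 3 → E →L[ℂ] E) : quadBound Q < ⊤ := by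
  refine ENNReal.add_lt_top.2 ⟨ENNReal.sum_lt_top.2 fun i _ => ENNReal.sum_lt_top.2 fun j _ =>
    enorm_lt_top, ENNReal.mul_lt_top (by simp) (quadConst_lt_top Q)⟩

/-- The frozen symbol contributes `|k|²` and its variation at most `1 + |k|`; both are dominated by
a multiple of `1 + |k|²`. -/
theorem boxNorm_quadSymbol_le (hχ : IsModulationWindow χ) (Q : Fin 3 → Fin 3 → E →L[ℂ] E)
    (k : Fin 3 → ℤ) {F : R3 → E} (hF : IsSymbol F) :
    boxNorm χ k (fun η => quadSymbol Q ((2 * Real.pi) • η) (F η))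
      ≤ quadBound Q * (ENNReal.ofReal (1 + ‖latticePoint k‖ ^ 2) * boxNorm χ k F) := by
  set κ := ‖latticePoint k‖ with hκ
  have hκ0 : 0 ≤ κ := norm_nonneg _
  have hb := hF.boxed hχ k
  obtain ⟨ρ, -, hρ⟩ := hb.exists_radius
  have hB : IsBandSymbol ρ (fun _ : ℝ => boxed χ k F) :=
    ⟨hb.smooth.comp contDiff_snd, fun _ => hρ⟩
  have h1 : boxed χ k (fun η => quadSymbol Q ((2 * Real.pi) • η) (F η)) = fun η =>
      quadSymbol Q (latticePoint k) (boxed χ k F η) + quadVariation Q k η (boxed χ k F η) := by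
    ext1 η
    simp only [boxed, quadVariation, sub_apply, map_smul, smul_sub]
    abel
  have h2 : ‖quadSymbol Q (latticePoint k)‖ₑ
      ≤ (∑ i, ∑ j, ‖Q i j‖ₑ) * ENNReal.ofReal (1 + κ ^ 2) := by
    rw [quadSymbol, Finset.sum_mul]
    refine (enorm_sum_le _ _).trans (Finset.sum_le_sum fun i _ => ?_)
    rw [Finset.sum_mul]
    refine (enorm_sum_le _ _).trans (Finset.sum_le_sum fun j _ => ?_)
    rw [enorm_smul, mul_comm]
    gcongr
    rw [← ofReal_norm]
    refine ENNReal.ofReal_le_ofReal ?_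
    rw [Complex.norm_real, norm_mul]
    have hi := PiLp.norm_apply_le (latticePoint k) i
    have hj := PiLp.norm_apply_le (latticePoint k) j
    calc _ ≤ κ * κ := mul_le_mul hi hj (norm_nonneg _) hκ0
      _ ≤ _ := by nlinarith
  calc boxNorm χ k (fun η => quadSymbol Q ((2 * Real.pi) • η) (F η))
      ≤ hatNorm (fun η => quadSymbol Q (latticePoint k) (boxed χ k F η))
        + hatNorm (fun η => quadVariation Q k η (boxed χ k F η)) := by
        rw [boxNorm, h1]
        exact hatNorm_add_le ((hB.op (S := fun _ _ => quadSymbol Q (latticePoint k))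
          contDiff_const).isSymbol 0) ((hB.quadVariation Q k).isSymbol 0)
    _ ≤ (∑ i, ∑ j, ‖Q i j‖ₑ) * ENNReal.ofReal (1 + κ ^ 2) * boxNorm χ k F
        + quadConst Q * ENNReal.ofReal (2 * (1 + κ ^ 2)) * boxNorm χ k F := by
        refine add_le_add ((hatNorm_clm_le _ hb).trans (mul_le_mul_left h2 _))
          ((hatNorm_quadVariation_le hχ Q k hF).trans ?_)
        gcongr
        nlinarith [sq_nonneg (κ - 1)]
    _ = _ := by
        rw [quadBound, ENNReal.ofReal_mul (by norm_num), ENNReal.ofReal_ofNat]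
        ring

end MaximalRegularitySum

/-! ### The linear theory for band-limited functions -/

section Linear

variable {E : Type*} [NormedAddCommGroup E] [InnerProductSpace ℂ E] [CompleteSpace E] {χ : R3 → ℂ}
variable {Q : Fin 3 → Fin 3 → E →L[ℂ] E} {c r : ℝ}

/-- The second order operator `∑ Q_ij ∂_i ∂_j`. -/
def quadOp (Q : Fin 3 → Fin 3 → E →L[ℂ] E) (f : R3 → E) (x : R3) : E :=
  ∑ i, ∑ j, Q i j (pd i (pd j f) x)

/-- The semigroup generated by `quadOp Q`. -/
def quadSg (Q : Fin 3 → Fin 3 → E →L[ℂ] E) (t : ℝ) (f : R3 → E) : R3 → E :=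
  fourierAngInv fun ξ => propagator (quadSymbol Q ξ) t (fourierAng f ξ)

/-- The constant of maximal regularity. -/
def regConst (Q : Fin 3 → Fin 3 → E →L[ℂ] E) (c : ℝ) : ℝ≥0∞ :=
  1 + ENNReal.ofReal (2 * Real.exp (dampingRate Q c)) +
    2 * (quadBound Q * ENNReal.ofReal ((2 / c + 2) * Real.exp (dampingRate Q c)))

theorem regConst_lt_top (Q : Fin 3 → Fin 3 → E →L[ℂ] E) (c : ℝ) : regConst Q c < ⊤ := by
  refine ENNReal.add_lt_top.2 ⟨ENNReal.add_lt_top.2 ⟨by simp, ENNReal.ofReal_lt_top⟩,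
    ENNReal.mul_lt_top (by simp) (ENNReal.mul_lt_top (quadBound_lt_top Q) ENNReal.ofReal_lt_top)⟩

theorem quadOp_fourierInv (Q : Fin 3 → Fin 3 → E →L[ℂ] E) {F : R3 → E} (hF : IsSymbol F) :
    quadOp Q (𝓕⁻ F) = 𝓕⁻ (fun η => (-1 : ℂ) • quadSymbol Q ((2 * Real.pi) • η) (F η)) := by
  have hm : ∀ i, ContDiff ℝ ∞ (fun η : R3 => (2 * Real.pi * Complex.I * (η i : ℝ) : ℂ)) :=
    fun i => contDiff_const.mul (contDiff_coord i)
  have hS : ∀ i j, IsSymbol (fun η => (2 * Real.pi * Complex.I * (η i : ℝ) : ℂ) •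
      ((2 * Real.pi * Complex.I * (η j : ℝ) : ℂ) • F η)) := fun i j => (hF.smul (hm j)).smul (hm i)
  have hQS : ∀ i j, IsSymbol (fun η => Q i j ((2 * Real.pi * Complex.I * (η i : ℝ) : ℂ) •
      ((2 * Real.pi * Complex.I * (η j : ℝ) : ℂ) • F η))) := fun i j =>
    ⟨((Q i j).restrictScalars ℝ).contDiff.comp (hS i j).smooth,
      (hS i j).compact.comp_left (g := fun x => Q i j x) (map_zero _)⟩
  have hj := fun i => IsSymbol.fourierInv_sum Finset.univ fun j (_ : j ∈ Finset.univ) => hQS i j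
  ext1 x
  have h1 : (fun η => (-1 : ℂ) • quadSymbol Q ((2 * Real.pi) • η) (F η)) = fun η => ∑ i, ∑ j,
      Q i j ((2 * Real.pi * Complex.I * (η i : ℝ) : ℂ) •
      ((2 * Real.pi * Complex.I * (η j : ℝ) : ℂ) • F η)) := by
    ext1 η
    simp only [IdealGas.quadSymbol, sum_apply, smul_apply, Finset.smul_sum, map_smul, smul_smul]
    refine Finset.sum_congr rfl fun i _ => Finset.sum_congr rfl fun j _ => ?_
    congr 1
    simp only [PiLp.smul_apply, smul_eq_mul]
    push_cast
    ring_nf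
    simp
  rw [h1, (IsSymbol.fourierInv_sum Finset.univ fun i _ => (hj i).1).2 x, quadOp]
  refine Finset.sum_congr rfl fun i _ => ?_
  rw [(hj i).2 x]
  refine Finset.sum_congr rfl fun j _ => ?_
  rw [(hS i j).fourierInv_clm, hF.pd_fourierInv, (hF.smul (hm j)).pd_fourierInv]

theorem IsBand.quadOp {f : ℝ → R3 → E} (hf : IsBand r f) (Q : Fin 3 → Fin 3 → E →L[ℂ] E) :
    IsBand r (fun t => quadOp Q (f t)) :=
  IsBand.sum _ fun i _ => IsBand.sum _ fun j _ => ((hf.pd j).pd i).clm (Q i j)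

theorem IsSymbol.injective {F G : R3 → E} (hF : IsSymbol F) (hG : IsSymbol G)
    (h : 𝓕⁻ F = 𝓕⁻ G) : F = G := by
  rw [← hF.fourier_fourierInv, h, hG.fourier_fourierInv]

/-- Maximal regularity in `L¹(0,T; M_{3,1})`. -/
theorem IsBand.maximal_regularity (hχ : IsModulationWindow χ) (hQ : IsCoercive Q c) (hc : 0 < c)
    {f g : ℝ → R3 → E} (hf : IsBand r f) (hg : IsBand r g)
    (heq : ∀ t x, IdealGas.timeDeriv f t x = IdealGas.quadOp Q (f t) x + g t x)
    {T : ℝ} (hT : 0 ≤ T) (hT1 : T ≤ 1) :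
    modNorm χ (f T) + modNormL1 χ T (IdealGas.timeDeriv f)
        + modNormL1 χ T (fun s => IdealGas.quadOp Q (f s))
      ≤ regConst Q c * (modNorm χ (f 0) + modNormL1 χ T g) := by
  have hop := hf.quadOp Q
  -- The time derivative is read off from the equation, so it is enough to bound the elliptic part.
  have htime : modNormL1 χ T (IdealGas.timeDeriv f)
      ≤ modNormL1 χ T (fun s => IdealGas.quadOp Q (f s)) + modNormL1 χ T g := by
    rw [modNormL1, modNormL1, modNormL1, ← lintegral_add_left (hop.measurable_modNorm hχ)]
    refine lintegral_mono fun s => ?_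
    rw [show IdealGas.timeDeriv f s = fun x => IdealGas.quadOp Q (f s) x + g s x from
      funext (heq s)]
    exact hop.modNorm_add_le hχ hg s
  obtain ⟨V, hV, rfl⟩ := hf.symbol
  obtain ⟨G, hG, rfl⟩ := hg.symbol
  -- The equation is assumed in space; injectivity of the inverse transform on symbols carries it to
  -- each frequency.
  have hVG : IsEvolution Q V G := by
    intro t η
    have h1 := hV.hasDerivAt t η
    have hM := hV.quadSymbol Q
    have hneg := hM.smul (m := fun _ _ => (-1 : ℂ)) contDiff_const
    have h2 : (fun η => deriv (fun s => V s η) t) = fun η =>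
        (-1 : ℂ) • quadSymbol Q ((2 * Real.pi) • η) (V t η) + G t η := by
      refine (hV.timeDeriv.isSymbol t).injective ((hneg.add hG).isSymbol t) (funext fun x => ?_)
      rw [(hneg.isSymbol t).fourierInv_add (hG.isSymbol t), ← quadOp_fourierInv Q (hV.isSymbol t)]
      rw [← heq t x]
      exact ((hV.fourierInv_hasDerivAt t x).deriv).symm
    have h3 := congrFun h2 η
    simp only [neg_smul, one_smul] at h3
    rw [← h3]
    exact h1.differentiableAt.hasDerivAt
  have hbox := fun k => box_maximal_regularity hχ hQ hc hV hG hVG k hT hT1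
  have hdata : modNorm χ (𝓕⁻ (V 0)) + modNormL1 χ T (fun t => 𝓕⁻ (G t))
      = ∑' k, (boxNorm χ k (V 0) + ∫⁻ s in Set.Ioo 0 T, boxNorm χ k (G s)) := by
    rw [ENNReal.tsum_add, modNorm_fourierInv χ (hV.isSymbol 0), modNormL1]
    simp only [modNorm_fourierInv χ (hG.isSymbol _)]
    rw [lintegral_tsum fun k => (hG.measurable_boxNorm hχ k).aemeasurable]
  set data := modNorm χ (𝓕⁻ (V 0)) + modNormL1 χ T (fun t => 𝓕⁻ (G t))
  have hG_le : modNormL1 χ T (fun t => 𝓕⁻ (G t)) ≤ data := le_add_self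
  have hsup : modNorm χ (𝓕⁻ (V T))
      ≤ ENNReal.ofReal (2 * Real.exp (dampingRate Q c)) * data := by
    rw [modNorm_fourierInv χ (hV.isSymbol T), hdata, ← ENNReal.tsum_mul_left]
    exact ENNReal.tsum_le_tsum fun k => (hbox k).1
  have hL1 : modNormL1 χ T (fun s => IdealGas.quadOp Q (𝓕⁻ (V s))) ≤
      quadBound Q * ENNReal.ofReal ((2 / c + 2) * Real.exp (dampingRate Q c)) * data := by
    have hM := hV.quadSymbol Q
    have h1 : ∀ s, modNorm χ (IdealGas.quadOp Q (𝓕⁻ (V s)))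
        ≤ ∑' k, quadBound Q * (ENNReal.ofReal (1 + ‖latticePoint k‖ ^ 2) * boxNorm χ k (V s)) := by
      intro s
      have h2 : IdealGas.quadOp Q (𝓕⁻ (V s)) = fun x =>
          -(𝓕⁻ (fun η => quadSymbol Q ((2 * Real.pi) • η) (V s η)) x) := by
        ext1 x
        rw [quadOp_fourierInv Q (hV.isSymbol s)]
        exact ((hM.isSymbol s).fourierInv_clm ((-1 : ℂ) • ContinuousLinearMap.id ℂ E) x).trans
          (by simp)
      rw [h2]
      refine (hM.isBand.modNorm_neg_le hχ s).trans ?_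
      rw [modNorm_fourierInv χ (hM.isSymbol s)]
      exact ENNReal.tsum_le_tsum fun k => boxNorm_quadSymbol_le hχ Q k (hV.isSymbol s)
    calc _ ≤ ∫⁻ s in Set.Ioo 0 T, ∑' k, quadBound Q *
          (ENNReal.ofReal (1 + ‖latticePoint k‖ ^ 2) * boxNorm χ k (V s)) := lintegral_mono h1
      -- Tonelli exchanges the sum over boxes with the time integral. An `ℓ¹` sum over boxes is what
      -- permits the endpoint `L¹` in time.
      _ = ∑' k, quadBound Q * (ENNReal.ofReal (1 + ‖latticePoint k‖ ^ 2) *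
          ∫⁻ s in Set.Ioo 0 T, boxNorm χ k (V s)) := by
          rw [lintegral_tsum fun k =>
            (((hV.measurable_boxNorm hχ k).const_mul _).const_mul _).aemeasurable]
          refine tsum_congr fun k => ?_
          rw [lintegral_const_mul _ ((hV.measurable_boxNorm hχ k).const_mul _),
            lintegral_const_mul _ (hV.measurable_boxNorm hχ k)]
      _ ≤ ∑' k, quadBound Q * (ENNReal.ofReal ((2 / c + 2) * Real.exp (dampingRate Q c)) *
          (boxNorm χ k (V 0) + ∫⁻ s in Set.Ioo 0 T, boxNorm χ k (G s))) :=
          ENNReal.tsum_le_tsum fun k => mul_le_mul_right (hbox k).2 _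
      _ = _ := by rw [ENNReal.tsum_mul_left, ENNReal.tsum_mul_left, hdata, mul_assoc]
  calc _ ≤ ENNReal.ofReal (2 * Real.exp (dampingRate Q c)) * data
        + (quadBound Q * ENNReal.ofReal ((2 / c + 2) * Real.exp (dampingRate Q c)) * data + data)
        + quadBound Q * ENNReal.ofReal ((2 / c + 2) * Real.exp (dampingRate Q c)) * data :=
        add_le_add (add_le_add hsup (htime.trans (add_le_add hL1 hG_le))) hL1
    _ = _ := by rw [regConst]; ring

theorem quadSg_fourierInv (Q : Fin 3 → Fin 3 → E →L[ℂ] E) (t : ℝ) {F : R3 → E} (hF : IsSymbol F) :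
    quadSg Q t (𝓕⁻ F)
      = 𝓕⁻ (fun η => propagator (quadSymbol Q ((2 * Real.pi) • η)) t (F η)) := by
  ext1 x
  rw [quadSg, fourierAngInv]
  refine congrFun (congrArg _ (funext fun η => ?_)) x
  rw [hF.fourierAng_fourierInv, smul_smul, inv_mul_cancel₀ (by positivity), one_smul]

theorem contDiff_propagator_quadSymbol (Q : Fin 3 → Fin 3 → E →L[ℂ] E) :
    ContDiff ℝ ∞ (fun q : ℝ × R3 => propagator (quadSymbol Q ((2 * Real.pi) • q.2)) q.1) :=
  contDiff_propagator ((contDiff_quadSymbol Q).comp (contDiff_snd.const_smul (2 * Real.pi)))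
    contDiff_fst

/-- The equation on the Fourier side gives the equation in space. -/
theorem IsEvolution.timeDeriv_eq {V G : ℝ → R3 → E} (h : IsEvolution Q V G)
    (hV : IsBandSymbol r V) (hG : IsBandSymbol r G) (t : ℝ) (x : R3) :
    timeDeriv (fun t => 𝓕⁻ (V t)) t x = quadOp Q (𝓕⁻ (V t)) x + 𝓕⁻ (G t) x := by
  have hneg := (hV.quadSymbol Q).smul (m := fun _ _ => (-1 : ℂ)) contDiff_const
  rw [timeDeriv, (hV.fourierInv_hasDerivAt t x).deriv, quadOp_fourierInv Q (hV.isSymbol t),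
    ← (hneg.isSymbol t).fourierInv_add (hG.isSymbol t)]
  refine congrFun (congrArg _ (funext fun η => ?_)) x
  rw [(h t η).deriv]
  simp

/-- The homogeneous evolution of band-limited data. -/
theorem IsBand.quadSg {u₀ : R3 → E} (hu : IsBand r (fun _ => u₀))
    (Q : Fin 3 → Fin 3 → E →L[ℂ] E) :
    IsBand r (fun t => quadSg Q t u₀) ∧ IdealGas.quadSg Q 0 u₀ = u₀ ∧
      ∀ t x, IdealGas.timeDeriv (fun t => IdealGas.quadSg Q t u₀) t x
        = IdealGas.quadOp Q (IdealGas.quadSg Q t u₀) x := by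
  obtain ⟨F, hF, h⟩ := hu
  have h0 : u₀ = 𝓕⁻ (F 0) := h 0
  have hF0 : IsBandSymbol r (fun _ : ℝ => F 0) :=
    ⟨(hF.isSymbol 0).smooth.comp contDiff_snd, fun t η h => hF.supp 0 η h⟩
  have hV : IsBandSymbol r (fun t η => propagator (quadSymbol Q ((2 * Real.pi) • η)) t (F 0 η)) :=
    hF0.op (contDiff_propagator_quadSymbol Q)
  have hsg : (fun t => IdealGas.quadSg Q t u₀) = fun t =>
      𝓕⁻ (fun η => propagator (quadSymbol Q ((2 * Real.pi) • η)) t (F 0 η)) :=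
    funext fun t => by rw [h0, quadSg_fourierInv Q t (hF.isSymbol 0)]
  have hev : IsEvolution Q (fun t η => propagator (quadSymbol Q ((2 * Real.pi) • η)) t (F 0 η))
      (fun _ _ => 0) := fun t η => by
    simpa using hasDerivAt_apply (hasDerivAt_propagator' (quadSymbol Q ((2 * Real.pi) • η)) t)
      (hasDerivAt_const t (F 0 η))
  refine ⟨⟨_, hV, fun t => congrFun hsg t⟩, ?_, fun t x => ?_⟩
  · rw [congrFun hsg 0, h0]
    simp
  · rw [hsg, hev.timeDeriv_eq hV ⟨contDiff_const, fun _ _ _ => rfl⟩, congrFun hsg t]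
    simp [Real.fourierInv_eq']

end Linear

/-! ### Duhamel's integral -/

section Duhamel

variable {E : Type*} [NormedAddCommGroup E] [InnerProductSpace ℂ E] [CompleteSpace E]
variable {Q : Fin 3 → Fin 3 → E →L[ℂ] E} {r : ℝ}

/-- The Fourier side of the propagator. -/
def freqProp (Q : Fin 3 → Fin 3 → E →L[ℂ] E) (t : ℝ) (η : R3) : E →L[ℂ] E :=
  propagator (quadSymbol Q ((2 * Real.pi) • η)) t

theorem freqProp_add (Q : Fin 3 → Fin 3 → E →L[ℂ] E) (s t : ℝ) (η : R3) (v : E) :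
    freqProp Q (s + t) η v = freqProp Q s η (freqProp Q t η v) := by
  rw [freqProp, propagator_add]
  rfl

theorem freqProp_zero (Q : Fin 3 → Fin 3 → E →L[ℂ] E) (η : R3) (v : E) :
    freqProp Q 0 η v = v := by
  rw [freqProp, propagator_zero]
  rfl

theorem contDiff_freqProp (Q : Fin 3 → Fin 3 → E →L[ℂ] E) {τ : ℝ → ℝ} (hτ : ContDiff ℝ ∞ τ) :
    ContDiff ℝ ∞ (fun q : ℝ × R3 => freqProp Q (τ q.1) q.2) :=
  contDiff_propagator ((contDiff_quadSymbol Q).comp (contDiff_snd.const_smul (2 * Real.pi)))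
    (hτ.comp contDiff_fst)

/-- The Fourier side of Duhamel's integral. -/
def duhamelSymbol (Q : Fin 3 → Fin 3 → E →L[ℂ] E) (G : ℝ → R3 → E) (t : ℝ) (η : R3) : E :=
  freqProp Q t η (∫ s in (0 : ℝ)..t, freqProp Q (-s) η (G s η))

theorem IsBandSymbol.freqProp {G : ℝ → R3 → E} (hG : IsBandSymbol r G) {τ : ℝ → ℝ}
    (hτ : ContDiff ℝ ∞ τ) : IsBandSymbol r (fun s η => freqProp Q (τ s) η (G s η)) :=
  hG.op (contDiff_freqProp Q hτ)

/-- At a fixed frequency the propagator exists for negative times too. Factoring it out of the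
integral leaves an ordinary primitive followed by a smooth operator, so smoothness in `t` needs no
argument about an integrand depending on its own endpoint. -/
theorem IsBandSymbol.duhamelSymbol {G : ℝ → R3 → E} (hG : IsBandSymbol r G) :
    IsBandSymbol r (duhamelSymbol Q G) :=
  ((hG.freqProp (Q := Q) contDiff_neg).primitive).op (contDiff_freqProp Q contDiff_id)

theorem IsBandSymbol.continuous_time {G : ℝ → R3 → E} (hG : IsBandSymbol r G) (η : R3) :
    Continuous (fun s => G s η) :=
  hG.smooth.continuous.comp (Continuous.prodMk_left η)

theorem duhamelSymbol_eq {G : ℝ → R3 → E} (hG : IsBandSymbol r G) (t : ℝ) :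
    duhamelSymbol Q G t = fun η => ∫ s in (0 : ℝ)..t, freqProp Q (t - s) η (G s η) := by
  ext1 η
  have hc := (hG.freqProp (Q := Q) contDiff_neg).continuous_time η
  rw [duhamelSymbol, ← (freqProp Q t η).intervalIntegral_comp_comm (hc.intervalIntegrable _ _)]
  exact intervalIntegral.integral_congr fun s _ => by
    simp only [sub_eq_add_neg, freqProp_add]

theorem isEvolution_duhamelSymbol {G : ℝ → R3 → E} (hG : IsBandSymbol r G) :
    IsEvolution Q (duhamelSymbol Q G) G := by
  intro t η
  have hc := (hG.freqProp (Q := Q) contDiff_neg).continuous_time η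
  have h1 : HasDerivAt (fun t => ∫ s in (0 : ℝ)..t, freqProp Q (-s) η (G s η))
      (freqProp Q (-t) η (G t η)) t :=
    intervalIntegral.integral_hasDerivAt_right (hc.intervalIntegrable _ _)
      (hc.stronglyMeasurableAtFilter _ _) hc.continuousAt
  have h2 := hasDerivAt_apply
    (hasDerivAt_propagator' (quadSymbol Q ((2 * Real.pi) • η)) t) h1
  refine h2.congr_deriv ?_
  have h3 : propagator (quadSymbol Q ((2 * Real.pi) • η)) t (freqProp Q (-t) η (G t η)) = G t η := by
    have := (freqProp_add Q t (-t) η (G t η)).symm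
    rwa [add_neg_cancel, freqProp_zero] at this
  rw [h3]
  rfl

theorem fourierInv_duhamelSymbol {G : ℝ → R3 → E} (hG : IsBandSymbol r G) (t : ℝ) (x : R3) :
    𝓕⁻ (duhamelSymbol Q G t) x = ∫ s in (0 : ℝ)..t, quadSg Q (t - s) (𝓕⁻ (G s)) x := by
  have hcur : IsBandSymbol r (fun s η => freqProp Q (t - s) η (G s η)) :=
    hG.freqProp (contDiff_const.sub contDiff_id)
  rw [duhamelSymbol_eq hG, hcur.fourierInv_primitive]
  refine intervalIntegral.integral_congr fun s _ => ?_
  simp only [quadSg_fourierInv Q (t - s) (hG.isSymbol s)]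
  rfl

/-- Duhamel's integral of a band-limited source. -/
theorem IsBand.duhamel {g : ℝ → R3 → E} (hg : IsBand r g) (Q : Fin 3 → Fin 3 → E →L[ℂ] E) :
    IsBand r (fun t x => ∫ s in (0 : ℝ)..t, IdealGas.quadSg Q (t - s) (g s) x) ∧
      ∀ t x, IdealGas.timeDeriv (fun t x => ∫ s in (0 : ℝ)..t, IdealGas.quadSg Q (t - s) (g s) x) t x
        = IdealGas.quadOp Q (fun x => ∫ s in (0 : ℝ)..t, IdealGas.quadSg Q (t - s) (g s) x) x + g t x := by
  obtain ⟨G, hG, rfl⟩ := hg.symbol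
  have h : (fun t x => ∫ s in (0 : ℝ)..t, IdealGas.quadSg Q (t - s) (𝓕⁻ (G s)) x)
      = fun t => 𝓕⁻ (duhamelSymbol Q G t) := by
    ext t x
    rw [fourierInv_duhamelSymbol hG]
  refine ⟨⟨_, hG.duhamelSymbol, fun t => congrFun h t⟩, fun t x => ?_⟩
  rw [h, (isEvolution_duhamelSymbol hG).timeDeriv_eq hG.duhamelSymbol hG, ← congrFun h t]

end Duhamel

/-! ### The heat and the Lamé operators -/

section Identification

/-- The coefficients of `κΔ`. -/
def heatCoeff (κ : ℝ) (i j : Fin 3) : ℂ →L[ℂ] ℂ :=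
  if i = j then (κ : ℂ) • ContinuousLinearMap.id ℂ ℂ else 0

/-- The coefficients of the Lamé operator. -/
def lameCoeff (μ lam : ℝ) (i j : Fin 3) : C3 →L[ℂ] C3 :=
  (if i = j then (μ : ℂ) • ContinuousLinearMap.id ℂ C3 else 0) +
    ((lam + μ : ℝ) : ℂ) • (EuclideanSpace.proj j : C3 →L[ℂ] ℂ).smulRight
      (EuclideanSpace.single i (1 : ℂ))

theorem sum_coord_sq (ξ : R3) : ∑ i, (ξ i : ℂ) * (ξ i : ℂ) = ((‖ξ‖ ^ 2 : ℝ) : ℂ) := by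
  rw [EuclideanSpace.real_norm_sq_eq]
  push_cast
  exact Finset.sum_congr rfl fun i _ => by ring

theorem quadSymbol_heatCoeff (κ : ℝ) (ξ : R3) (v : ℂ) :
    quadSymbol (heatCoeff κ) ξ v = ((κ * ‖ξ‖ ^ 2 : ℝ) : ℂ) * v := by
  have h : ∀ i j, ((ξ i * ξ j : ℝ) : ℂ) * (heatCoeff κ i j v)
      = if i = j then (κ : ℂ) * v * ((ξ i : ℂ) * ξ i) else 0 := fun i j => by
    unfold heatCoeff
    split_ifs with h
    · subst h
      simp
      ring
    · simp
  simp only [quadSymbol, sum_apply, smul_apply, smul_eq_mul]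
  push_cast at h ⊢
  simp only [h, Finset.sum_ite_eq, Finset.mem_univ, if_true]
  rw [← Finset.mul_sum, sum_coord_sq]
  push_cast
  ring

theorem quadSymbol_lameCoeff (μ lam : ℝ) (ξ : R3) (v : C3) :
    quadSymbol (lameCoeff μ lam) ξ v
      = ((μ * ‖ξ‖ ^ 2 : ℝ) : ℂ) • v + ((lam + μ : ℝ) : ℂ) • (rdot ξ v • toC3 ξ) := by
  have h1 : ∀ i j : Fin 3, ((if i = j then (μ : ℂ) • ContinuousLinearMap.id ℂ C3 else 0) : C3 →L[ℂ] C3) v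
      = if i = j then (μ : ℂ) • v else 0 := fun i j => by split_ifs <;> simp
  simp only [quadSymbol, sum_apply, smul_apply, lameCoeff, add_apply, smul_add,
    Finset.sum_add_distrib, h1]
  congr 1
  · simp only [smul_ite, smul_zero, Finset.sum_ite_eq, Finset.mem_univ, if_true, smul_smul,
      ← Finset.sum_smul]
    congr 1
    have := sum_coord_sq ξ
    push_cast at this ⊢
    rw [← this, Finset.mul_sum]
    exact Finset.sum_congr rfl fun i _ => by ring
  · ext i
    simp only [ContinuousLinearMap.smulRight_apply, PiLp.smul_apply, smul_eq_mul, toC3,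
      PiLp.proj_apply, rdot, WithLp.ofLp_sum, Finset.sum_apply, PiLp.single_apply,
      Finset.mul_sum, Finset.sum_mul, mul_ite, mul_one, mul_zero]
    rw [Finset.sum_comm]
    refine Finset.sum_congr rfl fun j _ => ?_
    rw [Finset.sum_ite_eq]
    simp
    ring

theorem rdot_toC3 (ξ : R3) : rdot ξ (toC3 ξ) = ((‖ξ‖ ^ 2 : ℝ) : ℂ) := sum_coord_sq ξ

theorem rdot_smul (ξ : R3) (a : ℂ) (v : C3) : rdot ξ (a • v) = a * rdot ξ v := by
  simp only [rdot, PiLp.smul_apply, smul_eq_mul, Finset.mul_sum]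
  exact Finset.sum_congr rfl fun i _ => by ring

theorem rdot_sub (ξ : R3) (v w : C3) : rdot ξ (v - w) = rdot ξ v - rdot ξ w := by
  simp [rdot, mul_sub, Finset.sum_sub_distrib]

theorem inner_toC3 (ξ : R3) (v : C3) : inner ℂ (toC3 ξ) v = rdot ξ v := by
  simp [PiLp.inner_apply, toC3, rdot, mul_comm]

theorem norm_toC3 (ξ : R3) : ‖toC3 ξ‖ = ‖ξ‖ := by
  rw [EuclideanSpace.norm_eq, EuclideanSpace.norm_eq]
  simp [toC3]

theorem norm_sq_smul_longitudinal (ξ : R3) (v : C3) :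
    ((‖ξ‖ ^ 2 : ℝ) : ℂ) • longitudinal ξ v = rdot ξ v • toC3 ξ := by
  rcases eq_or_ne ξ 0 with rfl | h
  · simp [rdot]
  · have : ((‖ξ‖ ^ 2 : ℝ) : ℂ) ≠ 0 := by
      exact_mod_cast (pow_pos (norm_pos_iff.2 h) 2).ne'
    rw [longitudinal, smul_smul, mul_div_cancel₀ _ this]

theorem rdot_longitudinal (ξ : R3) (v : C3) : rdot ξ (longitudinal ξ v) = rdot ξ v := by
  rcases eq_or_ne ξ 0 with rfl | h
  · simp [rdot]
  · have : ((‖ξ‖ ^ 2 : ℝ) : ℂ) ≠ 0 := by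
      exact_mod_cast (pow_pos (norm_pos_iff.2 h) 2).ne'
    rw [longitudinal, rdot_smul, rdot_toC3, div_mul_cancel₀ _ this]

/-- Uniqueness for the linear equation. It identifies explicit solutions with the operator
exponential, so no exponential is ever computed. -/
theorem eq_propagator {E : Type*} [NormedAddCommGroup E] [InnerProductSpace ℂ E] [CompleteSpace E]
    (A : E →L[ℂ] E) {w : ℝ → E} (hw : ∀ s, HasDerivAt w (-(A (w s))) s) (t : ℝ) :
    w t = propagator A t (w 0) := by
  have := eq_duhamel A (h := fun _ => (0 : E)) continuous_const (v := w)
    (fun s => by simpa using hw s) t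
  simpa using this

theorem hasDerivAt_exp_smul {E : Type*} [NormedAddCommGroup E] [NormedSpace ℂ E]
    (a : ℝ) (v : E) (s : ℝ) :
    HasDerivAt (fun s : ℝ => ((Real.exp (-(s * a)) : ℝ) : ℂ) • v)
      (-((a : ℂ) • ((Real.exp (-(s * a)) : ℝ) : ℂ) • v)) s := by
  have h1 : HasDerivAt (fun s : ℝ => Real.exp (-(s * a))) (Real.exp (-(s * a)) * -(1 * a)) s :=
    (((hasDerivAt_id s).mul_const a).neg).exp
  refine (h1.ofReal_comp.smul_const v).congr_deriv ?_
  rw [smul_smul, ← neg_smul]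
  congr 1
  push_cast
  ring

theorem propagator_heatCoeff (κ t : ℝ) (ξ : R3) (v : ℂ) :
    propagator (quadSymbol (heatCoeff κ) ξ) t v = (Real.exp (-(t * κ * ‖ξ‖ ^ 2)) : ℂ) • v := by
  have h := eq_propagator (quadSymbol (heatCoeff κ) ξ)
    (w := fun s => ((Real.exp (-(s * (κ * ‖ξ‖ ^ 2))) : ℝ) : ℂ) • v) (fun s => by
      rw [quadSymbol_heatCoeff]
      exact hasDerivAt_exp_smul _ _ _) t
  simp only [zero_mul, neg_zero, Real.exp_zero, Complex.ofReal_one, one_smul] at h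
  rw [← h]
  simp only [mul_assoc]

/-- The transversal and longitudinal parts of `v` are eigenvectors for `μ|ξ|²` and `(2μ+λ)|ξ|²`, so
both sides solve the same equation with the same initial value. The case `ξ = 0` fits, as the
longitudinal part is then zero. -/
theorem propagator_lameCoeff (μ lam t : ℝ) (ξ : R3) (v : C3) :
    propagator (quadSymbol (lameCoeff μ lam) ξ) t v = lameSymbol μ lam t ξ v := by
  have h := eq_propagator (quadSymbol (lameCoeff μ lam) ξ)
    (w := fun s => ((Real.exp (-(s * (μ * ‖ξ‖ ^ 2))) : ℝ) : ℂ) • (v - longitudinal ξ v) +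
      ((Real.exp (-(s * ((2 * μ + lam) * ‖ξ‖ ^ 2))) : ℝ) : ℂ) • longitudinal ξ v) (fun s => by
      refine ((hasDerivAt_exp_smul _ _ _).add (hasDerivAt_exp_smul _ _ _)).congr_deriv ?_
      have h1 : quadSymbol (lameCoeff μ lam) ξ (v - longitudinal ξ v)
          = ((μ * ‖ξ‖ ^ 2 : ℝ) : ℂ) • (v - longitudinal ξ v) := by
        rw [quadSymbol_lameCoeff, rdot_sub, rdot_longitudinal, sub_self, zero_smul, smul_zero,
          add_zero]
      have h2 : quadSymbol (lameCoeff μ lam) ξ (longitudinal ξ v)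
          = (((2 * μ + lam) * ‖ξ‖ ^ 2 : ℝ) : ℂ) • longitudinal ξ v := by
        rw [quadSymbol_lameCoeff, rdot_longitudinal, ← norm_sq_smul_longitudinal, smul_smul,
          ← add_smul]
        congr 1
        push_cast
        ring
      rw [map_add, map_smul, map_smul, h1, h2, smul_comm, neg_add]
      congr 2
      rw [smul_comm]) t
  simp only [zero_mul, neg_zero, Real.exp_zero, Complex.ofReal_one, one_smul,
    sub_add_cancel] at h
  rw [← h, lameSymbol]
  simp only [mul_assoc]

theorem heatSg_eq (κ t : ℝ) : heatSg κ t = quadSg (heatCoeff κ) t := by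
  ext1 f
  simp only [heatSg, quadSg, propagator_heatCoeff]

theorem lameSg_eq (μ lam t : ℝ) : lameSg μ lam t = quadSg (lameCoeff μ lam) t := by
  ext1 u
  simp only [lameSg, quadSg, propagator_lameCoeff]

theorem isCoercive_heatCoeff (κ : ℝ) : IsCoercive (heatCoeff κ) κ := by
  intro ξ v
  rw [quadSymbol_heatCoeff, ← smul_eq_mul (a := ((κ * ‖ξ‖ ^ 2 : ℝ) : ℂ)), inner_smul_right,
    inner_self_eq_norm_sq_to_K, Complex.re_ofReal_mul]
  norm_cast

/-- The form is `μ|ξ|²|v|² + (λ+μ)|ξ·v|²`. If `λ+μ ≥ 0` the second term is dropped; otherwise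
Cauchy–Schwarz bounds it below by `(λ+μ)|ξ|²|v|²`, which gives `2μ+λ`. -/
theorem isCoercive_lameCoeff {μ lam : ℝ} :
    IsCoercive (lameCoeff μ lam) (min μ (2 * μ + lam)) := by
  intro ξ v
  have h0 : inner ℂ v (toC3 ξ) = (starRingEnd ℂ) (rdot ξ v) := by
    rw [← inner_conj_symm, inner_toC3]
  have h1 : (inner ℂ v (quadSymbol (lameCoeff μ lam) ξ v)).re
      = μ * ‖ξ‖ ^ 2 * ‖v‖ ^ 2 + (lam + μ) * ‖rdot ξ v‖ ^ 2 := by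
    rw [quadSymbol_lameCoeff, inner_add_right, inner_smul_right, inner_smul_right,
      inner_smul_right, inner_self_eq_norm_sq_to_K, h0, Complex.mul_conj, Complex.normSq_eq_norm_sq,
      Complex.add_re, Complex.re_ofReal_mul, Complex.re_ofReal_mul]
    norm_cast
  have h2 : ‖rdot ξ v‖ ≤ ‖ξ‖ * ‖v‖ := by
    rw [← inner_toC3, ← norm_toC3 ξ]
    exact norm_inner_le_norm _ _
  have h3 : ‖rdot ξ v‖ ^ 2 ≤ ‖ξ‖ ^ 2 * ‖v‖ ^ 2 := by
    rw [← mul_pow]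
    exact pow_le_pow_left₀ (norm_nonneg _) h2 2
  have h4 : 0 ≤ ‖ξ‖ ^ 2 * ‖v‖ ^ 2 := by positivity
  rw [h1, mul_assoc, mul_assoc]
  rcases le_total 0 (lam + μ) with h | h
  · exact (mul_le_mul_of_nonneg_right (min_le_left _ _) h4).trans
      (le_add_of_nonneg_right (by positivity))
  · refine (mul_le_mul_of_nonneg_right (min_le_right _ _) h4).trans ?_
    nlinarith [mul_le_mul_of_nonpos_left h3 h]

theorem pd_pd_eq {F : Type*} [NormedAddCommGroup F] [NormedSpace ℂ F] {f : R3 → F}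
    (hf : ContDiff ℝ ∞ f) (i j : Fin 3) (x : R3) :
    pd i (pd j f) x = iteratedFDeriv ℝ 2 f x ![e i, e j] := by
  have hd : DifferentiableAt ℝ (fderiv ℝ f) x :=
    ((hf.fderiv_right (m := ∞) (by simp)).differentiable (by simp)) x
  rw [iteratedFDeriv_two_apply, pd]
  have h : (pd j f) = fun y => fderiv ℝ f y (e j) := rfl
  rw [h, fderiv_clm_apply hd (differentiableAt_const _)]
  simp

theorem laplacian_eq_sum {F : Type*} [NormedAddCommGroup F] [NormedSpace ℂ F] {f : R3 → F}
    (hf : ContDiff ℝ ∞ f) (x : R3) :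
    Laplacian.laplacian f x = ∑ i, pd i (pd i f) x := by
  rw [InnerProductSpace.laplacian_eq_iteratedFDeriv_orthonormalBasis f
    (EuclideanSpace.basisFun (Fin 3) ℝ)]
  refine Finset.sum_congr rfl fun i _ => ?_
  rw [pd_pd_eq hf]
  simp [e]

theorem quadOp_heatCoeff (κ : ℝ) {f : R3 → ℂ} (hf : ContDiff ℝ ∞ f) (x : R3) :
    quadOp (heatCoeff κ) f x = (κ : ℂ) * Laplacian.laplacian f x := by
  rw [laplacian_eq_sum hf, quadOp, Finset.mul_sum]
  refine Finset.sum_congr rfl fun i _ => ?_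
  rw [Finset.sum_eq_single i (fun j _ h => by simp [heatCoeff, h.symm]) (by simp)]
  simp [heatCoeff]

theorem contDiff_pd {F : Type*} [NormedAddCommGroup F] [NormedSpace ℂ F] {f : R3 → F}
    (hf : ContDiff ℝ ∞ f) (i : Fin 3) : ContDiff ℝ ∞ (pd i f) :=
  (hf.fderiv_right (m := ∞) (by simp)).clm_apply contDiff_const

theorem pd_clm {F G : Type*} [NormedAddCommGroup F] [NormedSpace ℂ F] [NormedAddCommGroup G]
    [NormedSpace ℂ G] (T : F →L[ℂ] G) {f : R3 → F}
    (hf : ContDiff ℝ ∞ f) (i : Fin 3) (x : R3) : pd i (fun y => T (f y)) x = T (pd i f x) := by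
  have h := ((T.restrictScalars ℝ).hasFDerivAt.comp x
    (hf.differentiable (by simp) x).hasFDerivAt).fderiv
  have h2 : fderiv ℝ (fun y => T (f y)) x = (T.restrictScalars ℝ).comp (fderiv ℝ f x) := h
  rw [pd, h2]
  rfl

theorem pd_coord {u : R3 → C3} (hu : ContDiff ℝ ∞ u) (i j : Fin 3) (x : R3) :
    pd i (fun y => u y j) x = pd i u x j :=
  pd_clm (EuclideanSpace.proj j : C3 →L[ℂ] ℂ) hu i x

theorem quadOp_lameCoeff (μ lam : ℝ) {u : R3 → C3} (hu : ContDiff ℝ ∞ u) (x : R3) :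
    quadOp (lameCoeff μ lam) u x = lame μ lam u x := by
  have hdiv : ∀ i, pd i (dvg u) x = ∑ j, pd i (pd j u) x j := fun i => by
    have h1 : dvg u = fun y => ∑ j, (EuclideanSpace.proj j : C3 →L[ℂ] ℂ) (pd j u y) := by
      ext1 y
      exact Finset.sum_congr rfl fun j _ => pd_coord hu j j y
    have h2 : ∀ j, ContDiff ℝ ∞ (fun y => (EuclideanSpace.proj j : C3 →L[ℂ] ℂ) (pd j u y)) :=
      fun j => ((EuclideanSpace.proj j : C3 →L[ℂ] ℂ).restrictScalars ℝ).contDiff.comp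
        (contDiff_pd hu j)
    rw [h1, pd, fderiv_fun_sum fun j _ => (h2 j).differentiable (by simp) x]
    simp only [sum_apply]
    exact Finset.sum_congr rfl fun j _ => pd_clm _ (contDiff_pd hu j) i x
  have h1 : ∀ i j : Fin 3, ∀ v : C3,
      ((if i = j then (μ : ℂ) • ContinuousLinearMap.id ℂ C3 else 0) : C3 →L[ℂ] C3) v
      = if i = j then (μ : ℂ) • v else 0 := fun i j v => by split_ifs <;> simp
  rw [lame, laplacian_eq_sum hu, quadOp]
  simp only [lameCoeff, add_apply, smul_apply, Finset.sum_add_distrib, h1,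
    Finset.sum_ite_eq, Finset.mem_univ, if_true]
  rw [Finset.smul_sum]
  congr 1
  ext i
  simp only [grad, hdiv, ContinuousLinearMap.smulRight_apply, PiLp.smul_apply, smul_eq_mul,
    PiLp.proj_apply, WithLp.ofLp_sum, Finset.sum_apply, PiLp.single_apply,
    Finset.mul_sum, mul_ite, mul_one, mul_zero]
  rw [Finset.sum_comm]
  refine Finset.sum_congr rfl fun j _ => ?_
  rw [Finset.sum_ite_eq]
  simp

end Identification

/-! ### Functions with frequencies in a ball -/

section Localized

/-- The frequencies of `f` lie in the closed ball of centre `b` and radius `r`. -/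
def IsLocalized (b : R3) (r : ℝ) (f : R3 → ℂ) : Prop :=
  ∃ F : R3 → ℂ, ContDiff ℝ ∞ F ∧ (∀ η, r < ‖η - b‖ → F η = 0) ∧ f = 𝓕⁻ F

variable {b : R3} {r : ℝ} {f g : R3 → ℂ}

theorem eq_zero_of_lt_norm {F : R3 → ℂ} (h : ∀ η, r < ‖η - b‖ → F η = 0) {η : R3}
    (hη : ‖b‖ + r < ‖η‖) : F η = 0 :=
  h η (by linarith [norm_le_norm_add_norm_sub' η b])

theorem IsLocalized.isBand (hf : IsLocalized b r f) : IsBand (‖b‖ + r) (fun _ => f) := by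
  obtain ⟨F, hF, h, rfl⟩ := hf
  exact ⟨fun _ => F, ⟨hF.comp contDiff_snd, fun _ η hη => eq_zero_of_lt_norm h hη⟩, fun _ => rfl⟩

theorem isLocalized_zero (b : R3) (r : ℝ) : IsLocalized b r (fun _ => 0) :=
  ⟨fun _ => 0, contDiff_const, fun _ _ => rfl, by ext; simp [Real.fourierInv_eq']⟩

theorem IsLocalized.add (hf : IsLocalized b r f) (hg : IsLocalized b r g) :
    IsLocalized b r (fun x => f x + g x) := by
  obtain ⟨F, hF, h, rfl⟩ := hf
  obtain ⟨G, hG, h', rfl⟩ := hg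
  refine ⟨fun η => F η + G η, hF.add hG, fun η hη => by simp [h η hη, h' η hη], ?_⟩
  exact funext fun x => ((IsSymbol.of_support hF _ fun η => eq_zero_of_lt_norm h).fourierInv_add
    (IsSymbol.of_support hG _ fun η => eq_zero_of_lt_norm h') x).symm

theorem IsLocalized.const_mul (hf : IsLocalized b r f) (c : ℂ) :
    IsLocalized b r (fun x => c * f x) := by
  obtain ⟨F, hF, h, rfl⟩ := hf
  refine ⟨fun η => c * F η, contDiff_const.mul hF, fun η hη => by simp [h η hη], ?_⟩
  exact funext fun x => ((IsSymbol.of_support hF _ fun η => eq_zero_of_lt_norm h).fourierInv_clm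
    (c • ContinuousLinearMap.id ℂ ℂ) x).symm

theorem IsLocalized.sum {ι : Type*} (s : Finset ι) {f : ι → R3 → ℂ}
    (hf : ∀ i ∈ s, IsLocalized b r (f i)) : IsLocalized b r (fun x => ∑ i ∈ s, f i x) := by
  classical
  induction s using Finset.induction_on with
  | empty => simpa using isLocalized_zero b r
  | insert a s ha ih =>
    simp only [Finset.sum_insert ha]
    exact (hf a (Finset.mem_insert_self _ _)).add
      (ih fun i hi => hf i (Finset.mem_insert_of_mem hi))

theorem IsLocalized.translate (hf : IsLocalized b r f) (c : R3) :
    IsLocalized b r (fun x => f (x - c)) := by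
  obtain ⟨F, hF, h, rfl⟩ := hf
  refine ⟨fun η => Complex.exp (↑(2 * Real.pi * inner ℝ η (-c)) * Complex.I) * F η, ?_,
    fun η hη => by simp [h η hη], funext fun x => ?_⟩
  · refine ContDiff.mul (Complex.contDiff_exp.comp ((Complex.ofRealCLM.contDiff.comp ?_).mul
      contDiff_const)) hF
    exact contDiff_const.mul (contDiff_id.inner ℝ contDiff_const)
  · simp only [Real.fourierInv_eq', smul_eq_mul]
    refine integral_congr_ae (Filter.Eventually.of_forall fun η => ?_)
    simp only
    rw [← mul_assoc, ← Complex.exp_add, sub_eq_add_neg, inner_add_right]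
    congr 2
    push_cast
    ring

theorem IsLocalized.modulate (hf : IsLocalized b r f) (c : R3) :
    IsLocalized (b + c) r
      (fun x => Complex.exp (↑(2 * Real.pi * inner ℝ c x) * Complex.I) * f x) := by
  obtain ⟨F, hF, h, rfl⟩ := hf
  refine ⟨fun η => F (η - c), hF.comp (contDiff_id.sub contDiff_const),
    fun η hη => h _ (by rwa [sub_sub, add_comm c b]), funext fun x => ?_⟩
  simp only [Real.fourierInv_eq', smul_eq_mul]
  rw [← integral_const_mul, ← integral_sub_right_eq_self _ c]
  refine integral_congr_ae (Filter.Eventually.of_forall fun η => ?_)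
  simp only
  rw [← mul_assoc, ← Complex.exp_add, inner_sub_left]
  congr 2
  push_cast
  ring

/-- Dilation. -/
theorem IsLocalized.dilate (hf : IsLocalized 0 r f) {ρ : ℝ} (hρ : 0 < ρ) :
    IsLocalized 0 (ρ * r) (fun x => f (ρ • x)) := by
  obtain ⟨F, hF, h, rfl⟩ := hf
  refine ⟨fun η => ((|(ρ ^ 3)⁻¹| : ℝ) : ℂ) * F (ρ⁻¹ • η),
    contDiff_const.mul (hF.comp (contDiff_id.const_smul ρ⁻¹)), fun η hη => ?_,
    funext fun x => ?_⟩
  · simp only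
    rw [h, mul_zero]
    rw [sub_zero] at hη ⊢
    rw [norm_smul, norm_inv, Real.norm_of_nonneg hρ.le, lt_inv_mul_iff₀ hρ]
    exact hη
  · simp only [Real.fourierInv_eq', smul_eq_mul]
    have h1 := Measure.integral_comp_smul (volume : Measure R3)
      (fun η => Complex.exp (↑(2 * Real.pi * inner ℝ η x) * Complex.I) *
        (((|(ρ ^ 3)⁻¹| : ℝ) : ℂ) * F (ρ⁻¹ • η))) ρ
    rw [finrank_euclideanSpace_fin] at h1
    have h2 : (fun v : R3 => Complex.exp (↑(2 * Real.pi * inner ℝ (ρ • v) x) * Complex.I) *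
        (((|(ρ ^ 3)⁻¹| : ℝ) : ℂ) * F (ρ⁻¹ • ρ • v))) = fun v => |(ρ ^ 3)⁻¹| •
        (Complex.exp (↑(2 * Real.pi * inner ℝ v (ρ • x)) * Complex.I) * F v) := by
      ext1 v
      rw [smul_smul, inv_mul_cancel₀ hρ.ne', one_smul, real_inner_smul_left,
        real_inner_smul_right, Complex.real_smul]
      ring
    rw [h2, integral_smul] at h1
    have h3 : |(ρ ^ 3)⁻¹| ≠ 0 := by positivity
    exact smul_right_injective ℂ h3 h1

/-- The lattice points that matter for unit balls of frequencies: `21 ^ 3` of them. -/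
theorem IsLocalized.modNorm_le {χ : R3 → ℂ} (hχ : IsModulationWindow χ)
    (hf : IsLocalized b 1 f) : modNorm χ f ≤ 21 ^ 3 * kernelNorm χ * eLpNorm f 3 volume := by
  obtain ⟨F, hF, h, rfl⟩ := hf
  have hS : IsSymbol F := IsSymbol.of_support hF _ fun η => eq_zero_of_lt_norm h
  set m : Fin 3 → ℤ := fun i => ⌊2 * Real.pi * b i⌋ with hm
  set S : Finset (Fin 3 → ℤ) := Fintype.piFinset fun i => Finset.Icc (m i - 10) (m i + 10)
  have hcard : S.card = 21 ^ 3 := by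
    simp only [S, Fintype.card_piFinset, Int.card_Icc]
    have : ∀ i : Fin 3, (m i + 10 + 1 - (m i - 10)).toNat = 21 := fun i => by omega
    simp [this]
  have hzero : ∀ k ∉ S, boxNorm χ k F = 0 := by
    intro k hk
    refine boxNorm_eq_zero (funext fun η => ?_)
    by_contra hne
    have h1 : χ (relFreq k η) ≠ 0 := fun h' => hne (by simp [boxed, h'])
    have h2 : F η ≠ 0 := fun h' => hne (by simp [boxed, h'])
    have h3 : ‖η - b‖ ≤ 1 := not_lt.1 fun h' => h2 (h η h')
    refine hk (Fintype.mem_piFinset.2 fun i => ?_)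
    have h4 := hχ.mem_Ico h1 i
    rw [relFreq_apply] at h4
    have h5 : |η i - b i| ≤ 1 := by
      have := PiLp.norm_apply_le (η - b) i
      rw [Real.norm_eq_abs] at this
      exact this.trans h3
    have h6 := Int.floor_le (2 * Real.pi * b i)
    have h7 := Int.lt_floor_add_one (2 * Real.pi * b i)
    rw [abs_le] at h5
    have hpi := Real.pi_lt_d2
    have hpi0 := Real.pi_pos
    -- Since `2π < 7` and windows have side two, `k i` differs from `⌊2π b i⌋` by less than ten in
    -- either direction.
    have h8 : 2 * Real.pi * (η i - b i) ≤ 7 := by nlinarith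
    have h9 : -7 ≤ 2 * Real.pi * (η i - b i) := by nlinarith
    rw [Finset.mem_Icc]
    constructor
    · have : ((m i : ℤ) : ℝ) - 10 ≤ k i := by simp only [hm]; linarith
      exact_mod_cast this
    · have : (k i : ℝ) ≤ ((m i : ℤ) : ℝ) + 10 := by simp only [hm]; linarith
      exact_mod_cast this
  rw [modNorm_fourierInv χ hS, tsum_eq_sum hzero]
  refine (Finset.sum_le_card_nsmul S _ _ fun k _ => boxNorm_le hχ k hS).trans (le_of_eq ?_)
  rw [hcard, nsmul_eq_mul, mul_assoc]
  norm_num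

end Localized

/-! ### Almost orthogonality in `L³` -/

section AlmostOrthogonal

theorem lintegral_comp_smul_sub {f : R3 → ℝ≥0∞} (hf : Measurable f) {ρ : ℝ} (hρ : 0 < ρ) (a : R3) :
    ∫⁻ x, f (ρ • (x - a)) = ENNReal.ofReal ((ρ ^ 3)⁻¹) * ∫⁻ x, f x := by
  rw [lintegral_sub_right_eq_self (fun x => f (ρ • x)) a]
  have h := Measure.map_addHaar_smul (volume : Measure R3) hρ.ne'
  rw [finrank_euclideanSpace_fin, abs_of_pos (by positivity)] at h
  rw [← lintegral_map hf (measurable_const_smul ρ), h, lintegral_smul_measure, smul_eq_mul]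

/-- The scaling that preserves the `L³` norm. -/
theorem eLpNorm_three_scale {ψ : R3 → ℂ} (hψ : Measurable ψ) {ρ : ℝ} (hρ : 0 < ρ) (a : R3) :
    eLpNorm (fun x => (ρ : ℂ) * ψ (ρ • (x - a))) 3 volume = eLpNorm ψ 3 volume := by
  rw [eLpNorm_three, eLpNorm_three]
  congr 1
  have h1 : ∀ x, ‖(ρ : ℂ) * ψ (ρ • (x - a))‖ₑ ^ 3
      = ENNReal.ofReal (ρ ^ 3) * ‖ψ (ρ • (x - a))‖ₑ ^ 3 := fun x => by
    rw [enorm_mul, mul_pow, ← ofReal_norm, Complex.norm_of_nonneg hρ.le,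
      ENNReal.ofReal_pow hρ.le]
  simp only [h1]
  rw [lintegral_const_mul _ (by fun_prop),
    lintegral_comp_smul_sub (f := fun x => ‖ψ x‖ₑ ^ 3) (by fun_prop) hρ, ← mul_assoc,
    ← ENNReal.ofReal_mul (by positivity), mul_inv_cancel₀ (by positivity)]
  simp

/-- At every point at most one summand is nonzero, so the cubes add. The number of pieces enters
with the power `1/3` instead of `1`. -/
theorem eLpNorm_three_sum_le_of_disjoint {ι : Type*} (s : Finset ι) {f : ι → R3 → ℂ}
    (hf : ∀ i, Measurable (f i))
    (hd : ∀ x, ∀ i ∈ s, ∀ j ∈ s, i ≠ j → f i x = 0 ∨ f j x = 0) {L : ℝ≥0∞}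
    (hL : ∀ i ∈ s, eLpNorm (f i) 3 volume ≤ L) :
    eLpNorm (fun x => ∑ i ∈ s, f i x) 3 volume ≤ (s.card : ℝ≥0∞) ^ (1 / 3 : ℝ) * L := by
  have h1 : ∀ x, ‖∑ i ∈ s, f i x‖ₑ ^ 3 ≤ ∑ i ∈ s, ‖f i x‖ₑ ^ 3 := by
    intro x
    by_cases h : ∃ i ∈ s, f i x ≠ 0
    · obtain ⟨i, hi, hne⟩ := h
      rw [Finset.sum_eq_single_of_mem i hi fun j hj hji => (hd x i hi j hj hji.symm).resolve_left hne]
      exact Finset.single_le_sum (f := fun i => ‖f i x‖ₑ ^ 3) (fun _ _ => zero_le) hi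
    · push Not at h
      rw [Finset.sum_eq_zero h]
      simp
  have h2 : ∀ i ∈ s, ∫⁻ x, ‖f i x‖ₑ ^ 3 ≤ L ^ 3 := fun i hi => by
    have := hL i hi
    rw [eLpNorm_three] at this
    have h3 := ENNReal.rpow_le_rpow this (z := 3) (by norm_num)
    rw [← ENNReal.rpow_mul] at h3
    norm_num at h3
    exact h3
  rw [eLpNorm_three]
  calc _ ≤ ((s.card : ℝ≥0∞) * L ^ 3) ^ (1 / 3 : ℝ) := by
        refine ENNReal.rpow_le_rpow ?_ (by norm_num)
        refine (lintegral_mono h1).trans ?_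
        rw [lintegral_finsetSum _ fun i _ => by have := hf i; fun_prop]
        exact (Finset.sum_le_card_nsmul s _ _ h2).trans (le_of_eq (nsmul_eq_mul _ _))
    _ = _ := by
        rw [ENNReal.mul_rpow_of_nonneg _ _ (by norm_num), ← ENNReal.rpow_natCast,
          ← ENNReal.rpow_mul]
        norm_num

/-- The first moment of `φ` in `L³`. -/
def momentNorm (φ : R3 → ℂ) : ℝ≥0∞ := eLpNorm (fun x => (‖x‖ : ℂ) * φ x) 3 volume

theorem momentNorm_lt_top (φ : 𝓢(R3, ℂ)) : momentNorm φ < ⊤ := by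
  obtain ⟨C, hC⟩ : ∃ C, ∀ x, ‖φ x‖ ≤ C :=
    ⟨_, fun x => by simpa using SchwartzMap.norm_le_seminorm ℝ φ x⟩
  have hC0 : 0 ≤ C := (norm_nonneg _).trans (hC 0)
  rw [momentNorm, eLpNorm_three]
  refine ENNReal.rpow_lt_top_of_nonneg (by norm_num) (ne_of_lt ?_)
  have hi : Integrable (fun x => C ^ 2 * (‖x‖ ^ 3 * ‖φ x‖)) :=
    (φ.integrable_pow_mul volume 3).const_mul _
  refine lt_of_le_of_lt (lintegral_mono fun x => ?_) hi.2
  rw [← ofReal_norm, ← ofReal_norm, ← ENNReal.ofReal_pow (norm_nonneg _)]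
  refine ENNReal.ofReal_le_ofReal ?_
  rw [norm_mul, Complex.norm_real, norm_norm, mul_pow, Real.norm_of_nonneg (by positivity)]
  have h1 : ‖φ x‖ ^ 3 ≤ C ^ 2 * ‖φ x‖ := by
    rw [pow_succ]
    gcongr
    exact hC x
  calc _ ≤ ‖x‖ ^ 3 * (C ^ 2 * ‖φ x‖) := by gcongr
    _ = _ := by ring

theorem eLpNorm_tail_le (φ : R3 → ℂ) {M : ℝ} (hM : 0 < M) :
    eLpNorm ({x | M ≤ ‖x‖}.indicator φ) 3 volume ≤ ENNReal.ofReal M⁻¹ * momentNorm φ := by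
  refine eLpNorm_le_mul_eLpNorm_of_ae_le_mul' (c := Real.toNNReal M⁻¹)
    (Filter.Eventually.of_forall fun x => ?_) 3
  by_cases h : x ∈ {x : R3 | M ≤ ‖x‖}
  · rw [Set.indicator_of_mem h, ← ENNReal.ofReal, ← ofReal_norm, ← ofReal_norm,
      ← ENNReal.ofReal_mul (by positivity), norm_mul, Complex.norm_real, norm_norm]
    refine ENNReal.ofReal_le_ofReal ?_
    rw [inv_mul_eq_div, le_div_iff₀ hM, mul_comm]
    exact mul_le_mul_of_nonneg_right h (norm_nonneg _)
  · rw [Set.indicator_of_notMem h]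
    simp

/-- The `L³`-normalized copy of `ψ` at scale `ρ` and centre `a`. -/
def scaled (ψ : R3 → ℂ) (ρ : ℝ) (a x : R3) : ℂ := (ρ : ℂ) * ψ (ρ • (x - a))

theorem measurable_scaled {ψ : R3 → ℂ} (hψ : Measurable ψ) (ρ : ℝ) (a : R3) :
    Measurable (scaled ψ ρ a) :=
  (hψ.comp ((measurable_id.sub_const a).const_smul ρ)).const_mul _

/-- For the tails the triangle inequality suffices: the factor `M⁻¹` from the first moment will
outweigh the number of pieces, as `M` is exponential in `N`. -/
theorem eLpNorm_sum_far_le {ι : Type*} (s : Finset ι) {φ : R3 → ℂ} (hφ : Measurable φ) {ρ : ι → ℝ}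
    (hρ : ∀ i, 0 < ρ i) (a : ι → R3) {M : ℝ} (hM : 0 < M) :
    eLpNorm (fun x => ∑ i ∈ s, scaled ({x | M ≤ ‖x‖}.indicator φ) (ρ i) (a i) x) 3 volume
      ≤ s.card * (ENNReal.ofReal M⁻¹ * momentNorm φ) := by
  have hfar := hφ.indicator (measurableSet_le measurable_const measurable_norm : MeasurableSet {x : R3 | M ≤ ‖x‖})
  have h1 := eLpNorm_sum_le (μ := (volume : Measure R3)) (p := 3) (s := s)
    (f := fun i => scaled ({x | M ≤ ‖x‖}.indicator φ) (ρ i) (a i))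
    (fun i _ => (measurable_scaled hfar (ρ i) (a i)).aestronglyMeasurable) (by norm_num)
  rw [show (fun x => ∑ i ∈ s, scaled ({x | M ≤ ‖x‖}.indicator φ) (ρ i) (a i) x)
    = ∑ i ∈ s, scaled ({x | M ≤ ‖x‖}.indicator φ) (ρ i) (a i) from
      funext fun x => (Finset.sum_apply x s _).symm]
  refine h1.trans ?_
  refine (Finset.sum_le_card_nsmul s _ _ fun i _ => ?_).trans (le_of_eq (nsmul_eq_mul _ _))
  exact (eLpNorm_three_scale hfar (hρ i) (a i)).trans_le (eLpNorm_tail_le φ hM)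

theorem norm_sub_lt_of_scaled_ne_zero {φ : R3 → ℂ} {M ρ : ℝ} (hρ : 0 < ρ) {a x : R3}
    (h : scaled ({x | M ≤ ‖x‖}ᶜ.indicator φ) ρ a x ≠ 0) : ‖x - a‖ < M / ρ := by
  have h1 : ρ • (x - a) ∈ ({x | M ≤ ‖x‖}ᶜ : Set R3) := by
    by_contra h2
    exact h (by rw [scaled, Set.indicator_of_notMem h2, mul_zero])
  rw [Set.mem_compl_iff, Set.mem_setOf_eq, not_le, norm_smul, Real.norm_of_nonneg hρ.le] at h1
  rw [lt_div_iff₀ hρ, mul_comm]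
  exact h1

/-- The truncated copies live in balls of radius `M / ρ i` about `a i`, and `hsep` makes these balls
disjoint. -/
theorem eLpNorm_sum_near_le {ι : Type*} (s : Finset ι) {φ : R3 → ℂ} (hφ : Measurable φ)
    {ρ : ι → ℝ} (hρ : ∀ i, 0 < ρ i) (a : ι → R3) {M : ℝ}
    (hsep : ∀ i ∈ s, ∀ j ∈ s, i ≠ j → M / ρ i + M / ρ j ≤ ‖a i - a j‖) :
    eLpNorm (fun x => ∑ i ∈ s, scaled ({x | M ≤ ‖x‖}ᶜ.indicator φ) (ρ i) (a i) x) 3 volume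
      ≤ (s.card : ℝ≥0∞) ^ (1 / 3 : ℝ) * eLpNorm φ 3 volume := by
  have hnear := hφ.indicator (measurableSet_le measurable_const measurable_norm :
    MeasurableSet {x : R3 | M ≤ ‖x‖}).compl
  refine eLpNorm_three_sum_le_of_disjoint s (fun i => measurable_scaled hnear (ρ i) (a i))
    (fun x i hi j hj hij => ?_) fun i _ =>
      (eLpNorm_three_scale hnear (hρ i) (a i)).trans_le (eLpNorm_indicator_le φ)
  by_contra! h
  have h1 := norm_sub_lt_of_scaled_ne_zero (hρ i) h.1
  have h2 := norm_sub_lt_of_scaled_ne_zero (hρ j) h.2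
  have h3 : ‖a i - a j‖ ≤ ‖x - a i‖ + ‖x - a j‖ := by
    rw [norm_sub_rev x (a i)]
    simpa using norm_add_le (a i - x) (x - a j)
  linarith [hsep i hi j hj hij]

/-- Sums of translates and dilates with well separated centres. -/
theorem eLpNorm_sum_scaled_le {ι : Type*} (s : Finset ι) {φ : R3 → ℂ} (hφ : Measurable φ)
    {ρ : ι → ℝ} (hρ : ∀ i, 0 < ρ i) (a : ι → R3) {M : ℝ} (hM : 0 < M)
    (hsep : ∀ i ∈ s, ∀ j ∈ s, i ≠ j → M / ρ i + M / ρ j ≤ ‖a i - a j‖) :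
    eLpNorm (fun x => ∑ i ∈ s, scaled φ (ρ i) (a i) x) 3 volume
      ≤ (s.card : ℝ≥0∞) ^ (1 / 3 : ℝ) * eLpNorm φ 3 volume
        + s.card * (ENNReal.ofReal M⁻¹ * momentNorm φ) := by
  have hm : MeasurableSet {x : R3 | M ≤ ‖x‖} := measurableSet_le measurable_const measurable_norm
  have hsplit : (fun x => ∑ i ∈ s, scaled φ (ρ i) (a i) x) =
      (fun x => ∑ i ∈ s, scaled ({x | M ≤ ‖x‖}ᶜ.indicator φ) (ρ i) (a i) x)
      + fun x => ∑ i ∈ s, scaled ({x | M ≤ ‖x‖}.indicator φ) (ρ i) (a i) x := by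
    ext x
    rw [Pi.add_apply, ← Finset.sum_add_distrib]
    refine Finset.sum_congr rfl fun i _ => ?_
    rw [scaled, scaled, scaled, ← mul_add, ← Pi.add_apply, Set.indicator_compl_add_self]
  rw [hsplit]
  exact (eLpNorm_add_le
    (Finset.measurable_fun_sum s fun i _ =>
      measurable_scaled (hφ.indicator hm.compl) (ρ i) (a i)).aestronglyMeasurable
    (Finset.measurable_fun_sum s fun i _ =>
      measurable_scaled (hφ.indicator hm) (ρ i) (a i)).aestronglyMeasurable
    (by norm_num)).trans
    (add_le_add (eLpNorm_sum_near_le s hφ hρ a hsep) (eLpNorm_sum_far_le s hφ hρ a hM))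

end AlmostOrthogonal

/-! ### The initial data -/

section InitialData

variable {φ₀ : 𝓢(R3, ℂ)} {χ : R3 → ℂ}

/-- The superposition of the dyadic pieces, before modulation. -/
def envelope (φ₀ : 𝓢(R3, ℂ)) (δ : ℝ) (N : ℕ) (x : R3) : ℂ :=
  ∑ j ∈ Finset.Icc ⌈-(δ * N)⌉ (0 : ℤ), (((2 : ℝ) ^ j : ℝ) : ℂ) *
    φ₀ ((2 : ℝ) ^ j • (x - (2 : ℝ) ^ (|j| + 2 * (N : ℤ)) • e 0))

theorem norm_e (i : Fin 3) : ‖e i‖ = 1 := by simp [e]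

/-- An angular frequency of at most `2` is at most `1/π < 1` in Mathlib's normalization. Dilation by
`2^j` with `j ≤ 0` only shrinks the spectrum, and translation preserves it. -/
theorem isLocalized_envelope (hφ : IsLittlewoodPaley φ₀) (δ : ℝ) (N : ℕ) :
    IsLocalized 0 1 (envelope φ₀ δ N) := by
  have h0 : IsLocalized 0 1 φ₀ := by
    refine ⟨𝓕 (φ₀ : R3 → ℂ), ?_, fun η hη => ?_, ?_⟩
    · rw [← SchwartzMap.fourier_coe]
      exact (𝓕 φ₀ : 𝓢(R3, ℂ)).smooth'
    · by_contra hne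
      have h1 : fourierAng φ₀ ((2 * Real.pi) • η) ≠ 0 := by
        rw [fourierAng, smul_smul, inv_mul_cancel₀ (by positivity), one_smul]
        exact hne
      have h2 := (hφ.supp h1).2
      rw [norm_smul, Real.norm_of_nonneg (by positivity)] at h2
      rw [sub_zero] at hη
      nlinarith [Real.pi_gt_three]
    · rw [← SchwartzMap.fourier_coe, ← SchwartzMap.fourierInv_coe, FourierTransform.fourierInv_fourier_eq]
  refine IsLocalized.sum _ fun j hj => ?_
  rw [Finset.mem_Icc] at hj
  have hρ : (2 : ℝ) ^ j ≤ 1 := zpow_le_one_of_nonpos₀ (by norm_num) hj.2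
  obtain ⟨F, h1, h2, h3⟩ := h0.dilate (ρ := (2 : ℝ) ^ j) (by positivity)
  have h4 : IsLocalized 0 1 (fun x => φ₀ ((2 : ℝ) ^ j • x)) :=
    ⟨F, h1, fun η hη => h2 η (by linarith), h3⟩
  exact (h4.translate _).const_mul _

theorem card_dyadic_le {δ : ℝ} (hδ : δ < 1) (N : ℕ) :
    (Finset.Icc ⌈-(δ * N)⌉ (0 : ℤ)).card ≤ N + 1 := by
  rw [Int.card_Icc]
  have h : -(N : ℤ) ≤ ⌈-(δ * N)⌉ := by
    have h1 : (-(N : ℤ) : ℝ) ≤ ⌈-(δ * N)⌉ := by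
      refine le_trans ?_ (Int.le_ceil _)
      push_cast
      nlinarith [Nat.cast_nonneg (α := ℝ) N]
    exact_mod_cast h1
  omega

/-- For `i < j ≤ 0` the distance is `4^N (2^{-i} - 2^{-j})`, and `2^{-i}` is at least twice
`2^{-j}`. The factor `1/4` in the radii leaves ample room. -/
theorem separated_centres (N : ℕ) {i j : ℤ} (hi : i ≤ 0) (hj : j ≤ 0) (hij : i ≠ j) :
    (2 : ℝ) ^ (2 * N) / 4 / 2 ^ i + (2 : ℝ) ^ (2 * N) / 4 / 2 ^ j
      ≤ ‖(2 : ℝ) ^ (|i| + 2 * (N : ℤ)) • e 0 - (2 : ℝ) ^ (|j| + 2 * (N : ℤ)) • e 0‖ := by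
  wlog h : i < j generalizing i j
  · rw [add_comm, norm_sub_rev]
    exact this hj hi hij.symm (lt_of_le_of_ne (not_lt.1 h) hij.symm)
  have h2 : (2 : ℝ) ≠ 0 := by norm_num
  rw [← sub_smul, norm_smul, norm_e, mul_one, abs_of_nonpos hi, abs_of_nonpos hj,
    zpow_add₀ h2, zpow_add₀ h2, div_eq_mul_inv _ ((2 : ℝ) ^ i), div_eq_mul_inv _ ((2 : ℝ) ^ j),
    ← zpow_neg, ← zpow_neg, ← sub_mul]
  have h3 : (2 : ℝ) ^ (2 * (N : ℤ)) = 2 ^ (2 * N) := by norm_cast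
  rw [h3]
  have h4 : 2 * (2 : ℝ) ^ (-j) ≤ 2 ^ (-i) := by
    have : (2 : ℝ) ^ (-j + 1) ≤ 2 ^ (-i) := zpow_le_zpow_right₀ (by norm_num) (by omega)
    rw [zpow_add₀ h2, zpow_one] at this
    linarith
  have h5 : (0 : ℝ) < 2 ^ (-j) := by positivity
  have h6 : (0 : ℝ) < 2 ^ (2 * N) := by positivity
  refine le_trans ?_ (le_abs_self _)
  nlinarith

theorem four_mul_succ_le_four_pow {N : ℕ} (hN : 2 ≤ N) : 4 * (N + 1) ≤ 4 ^ N := by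
  induction N, hN using Nat.le_induction with
  | base => norm_num
  | succ n hn ih => rw [pow_succ]; omega

/-- In the data `2^{-2j} 2^{3j} = 2^j`, which is the `L³`-preserving normalization at scale `2^j`.
With `M = 4^N / 4` the near part is at most `(N+1)^{1/3} ≤ (8N)^{1/3} = 2 N^{1/3}` times the norm of
`φ₀`. The tails contribute at most one moment norm, by `4(N+1) ≤ 4^N`. -/
theorem eLpNorm_envelope_le (φ₀ : 𝓢(R3, ℂ)) {δ : ℝ} (hδ : δ < 1) {N : ℕ} (hN : 2 ≤ N) :
    eLpNorm (envelope φ₀ δ N) 3 volume ≤ ENNReal.ofReal ((N : ℝ) ^ (1 / 3 : ℝ)) *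
      (2 * eLpNorm φ₀ 3 volume + momentNorm φ₀) := by
  have hN0 : (1 : ℝ) ≤ N := by exact_mod_cast (by omega : 1 ≤ N)
  have h := eLpNorm_sum_scaled_le (Finset.Icc ⌈-(δ * N)⌉ (0 : ℤ)) φ₀.continuous.measurable
    (ρ := fun j => (2 : ℝ) ^ j) (fun j => by positivity)
    (fun j => (2 : ℝ) ^ (|j| + 2 * (N : ℤ)) • e 0) (M := (2 : ℝ) ^ (2 * N) / 4) (by positivity)
    fun i hi j hj hij => separated_centres N (Finset.mem_Icc.1 hi).2 (Finset.mem_Icc.1 hj).2 hij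
  refine h.trans ?_
  rw [mul_add]
  have hcard : ((Finset.Icc ⌈-(δ * N)⌉ (0 : ℤ)).card : ℝ≥0∞) ≤ ENNReal.ofReal (N + 1) := by
    rw [← Nat.cast_one (R := ℝ), ← Nat.cast_add, ENNReal.ofReal_natCast]
    exact_mod_cast card_dyadic_le hδ N
  have h1 : (1 : ℝ) ≤ (N : ℝ) ^ (1 / 3 : ℝ) := Real.one_le_rpow hN0 (by norm_num)
  refine add_le_add ?_ ?_
  · rw [← mul_assoc]
    refine mul_le_mul_left ((ENNReal.rpow_le_rpow hcard (by norm_num)).trans ?_) _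
    rw [ENNReal.ofReal_rpow_of_nonneg (by positivity) (by norm_num), ← ENNReal.ofReal_ofNat 2,
      ← ENNReal.ofReal_mul (by positivity)]
    refine ENNReal.ofReal_le_ofReal ?_
    have h8 : (8 : ℝ) ^ (1 / 3 : ℝ) = 2 := by
      rw [show (8 : ℝ) = 2 ^ (3 : ℝ) by norm_num, ← Real.rpow_mul (by norm_num)]
      norm_num
    calc _ ≤ ((8 : ℝ) * N) ^ (1 / 3 : ℝ) :=
          Real.rpow_le_rpow (by positivity) (by linarith) (by norm_num)
      _ = _ := by rw [Real.mul_rpow (by norm_num) (by positivity), h8, mul_comm]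
  · rw [← mul_assoc]
    refine mul_le_mul_left ((mul_le_mul_left hcard _).trans ?_) _
    rw [← ENNReal.ofReal_mul (by positivity)]
    refine ENNReal.ofReal_le_ofReal (le_trans ?_ h1)
    have h4 := four_mul_succ_le_four_pow hN
    have h5 : (4 : ℝ) * (N + 1) ≤ 4 ^ N := by exact_mod_cast h4
    rw [inv_div, pow_mul, show (2 : ℝ) ^ 2 = 4 by norm_num, ← mul_div_assoc,
      div_le_one (by positivity)]
    linarith

/-- The frequency of the oscillation of the data. -/
def carrier (N : ℕ) : R3 := ((2 : ℝ) ^ N / (2 * Real.pi)) • e 0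

theorem two_pi_mul_inner_carrier (N : ℕ) (x : R3) :
    2 * Real.pi * inner ℝ (carrier N) x = 2 ^ N * x 0 := by
  rw [carrier, real_inner_smul_left, e, EuclideanSpace.inner_single_left]
  field_simp
  simp

/-- One of the two halves of the oscillating data. -/
def modulatedEnvelope (φ₀ : 𝓢(R3, ℂ)) (δ : ℝ) (N : ℕ) (c : R3) (x : R3) : ℂ :=
  Complex.exp (↑(2 * Real.pi * inner ℝ c x) * Complex.I) * envelope φ₀ δ N x

/-- The sine is split into two exponentials, so that each half has its spectrum in a unit ball and
meets boundedly many boxes. -/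
theorem initialFirst_eq (φ₀ : 𝓢(R3, ℂ)) (δ : ℝ) (N : ℕ) (x : R3) :
    initialFirst φ₀ δ N x =
      (((amp N * (N : ℝ) ^ (-(1 / 3) : ℝ) : ℝ) : ℂ) * (Complex.I / 2)) *
        modulatedEnvelope φ₀ δ N (-carrier N) x
      + (-((amp N * (N : ℝ) ^ (-(1 / 3) : ℝ) : ℝ) : ℂ) * (Complex.I / 2)) *
        modulatedEnvelope φ₀ δ N (carrier N) x := by
  have h1 : ∀ j ∈ Finset.Icc ⌈-(δ * N)⌉ (0 : ℤ), (((2 : ℝ) ^ (-2 * j) : ℝ) : ℂ) *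
      dyadic φ₀ j (x - (2 : ℝ) ^ (|j| + 2 * (N : ℤ)) • e 0) * ((Real.sin (2 ^ N * x 0) : ℝ) : ℂ)
      = ((((2 : ℝ) ^ j : ℝ) : ℂ) *
        φ₀ ((2 : ℝ) ^ j • (x - (2 : ℝ) ^ (|j| + 2 * (N : ℤ)) • e 0))) *
        ((Real.sin (2 ^ N * x 0) : ℝ) : ℂ) := fun j _ => by
    rw [dyadic, ← mul_assoc, ← Complex.ofReal_mul, ← zpow_add₀ (by norm_num)]
    congr 5
    ring
  rw [initialFirst, Finset.sum_congr rfl h1, ← Finset.sum_mul, ← envelope, Complex.ofReal_sin,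
    Complex.sin]
  simp only [modulatedEnvelope, inner_neg_left, mul_neg, two_pi_mul_inner_carrier]
  push_cast
  ring

theorem isLocalized_modulatedEnvelope (hφ : IsLittlewoodPaley φ₀) (δ : ℝ) (N : ℕ) (c : R3) :
    IsLocalized c 1 (modulatedEnvelope φ₀ δ N c) := by
  have := (isLocalized_envelope hφ δ N).modulate c
  rwa [zero_add] at this

theorem eLpNorm_modulatedEnvelope (φ₀ : 𝓢(R3, ℂ)) (δ : ℝ) (N : ℕ) (c : R3) :
    eLpNorm (modulatedEnvelope φ₀ δ N c) 3 volume = eLpNorm (envelope φ₀ δ N) 3 volume := by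
  refine eLpNorm_congr_norm_ae (Filter.Eventually.of_forall fun x => ?_)
  rw [modulatedEnvelope, norm_mul, Complex.norm_exp_ofReal_mul_I, one_mul]

theorem norm_carrier (N : ℕ) : ‖carrier N‖ = 2 ^ N / (2 * Real.pi) := by
  rw [carrier, norm_smul, norm_e, mul_one, Real.norm_of_nonneg (by positivity)]

/-- The spectrum lies within `2^N / (2π) + 1 ≤ 2^N / 2 + 1 ≤ 2^N`, the last step by `N ≥ 2`. This
fixes the basic bandwidth `2^N`. -/
theorem isBand_modulatedEnvelope (hφ : IsLittlewoodPaley φ₀) (δ : ℝ) {N : ℕ} (hN : 2 ≤ N)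
    {c : R3} (hc : ‖c‖ = ‖carrier N‖) :
    IsBand (2 ^ N) (fun _ => modulatedEnvelope φ₀ δ N c) := by
  refine (isLocalized_modulatedEnvelope hφ δ N c).isBand.mono ?_
  rw [hc, norm_carrier]
  have h1 : (2 : ℝ) ^ 2 ≤ 2 ^ N := pow_le_pow_right₀ (by norm_num) hN
  have h2 : (2 : ℝ) ^ N / (2 * Real.pi) ≤ 2 ^ N / 2 := by
    refine div_le_div_of_nonneg_left (by positivity) (by norm_num) ?_
    linarith [Real.pi_gt_three]
  linarith

theorem isBand_initialFirst (hφ : IsLittlewoodPaley φ₀) (δ : ℝ) {N : ℕ} (hN : 2 ≤ N) :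
    IsBand (2 ^ N) (fun _ => initialFirst φ₀ δ N) := by
  have h1 := (isBand_modulatedEnvelope hφ δ hN (norm_neg (carrier N))).const_smul
    (((amp N * (N : ℝ) ^ (-(1 / 3) : ℝ) : ℝ) : ℂ) * (Complex.I / 2))
  have h2 := (isBand_modulatedEnvelope hφ δ hN (rfl : ‖carrier N‖ = _)).const_smul
    (-((amp N * (N : ℝ) ^ (-(1 / 3) : ℝ) : ℝ) : ℂ) * (Complex.I / 2))
  have h3 := h1.add h2
  simp only [smul_eq_mul] at h3
  rwa [show (fun _ : ℝ => initialFirst φ₀ δ N) = _ from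
    funext fun _ => funext fun x => initialFirst_eq φ₀ δ N x]

/-- The embedding of scalars as first components. -/
def firstComponent : ℂ →L[ℂ] C3 :=
  ContinuousLinearMap.toSpanSingleton ℂ (EuclideanSpace.single 0 1)

theorem initialVelocity_eq (φ₀ : 𝓢(R3, ℂ)) (δ : ℝ) (N : ℕ) (x : R3) :
    initialVelocity φ₀ δ N x = firstComponent (initialFirst φ₀ δ N x) := by
  ext i
  simp [initialVelocity, firstComponent]

theorem isBand_initialVelocity (hφ : IsLittlewoodPaley φ₀) (δ : ℝ) {N : ℕ} (hN : 2 ≤ N) :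
    IsBand (2 ^ N) (fun _ => initialVelocity φ₀ δ N) := by
  have h := (isBand_initialFirst hφ δ hN).clm firstComponent
  rwa [show (fun _ : ℝ => initialVelocity φ₀ δ N) = _ from
    funext fun _ => funext fun x => initialVelocity_eq φ₀ δ N x]

/-- The size of the initial data, relative to the amplitude. -/
def dataConst (χ : R3 → ℂ) (φ₀ : 𝓢(R3, ℂ)) : ℝ≥0∞ :=
  ‖firstComponent‖ₑ * (21 ^ 3 * kernelNorm χ * (2 * eLpNorm φ₀ 3 volume + momentNorm φ₀))

theorem dataConst_lt_top (hχ : IsModulationWindow χ) (φ₀ : 𝓢(R3, ℂ)) : dataConst χ φ₀ < ⊤ := by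
  refine ENNReal.mul_lt_top enorm_lt_top (ENNReal.mul_lt_top (ENNReal.mul_lt_top
    (ENNReal.pow_lt_top (by simp)) (kernelNorm_lt_top hχ.isSymbol)) (ENNReal.add_lt_top.2
    ⟨ENNReal.mul_lt_top (by simp) (SchwartzMap.eLpNorm_lt_top _ _ _), momentNorm_lt_top φ₀⟩))

theorem amp_nonneg (N : ℕ) : 0 ≤ amp N := inv_nonneg.2 (Real.log_natCast_nonneg N)

/-- The prefactor `N^{-1/3}` cancels the `N^{1/3}` of the envelope, so only `R` is left, with a
constant free of `N` and `δ`. -/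
theorem modNorm_initialVelocity_le (hχ : IsModulationWindow χ) (hφ : IsLittlewoodPaley φ₀)
    {δ : ℝ} (hδ : δ < 1) {N : ℕ} (hN : 2 ≤ N) :
    modNorm χ (initialVelocity φ₀ δ N) ≤ dataConst χ φ₀ * ENNReal.ofReal (amp N) := by
  have hN0 : (0 : ℝ) < N := by exact_mod_cast (by omega : 0 < N)
  set A : ℝ := amp N * (N : ℝ) ^ (-(1 / 3) : ℝ) with hA
  have hA0 : 0 ≤ A := mul_nonneg (amp_nonneg N) (by positivity)
  have hpiece : ∀ c : R3, modNorm χ (modulatedEnvelope φ₀ δ N c) ≤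
      21 ^ 3 * kernelNorm χ * (ENNReal.ofReal ((N : ℝ) ^ (1 / 3 : ℝ)) *
        (2 * eLpNorm φ₀ 3 volume + momentNorm φ₀)) := fun c => by
    refine ((isLocalized_modulatedEnvelope hφ δ N c).modNorm_le hχ).trans ?_
    rw [eLpNorm_modulatedEnvelope]
    exact mul_le_mul_right (eLpNorm_envelope_le φ₀ hδ hN) _
  have b1 := isBand_modulatedEnvelope hφ δ hN (norm_neg (carrier N))
  have b2 := isBand_modulatedEnvelope hφ δ hN (rfl : ‖carrier N‖ = _)
  have hnorm : ∀ a : ℂ, ‖a‖ = A / 2 → ‖a‖ₑ = ENNReal.ofReal (A / 2) := fun a h => by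
    rw [← ofReal_norm, h]
  have n1 : ‖(A : ℂ) * (Complex.I / 2)‖ = A / 2 := by
    rw [norm_mul, Complex.norm_of_nonneg hA0]; simp [div_eq_mul_inv]
  have n2 : ‖-(A : ℂ) * (Complex.I / 2)‖ = A / 2 := by rw [neg_mul, norm_neg, n1]
  have hfirst : modNorm χ (initialFirst φ₀ δ N) ≤ ENNReal.ofReal A *
      (21 ^ 3 * kernelNorm χ * (ENNReal.ofReal ((N : ℝ) ^ (1 / 3 : ℝ)) *
        (2 * eLpNorm φ₀ 3 volume + momentNorm φ₀))) := by
    have h := (b1.const_smul ((A : ℂ) * (Complex.I / 2))).modNorm_add_le hχ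
      (b2.const_smul (-(A : ℂ) * (Complex.I / 2))) 0
    simp only [smul_eq_mul] at h
    rw [show initialFirst φ₀ δ N = _ from funext fun x => initialFirst_eq φ₀ δ N x]
    refine h.trans ?_
    have h1 := b1.modNorm_const_smul_le hχ ((A : ℂ) * (Complex.I / 2)) 0
    have h2 := b2.modNorm_const_smul_le hχ (-(A : ℂ) * (Complex.I / 2)) 0
    rw [hnorm _ n1] at h1
    rw [hnorm _ n2] at h2
    refine (add_le_add (h1.trans (mul_le_mul_right (hpiece _) _))
      (h2.trans (mul_le_mul_right (hpiece _) _))).trans (le_of_eq ?_)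
    rw [← add_mul, ← ENNReal.ofReal_add (by positivity) (by positivity), add_halves]
  have hvel : modNorm χ (initialVelocity φ₀ δ N)
      ≤ ‖firstComponent‖ₑ * modNorm χ (initialFirst φ₀ δ N) := by
    rw [show initialVelocity φ₀ δ N = _ from funext fun x => initialVelocity_eq φ₀ δ N x]
    exact (isBand_initialFirst hφ δ hN).modNorm_clm_le hχ firstComponent 0
  refine hvel.trans ((mul_le_mul_right hfirst _).trans (le_of_eq ?_))
  have hamp : ENNReal.ofReal (amp N) = ENNReal.ofReal A * ENNReal.ofReal ((N : ℝ) ^ (1 / 3 : ℝ)) := by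
    rw [← ENNReal.ofReal_mul hA0, hA, mul_assoc, ← Real.rpow_add hN0]
    norm_num
  rw [hamp, dataConst]
  ring

end InitialData

/-! ### Differential operators on band-limited functions -/

section Operators

variable {E : Type*} [NormedAddCommGroup E] [NormedSpace ℂ E] [CompleteSpace E] {χ : R3 → ℂ}
variable {r r' K x y t : ℝ}

/-- A common bound for the constants of the product rule and of Bernstein's inequality. -/
structure IsAlgebraBound (χ : R3 → ℂ) (K : ℝ) : Prop where
  one_le : 1 ≤ K
  prod : prodConst χ ≤ ENNReal.ofReal K
  deriv : derivConst ≤ ENNReal.ofReal K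

theorem IsAlgebraBound.nonneg (hK : IsAlgebraBound χ K) : 0 ≤ K := zero_le_one.trans hK.one_le

theorem enorm_clm_le_one {F G : Type*} [NormedAddCommGroup F] [NormedSpace ℂ F]
    [NormedAddCommGroup G] [NormedSpace ℂ G] {T : F →L[ℂ] G} (h : ∀ x, ‖T x‖ ≤ ‖x‖) : ‖T‖ₑ ≤ 1 := by
  rw [← ofReal_norm, ← ENNReal.ofReal_one]
  exact ENNReal.ofReal_le_ofReal
    (ContinuousLinearMap.opNorm_le_bound _ zero_le_one fun x => by simpa using h x)

/-- The projection to the component of index `i`. -/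
def coordProj (i : Fin 3) : C3 →L[ℂ] ℂ := EuclideanSpace.proj i

theorem enorm_coordProj_le (i : Fin 3) : ‖coordProj i‖ₑ ≤ 1 :=
  enorm_clm_le_one fun v => PiLp.norm_apply_le v i

/-- The embedding as the component of index `i`. -/
def coordIncl (i : Fin 3) : ℂ →L[ℂ] C3 :=
  ContinuousLinearMap.toSpanSingleton ℂ (EuclideanSpace.single i 1)

theorem enorm_coordIncl_le (i : Fin 3) : ‖coordIncl i‖ₑ ≤ 1 :=
  enorm_clm_le_one fun v => by simp [coordIncl, norm_smul]

/-- `f` is band-limited, and its norm at time `t` is at most `x`. -/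
structure BandLE (χ : R3 → ℂ) (t r : ℝ) (f : ℝ → R3 → E) (x : ℝ) : Prop where
  band : IsBand r f
  nonneg : 0 ≤ x
  le : modNorm χ (f t) ≤ ENNReal.ofReal x

namespace BandLE

theorem mono {f : ℝ → R3 → E} (hf : BandLE χ t r f x) (hr : r ≤ r') (hx : x ≤ y) :
    BandLE χ t r' f y :=
  ⟨hf.band.mono hr, hf.nonneg.trans hx, hf.le.trans (ENNReal.ofReal_le_ofReal hx)⟩

theorem clm (hχ : IsModulationWindow χ) {E' : Type*} [NormedAddCommGroup E']
    [NormedSpace ℂ E'] [CompleteSpace E'] {T : E →L[ℂ] E'} (hT : ‖T‖ₑ ≤ 1) {f : ℝ → R3 → E}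
    (hf : BandLE χ t r f x) : BandLE χ t r (fun t z => T (f t z)) x :=
  ⟨hf.band.clm T, hf.nonneg,
    (hf.band.modNorm_clm_le hχ T t).trans ((mul_le_mul' hT hf.le).trans (one_mul _).le)⟩

theorem add (hχ : IsModulationWindow χ) {f g : ℝ → R3 → E} (hf : BandLE χ t r f x)
    (hg : BandLE χ t r g y) : BandLE χ t r (fun t z => f t z + g t z) (x + y) := by
  refine ⟨hf.band.add hg.band, add_nonneg hf.nonneg hg.nonneg, ?_⟩
  rw [ENNReal.ofReal_add hf.nonneg hg.nonneg]
  exact (hf.band.modNorm_add_le hχ hg.band t).trans (add_le_add hf.le hg.le)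

theorem neg (hχ : IsModulationWindow χ) {f : ℝ → R3 → E} (hf : BandLE χ t r f x) :
    BandLE χ t r (fun t z => - f t z) x :=
  ⟨hf.band.neg, hf.nonneg, (hf.band.modNorm_neg_le hχ t).trans hf.le⟩

theorem sub (hχ : IsModulationWindow χ) {f g : ℝ → R3 → E} (hf : BandLE χ t r f x)
    (hg : BandLE χ t r g y) : BandLE χ t r (fun t z => f t z - g t z) (x + y) := by
  simpa only [sub_eq_add_neg] using hf.add hχ (hg.neg hχ)

theorem sum (hχ : IsModulationWindow χ) {ι : Type*} (s : Finset ι) {f : ι → ℝ → R3 → E}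
    {x : ι → ℝ} (hf : ∀ i ∈ s, BandLE χ t r (f i) (x i)) :
    BandLE χ t r (fun t z => ∑ i ∈ s, f i t z) (∑ i ∈ s, x i) := by
  refine ⟨IsBand.sum s fun i hi => (hf i hi).band, Finset.sum_nonneg fun i hi => (hf i hi).nonneg,
    ?_⟩
  rw [ENNReal.ofReal_sum_of_nonneg fun i hi => (hf i hi).nonneg]
  exact (IsBand.modNorm_sum_le hχ s (fun i hi => (hf i hi).band) t).trans
    (Finset.sum_le_sum fun i hi => (hf i hi).le)

theorem sum_fin (hχ : IsModulationWindow χ) {f : Fin 3 → ℝ → R3 → E}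
    (hf : ∀ i, BandLE χ t r (f i) x) :
    BandLE χ t r (fun t z => ∑ i, f i t z) (3 * x) := by
  have h := sum hχ Finset.univ fun i _ => hf i
  simpa using h

theorem const_smul (hχ : IsModulationWindow χ) {f : ℝ → R3 → E} (hf : BandLE χ t r f x) {c : ℂ}
    {k : ℝ} (hc : ‖c‖ ≤ k) : BandLE χ t r (fun t z => c • f t z) (k * x) := by
  have hk := (norm_nonneg _).trans hc
  refine ⟨hf.band.const_smul c, mul_nonneg hk hf.nonneg, ?_⟩
  rw [ENNReal.ofReal_mul hk]
  refine (hf.band.modNorm_const_smul_le hχ c t).trans (mul_le_mul' ?_ hf.le)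
  rw [← ofReal_norm]
  exact ENNReal.ofReal_le_ofReal hc

theorem smul (hχ : IsModulationWindow χ) (hK : IsAlgebraBound χ K) {a : ℝ → R3 → ℂ}
    {f : ℝ → R3 → E} (ha : BandLE χ t r a x) (hf : BandLE χ t r' f y) :
    BandLE χ t (r + r') (fun t z => a t z • f t z) (K * x * y) := by
  refine ⟨ha.band.smul hf.band, mul_nonneg (mul_nonneg hK.nonneg ha.nonneg) hf.nonneg, ?_⟩
  rw [ENNReal.ofReal_mul (mul_nonneg hK.nonneg ha.nonneg), ENNReal.ofReal_mul hK.nonneg]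
  exact (ha.band.modNorm_smul_le hχ hf.band t).trans (mul_le_mul' (mul_le_mul' hK.prod ha.le) hf.le)

theorem mul (hχ : IsModulationWindow χ) (hK : IsAlgebraBound χ K) {a f : ℝ → R3 → ℂ}
    (ha : BandLE χ t r a x) (hf : BandLE χ t r' f y) :
    BandLE χ t (r + r') (fun t z => a t z * f t z) (K * x * y) :=
  ha.smul hχ hK hf

theorem pd (hχ : IsModulationWindow χ) (hK : IsAlgebraBound χ K) (hr : 1 ≤ r)
    {f : ℝ → R3 → E} (hf : BandLE χ t r f x) (i : Fin 3) :
    BandLE χ t r (fun t => IdealGas.pd i (f t)) (K * r * x) := by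
  have hKr := mul_nonneg hK.nonneg (zero_le_one.trans hr)
  refine ⟨hf.band.pd i, mul_nonneg hKr hf.nonneg, ?_⟩
  rw [ENNReal.ofReal_mul hKr, ENNReal.ofReal_mul hK.nonneg]
  exact (hf.band.modNorm_pd_le hχ hr i t).trans (mul_le_mul' (mul_le_mul' hK.deriv le_rfl) hf.le)

theorem coord (hχ : IsModulationWindow χ) {u : ℝ → R3 → C3} (hu : BandLE χ t r u x) (i : Fin 3) :
    BandLE χ t r (fun t z => u t z i) x :=
  clm hχ (enorm_coordProj_le i) hu

theorem advect (hχ : IsModulationWindow χ) (hK : IsAlgebraBound χ K) {u : ℝ → R3 → C3}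
    {f : ℝ → R3 → E} (hu : BandLE χ t r u x) (hf : BandLE χ t r' f y) (hr' : 1 ≤ r') :
    BandLE χ t (r + r') (fun t => IdealGas.advect (u t) (f t)) (3 * (K * x * (K * r' * y))) :=
  sum_fin hχ fun i => (hu.coord hχ i).smul hχ hK (hf.pd hχ hK hr' i)

theorem dvg (hχ : IsModulationWindow χ) (hK : IsAlgebraBound χ K) {u : ℝ → R3 → C3}
    (hu : BandLE χ t r u x) (hr : 1 ≤ r) :
    BandLE χ t r (fun t => IdealGas.dvg (u t)) (3 * (K * r * x)) :=
  sum_fin hχ fun i => (hu.coord hχ i).pd hχ hK hr i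

theorem grad_eq (f : R3 → ℂ) (z : R3) :
    IdealGas.grad f z = ∑ i, coordIncl i (IdealGas.pd i f z) := by
  ext j
  simp [IdealGas.grad, coordIncl, Finset.sum_apply, Pi.single_apply]

theorem grad (hχ : IsModulationWindow χ) (hK : IsAlgebraBound χ K) {f : ℝ → R3 → ℂ}
    (hf : BandLE χ t r f x) (hr : 1 ≤ r) :
    BandLE χ t r (fun t => IdealGas.grad (f t)) (3 * (K * r * x)) := by
  rw [show (fun t => IdealGas.grad (f t)) = fun t z => ∑ i, coordIncl i (IdealGas.pd i (f t) z)
    from funext fun t => funext fun z => grad_eq (f t) z]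
  exact sum_fin hχ fun i => clm hχ (enorm_coordIncl_le i) (hf.pd hχ hK hr i)

theorem deform (hχ : IsModulationWindow χ) (hK : IsAlgebraBound χ K) {u : ℝ → R3 → C3}
    (hu : BandLE χ t r u x) (hr : 1 ≤ r) (i j : Fin 3) :
    BandLE χ t r (fun t z => IdealGas.deform (u t) z i j) (K * r * x) := by
  have h := (((hu.coord hχ j).pd hχ hK hr i).add hχ ((hu.coord hχ i).pd hχ hK hr j)).const_smul hχ
    (c := 1 / 2) (k := 1 / 2) (by simp)
  rw [show 1 / 2 * (K * r * x + K * r * x) = K * r * x by ring] at h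
  rw [show (fun t z => IdealGas.deform (u t) z i j) = fun t z => (1 / 2 : ℂ) •
      (IdealGas.pd i (fun y => u t y j) z + IdealGas.pd j (fun y => u t y i) z) from
    funext fun t => funext fun z => (div_eq_inv_mul _ (2 : ℂ)).trans (by simp)]
  exact h

theorem dissip_eq (μ lam : ℝ) (u v : R3 → C3) (z : R3) :
    IdealGas.dissip μ lam u v z
      = (2 * (μ : ℂ)) • (∑ i, ∑ j, IdealGas.deform u z i j • IdealGas.deform v z i j)
        + (lam : ℂ) • (IdealGas.dvg u z • IdealGas.dvg v z) := by
  simp [IdealGas.dissip, Matrix.trace, Matrix.mul_apply]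

theorem dissip (hχ : IsModulationWindow χ) (hK : IsAlgebraBound χ K) {μ lam : ℝ}
    (hμ : |μ| ≤ K) (hlam : |lam| ≤ K) {u v : ℝ → R3 → C3} (hu : BandLE χ t r u x)
    (hv : BandLE χ t r' v y) (hr : 1 ≤ r) (hr' : 1 ≤ r') :
    BandLE χ t (r + r') (fun t => IdealGas.dissip μ lam (u t) (v t))
      (27 * K ^ 4 * (r * r' * x * y)) := by
  rw [show (fun t => IdealGas.dissip μ lam (u t) (v t)) = fun t z =>
      (2 * (μ : ℂ)) • (∑ i, ∑ j, IdealGas.deform (u t) z i j • IdealGas.deform (v t) z i j)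
        + (lam : ℂ) • (IdealGas.dvg (u t) z • IdealGas.dvg (v t) z) from
    funext fun t => funext fun z => dissip_eq μ lam (u t) (v t) z]
  have h1 := (sum_fin hχ fun i => sum_fin hχ fun j => (hu.deform hχ hK hr i j).smul hχ hK
    (hv.deform hχ hK hr' i j)).const_smul hχ (c := 2 * (μ : ℂ)) (k := 2 * K) (by
      rw [norm_mul, Complex.norm_real, Real.norm_eq_abs]; simpa using hμ)
  have h2 := ((hu.dvg hχ hK hr).smul hχ hK (hv.dvg hχ hK hr')).const_smul hχ (c := (lam : ℂ))
    (k := K) (by rw [Complex.norm_real, Real.norm_eq_abs]; exact hlam)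
  -- The constant is `27 = 18 + 9`: `2·9` from the nine entries of the tensors, and `3·3` from the
  -- two divergences.
  exact (h1.add hχ h2).mono le_rfl (le_of_eq (by ring))

end BandLE

end Operators

/-! ### Convolution sums of the weights -/

section Weights

/-- The weights `q y^k / k³`; the weight of index zero vanishes. -/
def wt (q y : ℝ) (k : ℕ) : ℝ := q * y ^ k / k ^ 3

/-- This rests on `1/0 = 0`, and it agrees with the vanishing triple of index zero: summands with
`P_0` need no separate treatment. -/
theorem wt_zero (q y : ℝ) : wt q y 0 = 0 := by simp [wt]

theorem wt_nonneg {q y : ℝ} (hq : 0 ≤ q) (hy : 0 ≤ y) (k : ℕ) : 0 ≤ wt q y k := by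
  unfold wt; positivity

theorem sum_inv_sq_le (n : ℕ) : ∑ i ∈ Finset.Icc 1 n, ((i : ℝ) ^ 2)⁻¹ ≤ 2 := by
  rcases Nat.eq_zero_or_pos n with rfl | hn
  · norm_num
  suffices h : ∑ i ∈ Finset.Icc 1 n, ((i : ℝ) ^ 2)⁻¹ ≤ 2 - (n : ℝ)⁻¹ from
    h.trans (sub_le_self _ (by positivity))
  induction n, hn using Nat.le_induction with
  | base => norm_num
  | succ n hn ih =>
    rw [Finset.sum_Icc_succ_top (by omega)]
    refine (add_le_add_left ih _).trans ?_
    have hn0 : (0 : ℝ) < n := by exact_mod_cast hn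
    have h1 : (n : ℝ)⁻¹ - ((n + 1 : ℕ) : ℝ)⁻¹ - (((n + 1 : ℕ) : ℝ) ^ 2)⁻¹
        = 1 / (n * (n + 1) ^ 2) := by
      push_cast
      field_simp
      ring
    have h2 : (0 : ℝ) ≤ 1 / (n * (n + 1) ^ 2) := by positivity
    linarith

theorem sum_Icc_reflect (f : ℕ → ℝ) (k : ℕ) :
    ∑ i ∈ Finset.Icc 1 (k - 1), f (k - i) = ∑ i ∈ Finset.Icc 1 (k - 1), f i := by
  refine Finset.sum_bij' (fun i _ => k - i) (fun i _ => k - i) ?_ ?_ ?_ ?_ ?_ <;>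
    intro i hi <;> rw [Finset.mem_Icc] at hi <;> try rw [Finset.mem_Icc]
  all_goals first | rfl | omega

variable {q y : ℝ} {k : ℕ}

/-- The convolution of the derivatives of the weights. -/
def convDeriv (q y : ℝ) (k : ℕ) : ℝ :=
  ∑ i ∈ Finset.Icc 1 (k - 1), (i : ℝ) * ((k - i : ℕ) : ℝ) * (wt q y i * wt q y (k - i))

theorem convDeriv_nonneg (hq : 0 ≤ q) (hy : 0 ≤ y) (k : ℕ) : 0 ≤ convDeriv q y k :=
  Finset.sum_nonneg fun i _ => by
    have := wt_nonneg hq hy i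
    have := wt_nonneg hq hy (k - i)
    positivity

theorem index_mul_wt (hi : 0 < k) : (k : ℝ) * wt q y k = q * y ^ k * ((k : ℝ) ^ 2)⁻¹ := by
  have : (0 : ℝ) < k := by exact_mod_cast hi
  unfold wt
  field_simp

/-- With its derivative a weight becomes `q y^i / i²`. From `(i+j)² ≤ 2i² + 2j²` follows `1/(i²j²) ≤
(2/i² + 2/j²)/k²`, and each sum of inverse squares is at most two. The result keeps one factor `k`
and gains one factor `q`. -/
theorem convDeriv_le (hy : 0 ≤ y) (hk : 0 < k) : convDeriv q y k ≤ 8 * q * (k * wt q y k) := by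
  have hk0 : (0 : ℝ) < k := by exact_mod_cast hk
  have h1 : ∀ i ∈ Finset.Icc 1 (k - 1),
      (i : ℝ) * ((k - i : ℕ) : ℝ) * (wt q y i * wt q y (k - i))
      ≤ q ^ 2 * y ^ k * ((k : ℝ) ^ 2)⁻¹ *
        (2 * ((i : ℝ) ^ 2)⁻¹ + 2 * (((k - i : ℕ) : ℝ) ^ 2)⁻¹) := by
    intro i hi
    rw [Finset.mem_Icc] at hi
    obtain ⟨j, hj⟩ : ∃ j, j = k - i := ⟨_, rfl⟩
    rw [← hj]
    have hj0 : 0 < j := by omega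
    have hi' : (0 : ℝ) < i := by exact_mod_cast hi.1
    have hj' : (0 : ℝ) < j := by exact_mod_cast hj0
    have hkij : (k : ℝ) = i + j := by exact_mod_cast (by omega : k = i + j)
    have hpow : y ^ k = y ^ i * y ^ j := by rw [← pow_add]; congr 1; omega
    calc (i : ℝ) * j * (wt q y i * wt q y j) = (i * wt q y i) * (j * wt q y j) := by ring
      _ = q ^ 2 * y ^ k * (((i : ℝ) ^ 2)⁻¹ * ((j : ℝ) ^ 2)⁻¹) := by
          rw [index_mul_wt hi.1, index_mul_wt hj0, hpow]; ring
      _ ≤ q ^ 2 * y ^ k * (((k : ℝ) ^ 2)⁻¹ * (2 * ((i : ℝ) ^ 2)⁻¹ + 2 * ((j : ℝ) ^ 2)⁻¹)) := by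
          refine mul_le_mul_of_nonneg_left ?_ (by positivity)
          have h2 : ((k : ℝ) ^ 2)⁻¹ * (2 * ((i : ℝ) ^ 2)⁻¹ + 2 * ((j : ℝ) ^ 2)⁻¹)
              - ((i : ℝ) ^ 2)⁻¹ * ((j : ℝ) ^ 2)⁻¹
              = ((i : ℝ) - j) ^ 2 * (((i : ℝ) ^ 2)⁻¹ * ((j : ℝ) ^ 2)⁻¹ * ((k : ℝ) ^ 2)⁻¹) := by
            rw [hkij]
            field_simp
            ring
          have h3 : 0 ≤ ((i : ℝ) - j) ^ 2 *
              (((i : ℝ) ^ 2)⁻¹ * ((j : ℝ) ^ 2)⁻¹ * ((k : ℝ) ^ 2)⁻¹) := by positivity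
          linarith
      _ = _ := by ring
  refine (Finset.sum_le_sum h1).trans ?_
  rw [← Finset.mul_sum, Finset.sum_add_distrib, ← Finset.mul_sum, ← Finset.mul_sum,
    sum_Icc_reflect (fun i => ((i : ℝ) ^ 2)⁻¹), index_mul_wt hk]
  have h2 := sum_inv_sq_le (k - 1)
  have h3 : 0 ≤ q ^ 2 * y ^ k * ((k : ℝ) ^ 2)⁻¹ := by positivity
  nlinarith [mul_le_mul_of_nonneg_left h2 h3]

/-- The convolution of the weights. -/
def conv (q y : ℝ) (k : ℕ) : ℝ :=
  ∑ i ∈ Finset.Icc 1 (k - 1), wt q y i * wt q y (k - i)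

/-- For `i, j ≥ 1` with `i + j = k` one has `k ≤ 2ij`, so the factor `k` in the bound for
`convDeriv` can be divided out. -/
theorem conv_le (hq : 0 ≤ q) (hy : 0 ≤ y) (hk : 0 < k) : conv q y k ≤ 16 * q * wt q y k := by
  have hk0 : (0 : ℝ) < k := by exact_mod_cast hk
  have h1 : k * conv q y k ≤ 2 * convDeriv q y k := by
    rw [conv, convDeriv, Finset.mul_sum, Finset.mul_sum]
    refine Finset.sum_le_sum fun i hi => ?_
    rw [Finset.mem_Icc] at hi
    rw [← mul_assoc 2]
    refine mul_le_mul_of_nonneg_right ?_ (mul_nonneg (wt_nonneg hq hy _) (wt_nonneg hq hy _))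
    obtain ⟨j, hj⟩ : ∃ j, j = k - i := ⟨_, rfl⟩
    rw [← hj]
    have hi' : (1 : ℝ) ≤ i := by exact_mod_cast hi.1
    have hj' : (1 : ℝ) ≤ j := by exact_mod_cast (by omega : 1 ≤ j)
    have hkij : (k : ℝ) = i + j := by exact_mod_cast (by omega : k = i + j)
    nlinarith
  have h2 := convDeriv_le (q := q) hy hk
  refine le_of_mul_le_mul_left ?_ hk0
  linarith

/-- The threefold convolution, with two derivatives. -/
def convTriple (q y : ℝ) (k : ℕ) : ℝ :=
  ∑ i ∈ Finset.Icc 1 (k - 1), ∑ j ∈ Finset.Icc 1 (k - i),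
    (i : ℝ) * (j : ℝ) * (wt q y (k - (i + j)) * (wt q y i * wt q y j))

theorem convTriple_nonneg (hq : 0 ≤ q) (hy : 0 ≤ y) (k : ℕ) : 0 ≤ convTriple q y k :=
  Finset.sum_nonneg fun i _ => Finset.sum_nonneg fun j _ => by
    have := wt_nonneg hq hy i
    have := wt_nonneg hq hy j
    have := wt_nonneg hq hy (k - (i + j))
    positivity

/-- For fixed `i` the sum over `j` is dominated by `convDeriv` at `k - i`: the missing factor `k - i
- j` is at least one unless `j = k - i`, and there the weight of index zero vanishes. A second use
of `convDeriv_le` handles the sum over `i`. -/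
theorem convTriple_le (hq : 0 ≤ q) (hy : 0 ≤ y) (hk : 0 < k) :
    convTriple q y k ≤ 64 * q ^ 2 * (k * wt q y k) := by
  have h1 : ∀ i ∈ Finset.Icc 1 (k - 1), ∑ j ∈ Finset.Icc 1 (k - i),
      (i : ℝ) * (j : ℝ) * (wt q y (k - (i + j)) * (wt q y i * wt q y j))
      ≤ 8 * q * ((i : ℝ) * ((k - i : ℕ) : ℝ) * (wt q y i * wt q y (k - i))) := by
    intro i hi
    rw [Finset.mem_Icc] at hi
    obtain ⟨m, hm⟩ : ∃ m, k - i = m + 1 := ⟨k - i - 1, by omega⟩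
    have h2 : ∑ j ∈ Finset.Icc 1 (m + 1), (j : ℝ) * (wt q y (m + 1 - j) * wt q y j)
        ≤ convDeriv q y (m + 1) := by
      rw [Finset.sum_Icc_succ_top (by omega), Nat.sub_self, wt_zero, zero_mul, mul_zero, add_zero,
        convDeriv, Nat.add_sub_cancel]
      refine Finset.sum_le_sum fun j hj => ?_
      rw [Finset.mem_Icc] at hj
      have h3 : (1 : ℝ) ≤ ((m + 1 - j : ℕ) : ℝ) := by exact_mod_cast (by omega : 1 ≤ m + 1 - j)
      have h4 := mul_nonneg (wt_nonneg hq hy (m + 1 - j)) (wt_nonneg hq hy j)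
      have h5 : 0 ≤ (j : ℝ) * (wt q y (m + 1 - j) * wt q y j) := by positivity
      nlinarith [mul_le_mul_of_nonneg_right h3 h5]
    have h6 : ∀ j ∈ Finset.Icc 1 (m + 1), (i : ℝ) * (j : ℝ) *
        (wt q y (k - (i + j)) * (wt q y i * wt q y j))
        = (i * wt q y i) * ((j : ℝ) * (wt q y (m + 1 - j) * wt q y j)) := fun j _ => by
      rw [show k - (i + j) = m + 1 - j by omega]
      ring
    rw [hm, Finset.sum_congr rfl h6, ← Finset.mul_sum]
    have h7 : 0 ≤ (i : ℝ) * wt q y i := mul_nonneg (by positivity) (wt_nonneg hq hy i)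
    refine (mul_le_mul_of_nonneg_left (h2.trans (convDeriv_le hy (by omega))) h7).trans
      (le_of_eq ?_)
    ring
  refine (Finset.sum_le_sum h1).trans ?_
  rw [← Finset.mul_sum]
  refine (mul_le_mul_of_nonneg_left (convDeriv_le (q := q) hy hk)
    (by positivity : (0 : ℝ) ≤ 8 * q)).trans (le_of_eq ?_)
  ring

end Weights

/-! ### Bounds for the sources -/

section Sources

variable {χ : R3 → ℂ} {K s Λ q y : ℝ} {a : ℕ → Terms} {k : ℕ}

/-- The bounds for the terms of index `i` at time `s`. -/
structure TermsLE (χ : R3 → ℂ) (s Λ q y : ℝ) (a : ℕ → Terms) (i : ℕ) : Prop where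
  P : BandLE χ s (i * Λ) (a i).P (wt q y i * (s * Λ) ^ i)
  U : BandLE χ s (i * Λ) (a i).U (wt q y i * (s * Λ) ^ (i - 1))
  Th : BandLE χ s (i * Λ) (a i).Th (Λ * (wt q y i * (s * Λ) ^ (i - 1)))

theorem one_le_radius (hΛ : 1 ≤ Λ) {i : ℕ} (hi : 1 ≤ i) : 1 ≤ (i : ℝ) * Λ :=
  one_le_mul_of_one_le_of_one_le (by exact_mod_cast hi) hΛ

theorem radius_add {i j : ℕ} (h : i + j = k) : (i : ℝ) * Λ + j * Λ = k * Λ := by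
  rw [← add_mul, ← Nat.cast_add, h]

theorem radius_add_add {l i j : ℕ} (h : l + (i + j) = k) :
    (l : ℝ) * Λ + (i * Λ + j * Λ) = k * Λ := by
  rw [← add_mul, ← add_mul, ← Nat.cast_add, ← Nat.cast_add, h]

/-- Density bounds have the power `i` of `σ = sΛ`, and velocity and temperature bounds the power `i
- 1`. This and the next two lemmas count the powers in products. -/
theorem pow_pair (σ : ℝ) {i j : ℕ} (hi : 1 ≤ i) (hj : 1 ≤ j) (h : i + j = k) :
    σ ^ (k - 2) = σ ^ (i - 1) * σ ^ (j - 1) := by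
  rw [← pow_add]; congr 1; omega

theorem pow_mixed (σ : ℝ) {i j : ℕ} (hj : 1 ≤ j) (h : i + j = k) :
    σ ^ (k - 1) = σ ^ i * σ ^ (j - 1) := by
  rw [← pow_add]; congr 1; omega

theorem pow_triple (σ : ℝ) {l i j : ℕ} (hi : 1 ≤ i) (hj : 1 ≤ j) (h : l + (i + j) = k) :
    σ ^ (k - 2) = σ ^ l * (σ ^ (i - 1) * σ ^ (j - 1)) := by
  rw [← pow_add, ← pow_add]; congr 1; omega

theorem BandLE.sum_pairs {E : Type*} [NormedAddCommGroup E] [NormedSpace ℂ E] [CompleteSpace E]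
    (hχ : IsModulationWindow χ) {r M : ℝ} (f : ℕ → ℕ → ℝ → R3 → E)
    (hf : ∀ i j, 1 ≤ i → 1 ≤ j → i + j = k → BandLE χ s r (f i j)
      (M * ((i : ℝ) * j * (wt q y i * wt q y j)))) :
    BandLE χ s r (fun s z => ∑ i ∈ Finset.Icc 1 (k - 1), f i (k - i) s z) (M * convDeriv q y k) := by
  rw [convDeriv, Finset.mul_sum]
  refine BandLE.sum hχ _ fun i hi => ?_
  rw [Finset.mem_Icc] at hi
  exact hf i (k - i) hi.1 (by omega) (by omega)

theorem BandLE.sum_plain {E : Type*} [NormedAddCommGroup E] [NormedSpace ℂ E] [CompleteSpace E]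
    (hχ : IsModulationWindow χ) {r M : ℝ} (f : ℕ → ℕ → ℝ → R3 → E)
    (hf : ∀ i j, 1 ≤ i → 1 ≤ j → i + j = k → BandLE χ s r (f i j) (M * (wt q y i * wt q y j))) :
    BandLE χ s r (fun s z => ∑ i ∈ Finset.Icc 1 (k - 1), f i (k - i) s z) (M * conv q y k) := by
  rw [conv, Finset.mul_sum]
  refine BandLE.sum hχ _ fun i hi => ?_
  rw [Finset.mem_Icc] at hi
  exact hf i (k - i) hi.1 (by omega) (by omega)

theorem BandLE.sum_triples {E : Type*} [NormedAddCommGroup E] [NormedSpace ℂ E] [CompleteSpace E]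
    (hχ : IsModulationWindow χ) {r M : ℝ} (f : ℕ → ℕ → ℕ → ℝ → R3 → E)
    (hf : ∀ l i j, 1 ≤ i → 1 ≤ j → l + (i + j) = k → BandLE χ s r (f l i j)
      (M * ((i : ℝ) * j * (wt q y l * (wt q y i * wt q y j))))) :
    BandLE χ s r (fun s z => ∑ i ∈ Finset.Icc 1 (k - 1), ∑ j ∈ Finset.Icc 1 (k - i),
      f (k - (i + j)) i j s z)
      (M * convTriple q y k) := by
  rw [convTriple, Finset.mul_sum]
  refine BandLE.sum hχ _ fun i hi => ?_
  rw [Finset.mul_sum]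
  refine BandLE.sum hχ _ fun j hj => ?_
  rw [Finset.mem_Icc] at hi hj
  exact hf (k - (i + j)) i j hi.1 hj.1 (by omega)

/-- The source of the temperature without the terms containing time derivatives. -/
def thetaMain (μ lam : ℝ) (a : ℕ → Terms) (k : ℕ) (s : ℝ) (x : R3) : ℂ :=
  - (∑ i ∈ Finset.Icc 1 (k - 1), advect ((a i).U s) ((a (k - i)).Th s) x)
  - (∑ i ∈ Finset.Icc 1 (k - 1), ∑ j ∈ Finset.Icc 1 (k - i),
      (a (k - (i + j))).P s x * advect ((a i).U s) ((a j).Th s) x)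
  - ((∑ i ∈ Finset.Icc 1 (k - 1), (a i).Th s x * dvg ((a (k - i)).U s) x)
    + ∑ i ∈ Finset.Icc 1 (k - 1), ∑ j ∈ Finset.Icc 1 (k - i),
      (a (k - (i + j))).P s x * (a i).Th s x * dvg ((a j).U s) x)
  + ∑ i ∈ Finset.Icc 1 (k - 1), dissip μ lam ((a i).U s) ((a (k - i)).U s) x

/-- The bounds for all terms of index below `k` at time `s`. -/
structure BoundedBelow (χ : R3 → ℂ) (K s Λ q y : ℝ) (a : ℕ → Terms) (k : ℕ) : Prop where
  window : IsModulationWindow χ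
  alg : IsAlgebraBound χ K
  time : 0 ≤ s
  freq : 1 ≤ Λ
  q_nonneg : 0 ≤ q
  y_nonneg : 0 ≤ y
  terms : ∀ i < k, TermsLE χ s Λ q y a i

namespace BoundedBelow

/-- The single derivative costs `j Λ`, and the temperature bound supplies the second `Λ`. The factor
`i ≥ 1` is inserted so that all quadratic terms share the shape of the dissipation, which really has
two derivatives. -/
theorem advect_theta_le (H : BoundedBelow χ K s Λ q y a k) {i j : ℕ} (hi : 1 ≤ i) (hj : 1 ≤ j) (hij : i + j = k) :
    BandLE χ s (k * Λ) (fun s => advect ((a i).U s) ((a j).Th s))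
      (3 * K ^ 2 * Λ ^ 2 * (s * Λ) ^ (k - 2) * ((i : ℝ) * j * (wt q y i * wt q y j))) := by
  have hi' : (1 : ℝ) ≤ i := by exact_mod_cast hi
  have h := (H.terms i (by omega)).U.advect H.window H.alg (H.terms j (by omega)).Th (one_le_radius H.freq hj)
  rw [radius_add hij] at h
  refine h.mono le_rfl ?_
  rw [pow_pair (s * Λ) hi hj hij]
  have hw := wt_nonneg H.q_nonneg H.y_nonneg i
  have hw' := wt_nonneg H.q_nonneg H.y_nonneg j
  have hs := H.time
  have hK0 := H.alg.nonneg
  have hΛ0 : 0 ≤ Λ := zero_le_one.trans H.freq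
  have h1 : 0 ≤ 3 * K ^ 2 * Λ ^ 2 * ((s * Λ) ^ (i - 1) * (s * Λ) ^ (j - 1)) *
    (j * (wt q y i * wt q y j)) := by positivity
  nlinarith [mul_le_mul_of_nonneg_right hi' h1]

theorem triple_advect_theta_le (H : BoundedBelow χ K s Λ q y a k) {l i j : ℕ} (hi : 1 ≤ i) (hj : 1 ≤ j) (hij : l + (i + j) = k) :
    BandLE χ s (k * Λ) (fun s x => (a l).P s x * advect ((a i).U s) ((a j).Th s) x)
      (3 * K ^ 3 * Λ ^ 2 * (s * Λ) ^ (k - 2) *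
        ((i : ℝ) * j * (wt q y l * (wt q y i * wt q y j)))) := by
  have hi' : (1 : ℝ) ≤ i := by exact_mod_cast hi
  have h := (H.terms l (by omega)).P.mul H.window H.alg
    ((H.terms i (by omega)).U.advect H.window H.alg (H.terms j (by omega)).Th (one_le_radius H.freq hj))
  rw [radius_add_add hij] at h
  refine h.mono le_rfl ?_
  rw [pow_triple (s * Λ) hi hj hij]
  have hw := wt_nonneg H.q_nonneg H.y_nonneg i
  have hw' := wt_nonneg H.q_nonneg H.y_nonneg j
  have hw'' := wt_nonneg H.q_nonneg H.y_nonneg l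
  have hs := H.time
  have hK0 := H.alg.nonneg
  have hΛ0 : 0 ≤ Λ := zero_le_one.trans H.freq
  have h1 : 0 ≤ 3 * K ^ 3 * Λ ^ 2 * ((s * Λ) ^ l * ((s * Λ) ^ (i - 1) * (s * Λ) ^ (j - 1))) *
    (j * (wt q y l * (wt q y i * wt q y j))) := by positivity
  nlinarith [mul_le_mul_of_nonneg_right hi' h1]

theorem theta_dvg_le (H : BoundedBelow χ K s Λ q y a k) {i j : ℕ} (hi : 1 ≤ i) (hj : 1 ≤ j) (hij : i + j = k) :
    BandLE χ s (k * Λ) (fun s x => (a i).Th s x * dvg ((a j).U s) x)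
      (3 * K ^ 2 * Λ ^ 2 * (s * Λ) ^ (k - 2) * ((i : ℝ) * j * (wt q y i * wt q y j))) := by
  have hi' : (1 : ℝ) ≤ i := by exact_mod_cast hi
  have h := (H.terms i (by omega)).Th.mul H.window H.alg ((H.terms j (by omega)).U.dvg H.window H.alg (one_le_radius H.freq hj))
  rw [radius_add hij] at h
  refine h.mono le_rfl ?_
  rw [pow_pair (s * Λ) hi hj hij]
  have hw := wt_nonneg H.q_nonneg H.y_nonneg i
  have hw' := wt_nonneg H.q_nonneg H.y_nonneg j
  have hs := H.time
  have hK0 := H.alg.nonneg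
  have hΛ0 : 0 ≤ Λ := zero_le_one.trans H.freq
  have h1 : 0 ≤ 3 * K ^ 2 * Λ ^ 2 * ((s * Λ) ^ (i - 1) * (s * Λ) ^ (j - 1)) *
    (j * (wt q y i * wt q y j)) := by positivity
  nlinarith [mul_le_mul_of_nonneg_right hi' h1]

theorem triple_theta_dvg_le (H : BoundedBelow χ K s Λ q y a k) {l i j : ℕ} (hi : 1 ≤ i) (hj : 1 ≤ j) (hij : l + (i + j) = k) :
    BandLE χ s (k * Λ) (fun s x => (a l).P s x * (a i).Th s x * dvg ((a j).U s) x)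
      (3 * K ^ 3 * Λ ^ 2 * (s * Λ) ^ (k - 2) *
        ((i : ℝ) * j * (wt q y l * (wt q y i * wt q y j)))) := by
  have hi' : (1 : ℝ) ≤ i := by exact_mod_cast hi
  have h := ((H.terms l (by omega)).P.mul H.window H.alg (H.terms i (by omega)).Th).mul H.window H.alg
    ((H.terms j (by omega)).U.dvg H.window H.alg (one_le_radius H.freq hj))
  rw [add_assoc, radius_add_add hij] at h
  refine h.mono le_rfl ?_
  rw [pow_triple (s * Λ) hi hj hij]
  have hw := wt_nonneg H.q_nonneg H.y_nonneg i
  have hw' := wt_nonneg H.q_nonneg H.y_nonneg j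
  have hw'' := wt_nonneg H.q_nonneg H.y_nonneg l
  have hs := H.time
  have hK0 := H.alg.nonneg
  have hΛ0 : 0 ≤ Λ := zero_le_one.trans H.freq
  have h1 : 0 ≤ 3 * K ^ 3 * Λ ^ 2 * ((s * Λ) ^ l * ((s * Λ) ^ (i - 1) * (s * Λ) ^ (j - 1))) *
    (j * (wt q y l * (wt q y i * wt q y j))) := by positivity
  nlinarith [mul_le_mul_of_nonneg_right hi' h1]

theorem dissip_le (H : BoundedBelow χ K s Λ q y a k) {μ lam : ℝ} (hμ : |μ| ≤ K) (hlam : |lam| ≤ K) {i j : ℕ} (hi : 1 ≤ i)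
    (hj : 1 ≤ j) (hij : i + j = k) :
    BandLE χ s (k * Λ) (fun s => dissip μ lam ((a i).U s) ((a j).U s))
      (27 * K ^ 4 * Λ ^ 2 * (s * Λ) ^ (k - 2) * ((i : ℝ) * j * (wt q y i * wt q y j))) := by
  have h := (H.terms i (by omega)).U.dissip H.window H.alg hμ hlam (H.terms j (by omega)).U (one_le_radius H.freq hi)
    (one_le_radius H.freq hj)
  rw [radius_add hij] at h
  refine h.mono le_rfl (le_of_eq ?_)
  rw [pow_pair (s * Λ) hi hj hij]
  ring

theorem convDeriv_nonneg (H : BoundedBelow χ K s Λ q y a k) : 0 ≤ convDeriv q y k :=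
  IdealGas.convDeriv_nonneg H.q_nonneg H.y_nonneg k

theorem convTriple_nonneg (H : BoundedBelow χ K s Λ q y a k) : 0 ≤ convTriple q y k :=
  IdealGas.convTriple_nonneg H.q_nonneg H.y_nonneg k

theorem thetaMain_le (H : BoundedBelow χ K s Λ q y a k) {μ lam : ℝ} (hμ : |μ| ≤ K)
    (hlam : |lam| ≤ K) :
    BandLE χ s (k * Λ) (thetaMain μ lam a k)
      (33 * K ^ 4 * (Λ ^ 2 * (s * Λ) ^ (k - 2)) * (convDeriv q y k + convTriple q y k)) := by
  have hχ := H.window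
  have h1 := BandLE.sum_pairs hχ (fun i j s => advect ((a i).U s) ((a j).Th s))
    fun i j => H.advect_theta_le
  have h2 := BandLE.sum_triples hχ
    (fun l i j s x => (a l).P s x * advect ((a i).U s) ((a j).Th s) x)
    fun l i j => H.triple_advect_theta_le
  have h3 := BandLE.sum_pairs hχ (fun i j s x => (a i).Th s x * dvg ((a j).U s) x)
    fun i j => H.theta_dvg_le
  have h4 := BandLE.sum_triples hχ
    (fun l i j s x => (a l).P s x * (a i).Th s x * dvg ((a j).U s) x)
    fun l i j => H.triple_theta_dvg_le
  have h5 := BandLE.sum_pairs hχ (fun i j s => dissip μ lam ((a i).U s) ((a j).U s))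
    fun i j => H.dissip_le hμ hlam
  refine (((((h1.neg hχ).sub hχ h2).sub hχ (h3.add hχ h4)).add hχ h5).mono le_rfl ?_)
  have hK1 := H.alg.one_le
  have hK0 := H.alg.nonneg
  have hΛ0 : 0 ≤ Λ := zero_le_one.trans H.freq
  have hs := H.time
  have hM : 0 ≤ Λ ^ 2 * (s * Λ) ^ (k - 2) := by positivity
  have e2 : K ^ 2 ≤ K ^ 4 := pow_le_pow_right₀ hK1 (by norm_num)
  have e3 : K ^ 3 ≤ K ^ 4 := pow_le_pow_right₀ hK1 (by norm_num)
  have hK4 : 0 ≤ K ^ 4 := by positivity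
  -- The constant is `33 = 3 + 3 + 27`: two pair sums with one derivative, and the dissipation.
  calc _ = (Λ ^ 2 * (s * Λ) ^ (k - 2)) *
        ((6 * K ^ 2 + 27 * K ^ 4) * convDeriv q y k + 6 * K ^ 3 * convTriple q y k) := by ring
    _ ≤ (Λ ^ 2 * (s * Λ) ^ (k - 2)) *
        (33 * K ^ 4 * convDeriv q y k + 33 * K ^ 4 * convTriple q y k) := by
        refine mul_le_mul_of_nonneg_left (add_le_add ?_ ?_) hM
        · exact mul_le_mul_of_nonneg_right (by linarith) H.convDeriv_nonneg
        · exact mul_le_mul_of_nonneg_right (by linarith) H.convTriple_nonneg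
    _ = _ := by ring

theorem advect_velocity_le {i j : ℕ} (H : BoundedBelow χ K s Λ q y a k) (hi : 1 ≤ i) (hj : 1 ≤ j)
    (hij : i + j = k) :
    BandLE χ s (k * Λ) (fun s => advect ((a i).U s) ((a j).U s))
      (3 * K ^ 2 * Λ * (s * Λ) ^ (k - 2) * ((i : ℝ) * j * (wt q y i * wt q y j))) := by
  have hi' : (1 : ℝ) ≤ i := by exact_mod_cast hi
  have h := (H.terms i (by omega)).U.advect H.window H.alg (H.terms j (by omega)).U
    (one_le_radius H.freq hj)
  rw [radius_add hij] at h
  refine h.mono le_rfl ?_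
  rw [pow_pair (s * Λ) hi hj hij]
  have hw := wt_nonneg H.q_nonneg H.y_nonneg i
  have hw' := wt_nonneg H.q_nonneg H.y_nonneg j
  have hs := H.time
  have hK0 := H.alg.nonneg
  have hΛ0 : 0 ≤ Λ := zero_le_one.trans H.freq
  have h1 : 0 ≤ 3 * K ^ 2 * Λ * ((s * Λ) ^ (i - 1) * (s * Λ) ^ (j - 1)) *
    (j * (wt q y i * wt q y j)) := by positivity
  nlinarith [mul_le_mul_of_nonneg_right hi' h1]

theorem triple_advect_velocity_le {l i j : ℕ} (H : BoundedBelow χ K s Λ q y a k) (hi : 1 ≤ i)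
    (hj : 1 ≤ j) (hij : l + (i + j) = k) :
    BandLE χ s (k * Λ) (fun s x => (a l).P s x • advect ((a i).U s) ((a j).U s) x)
      (3 * K ^ 3 * Λ * (s * Λ) ^ (k - 2) *
        ((i : ℝ) * j * (wt q y l * (wt q y i * wt q y j)))) := by
  have hi' : (1 : ℝ) ≤ i := by exact_mod_cast hi
  have h := (H.terms l (by omega)).P.smul H.window H.alg
    ((H.terms i (by omega)).U.advect H.window H.alg (H.terms j (by omega)).U
      (one_le_radius H.freq hj))
  rw [radius_add_add hij] at h
  refine h.mono le_rfl ?_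
  rw [pow_triple (s * Λ) hi hj hij]
  have hw := wt_nonneg H.q_nonneg H.y_nonneg i
  have hw' := wt_nonneg H.q_nonneg H.y_nonneg j
  have hw'' := wt_nonneg H.q_nonneg H.y_nonneg l
  have hs := H.time
  have hK0 := H.alg.nonneg
  have hΛ0 : 0 ≤ Λ := zero_le_one.trans H.freq
  have h1 : 0 ≤ 3 * K ^ 3 * Λ * ((s * Λ) ^ l * ((s * Λ) ^ (i - 1) * (s * Λ) ^ (j - 1))) *
    (j * (wt q y l * (wt q y i * wt q y j))) := by positivity
  nlinarith [mul_le_mul_of_nonneg_right hi' h1]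

end BoundedBelow

/-- The source of the velocity without the terms containing time derivatives and gradients. -/
def velocityMain (a : ℕ → Terms) (k : ℕ) (s : ℝ) (x : R3) : C3 :=
  - (∑ i ∈ Finset.Icc 1 (k - 1), advect ((a i).U s) ((a (k - i)).U s) x)
  - (∑ i ∈ Finset.Icc 1 (k - 1), ∑ j ∈ Finset.Icc 1 (k - i),
      (a (k - (i + j))).P s x • advect ((a i).U s) ((a j).U s) x)

/-- The pressure. -/
def pressure (a : ℕ → Terms) (Thk : ℝ → R3 → ℂ) (k : ℕ) (s : ℝ) (x : R3) : ℂ :=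
  Thk s x + ∑ i ∈ Finset.Icc 1 (k - 1), (a i).P s x * (a (k - i)).Th s x

namespace BoundedBelow

theorem velocityMain_le (H : BoundedBelow χ K s Λ q y a k) :
    BandLE χ s (k * Λ) (velocityMain a k)
      (3 * K ^ 3 * (Λ * (s * Λ) ^ (k - 2)) * (convDeriv q y k + convTriple q y k)) := by
  have hχ := H.window
  have h1 := BandLE.sum_pairs hχ (fun i j s => advect ((a i).U s) ((a j).U s))
    fun i j => H.advect_velocity_le
  have h2 := BandLE.sum_triples hχ
    (fun l i j s x => (a l).P s x • advect ((a i).U s) ((a j).U s) x)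
    fun l i j => H.triple_advect_velocity_le
  refine ((h1.neg hχ).sub hχ h2).mono le_rfl ?_
  have hK1 := H.alg.one_le
  have hΛ0 : 0 ≤ Λ := zero_le_one.trans H.freq
  have hs := H.time
  have hM : 0 ≤ Λ * (s * Λ) ^ (k - 2) := by positivity
  have e2 : K ^ 2 ≤ K ^ 3 := pow_le_pow_right₀ hK1 (by norm_num)
  have h3 := mul_le_mul_of_nonneg_right e2 (mul_nonneg hM H.convDeriv_nonneg)
  linarith

theorem pressure_le (H : BoundedBelow χ K s Λ q y a k) {Thk : ℝ → R3 → ℂ} {x : ℝ}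
    (hTh : BandLE χ s (k * Λ) Thk x) :
    BandLE χ s (k * Λ) (pressure a Thk k) (x + K * Λ * (s * Λ) ^ (k - 1) * conv q y k) := by
  refine hTh.add H.window (BandLE.sum_plain H.window (fun i j s x => (a i).P s x * (a j).Th s x)
    fun i j hi hj hij => ?_)
  have h := (H.terms i (by omega)).P.mul H.window H.alg (H.terms j (by omega)).Th
  rw [radius_add hij] at h
  refine h.mono le_rfl (le_of_eq ?_)
  rw [pow_mixed (s * Λ) hj hij]
  ring

theorem densitySource_le (H : BoundedBelow χ K s Λ q y a k) (hk : 1 ≤ k) {Uk : ℝ → R3 → C3} {x : ℝ}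
    (hU : BandLE χ s (k * Λ) Uk x) :
    BandLE χ s (k * Λ) (densitySource a Uk k)
      (3 * K * (k * Λ) * (x + K * (s * Λ) ^ (k - 1) * conv q y k)) := by
  have hr := one_le_radius H.freq hk
  refine ((hU.dvg H.window H.alg hr).add H.window (BandLE.sum_plain H.window
    (fun i j s => dvg (fun y => (a i).P s y • (a j).U s y)) (M := 3 * K * (k * Λ) *
      (K * (s * Λ) ^ (k - 1))) fun i j hi hj hij => ?_)).mono le_rfl (le_of_eq (by ring))
  have h := (H.terms i (by omega)).P.smul H.window H.alg (H.terms j (by omega)).U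
  rw [radius_add hij] at h
  refine (h.dvg H.window H.alg hr).mono le_rfl (le_of_eq ?_)
  rw [pow_mixed (s * Λ) hj hij]
  ring

end BoundedBelow

end Sources

/-! ### Time integration -/

section TimeIntegration

variable {E : Type*} [NormedAddCommGroup E] [NormedSpace ℂ E] [CompleteSpace E] {χ : R3 → ℂ}
variable {t : ℝ}

theorem lintegral_Ioo_pow {c : ℝ} (hc : 0 ≤ c) (ht : 0 ≤ t) (m : ℕ) :
    ∫⁻ s in Set.Ioo 0 t, ENNReal.ofReal (c * s ^ m)
      = ENNReal.ofReal (c * (t ^ (m + 1) / (m + 1))) := by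
  have hi : IntegrableOn (fun s : ℝ => c * s ^ m) (Set.Ioc 0 t) :=
    ((continuous_const.mul (continuous_pow m)).integrableOn_Icc).mono_set Set.Ioc_subset_Icc_self
  rw [restrict_Ioo_eq_restrict_Ioc, ← ofReal_integral_eq_lintegral_ofReal hi,
    ← intervalIntegral.integral_of_le ht, intervalIntegral.integral_const_mul, integral_pow]
  · simp
  · filter_upwards [ae_restrict_mem measurableSet_Ioc] with s hs
    exact mul_nonneg hc (pow_nonneg hs.1.le m)

theorem modNormL1_le_of_pow {f : ℝ → R3 → E} {c : ℝ} (hc : 0 ≤ c) (ht : 0 ≤ t) (m : ℕ)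
    (hf : ∀ s, 0 < s → s < t → modNorm χ (f s) ≤ ENNReal.ofReal (c * s ^ m)) :
    modNormL1 χ t f ≤ ENNReal.ofReal (c * (t ^ (m + 1) / (m + 1))) := by
  rw [← lintegral_Ioo_pow hc ht m]
  exact setLIntegral_mono' measurableSet_Ioo fun s hs => hf s hs.1 hs.2

theorem modNormL1_sub_le (hχ : IsModulationWindow χ) {r : ℝ} {f g : ℝ → R3 → E} (hf : IsBand r f)
    (hg : IsBand r g) (t : ℝ) :
    modNormL1 χ t (fun s x => f s x - g s x) ≤ modNormL1 χ t f + modNormL1 χ t g := by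
  rw [modNormL1, modNormL1, modNormL1, ← lintegral_add_left (hf.measurable_modNorm hχ)]
  exact lintegral_mono fun s => hf.modNorm_sub_le hχ hg s

theorem modNormL1_sum_le (hχ : IsModulationWindow χ) {r : ℝ} {ι : Type*} (S : Finset ι)
    {f : ι → ℝ → R3 → E} (hf : ∀ i ∈ S, IsBand r (f i)) (t : ℝ) :
    modNormL1 χ t (fun s x => ∑ i ∈ S, f i s x) ≤ ∑ i ∈ S, modNormL1 χ t (f i) := by
  have h : ∑ i ∈ S, modNormL1 χ t (f i)
      = ∫⁻ s in Set.Ioo 0 t, ∑ i ∈ S, modNorm χ (f i s) :=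
    (lintegral_finsetSum' _ fun i hi => ((hf i hi).measurable_modNorm hχ).aemeasurable).symm
  rw [h]
  exact lintegral_mono fun s => IsBand.modNorm_sum_le hχ S hf s

theorem modNormL1_smul_le (hχ : IsModulationWindow χ) {K : ℝ} (hK : IsAlgebraBound χ K)
    {r r' x y : ℝ} {a : ℝ → R3 → ℂ} {f : ℝ → R3 → E} (ha : IsBand r a) (hf : IsBand r' f)
    (hx : 0 ≤ x) (h : ∀ s, 0 < s → s < t → modNorm χ (a s) ≤ ENNReal.ofReal x)
    (h' : modNormL1 χ t f ≤ ENNReal.ofReal y) :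
    modNormL1 χ t (fun s z => a s z • f s z) ≤ ENNReal.ofReal (K * x * y) := by
  rw [ENNReal.ofReal_mul (mul_nonneg hK.nonneg hx), ENNReal.ofReal_mul hK.nonneg]
  calc _ ≤ ∫⁻ s in Set.Ioo 0 t, ENNReal.ofReal K * ENNReal.ofReal x * modNorm χ (f s) :=
        setLIntegral_mono' measurableSet_Ioo fun s hs => (ha.modNorm_smul_le hχ hf s).trans
          (mul_le_mul_left (mul_le_mul' hK.prod (h s hs.1 hs.2)) _)
    _ = ENNReal.ofReal K * ENNReal.ofReal x * modNormL1 χ t f :=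
        lintegral_const_mul _ (hf.measurable_modNorm hχ)
    _ ≤ _ := mul_le_mul_right h' _

end TimeIntegration

/-! ### The inductive step -/

section Induction

variable {χ : R3 → ℂ} {μ lam κ K Λ T q y : ℝ} {a : ℕ → Terms} {k : ℕ}

/-- The bounds for the term of index `n` on the time interval `(0,T]`. -/
structure IsControlled (χ : R3 → ℂ) (μ lam κ Λ T q y : ℝ) (n : ℕ) (a : Terms) : Prop where
  bandP : IsBand (n * Λ) a.P
  bandU : IsBand (n * Λ) a.U
  bandTh : IsBand (n * Λ) a.Th
  P : ∀ t, 0 < t → t ≤ T → modNorm χ (a.P t) ≤ ENNReal.ofReal (wt q y n * (t * Λ) ^ n)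
  U : ∀ t, 0 < t → t ≤ T → modNorm χ (a.U t) + modNormL1 χ t (timeDeriv a.U)
    + modNormL1 χ t (fun s => lame μ lam (a.U s)) ≤ ENNReal.ofReal (wt q y n * (t * Λ) ^ (n - 1))
  Th : ∀ t, 0 < t → t ≤ T → modNorm χ (a.Th t) + modNormL1 χ t (timeDeriv a.Th)
    + modNormL1 χ t (fun s x => (κ : ℂ) * Laplacian.laplacian (a.Th s) x)
      ≤ ENNReal.ofReal (Λ * (wt q y n * (t * Λ) ^ (n - 1)))

/-- The assumptions on the parameters. -/
structure IsAdmissible (χ : R3 → ℂ) (μ lam κ K Λ T q y : ℝ) : Prop where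
  window : IsModulationWindow χ
  alg : IsAlgebraBound χ K
  mu_le : |μ| ≤ K
  lam_le : |lam| ≤ K
  heat : 0 < κ
  shear : 0 < min μ (2 * μ + lam)
  reg_heat : regConst (heatCoeff κ) κ ≤ ENNReal.ofReal K
  reg_lame : regConst (lameCoeff μ lam) (min μ (2 * μ + lam)) ≤ ENNReal.ofReal K
  freq : 1 ≤ Λ
  time : 0 < T
  short : T * Λ ^ 2 ≤ 1
  q_nonneg : 0 ≤ q
  q_le : q ≤ 1
  y_nonneg : 0 ≤ y

namespace IsAdmissible

theorem freq_nonneg (A : IsAdmissible χ μ lam κ K Λ T q y) : 0 ≤ Λ := zero_le_one.trans A.freq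

theorem time_le (A : IsAdmissible χ μ lam κ K Λ T q y) : T ≤ 1 := by
  have h1 : (1 : ℝ) ≤ Λ ^ 2 := one_le_pow₀ A.freq
  nlinarith [A.time, A.short]

theorem wt_nonneg (A : IsAdmissible χ μ lam κ K Λ T q y) (n : ℕ) : 0 ≤ wt q y n :=
  IdealGas.wt_nonneg A.q_nonneg A.y_nonneg n

theorem boundedBelow (A : IsAdmissible χ μ lam κ K Λ T q y)
    (H : ∀ i < k, IsControlled χ μ lam κ Λ T q y i (a i)) {s : ℝ} (hs : 0 < s) (hsT : s ≤ T) :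
    BoundedBelow χ K s Λ q y a k where
  window := A.window
  alg := A.alg
  time := hs.le
  freq := A.freq
  q_nonneg := A.q_nonneg
  y_nonneg := A.y_nonneg
  terms i hi := by
    have hΛ := A.freq_nonneg
    have hw := A.wt_nonneg i
    exact ⟨⟨(H i hi).bandP, by positivity, (H i hi).P s hs hsT⟩,
      ⟨(H i hi).bandU, by positivity,
        (le_self_add.trans le_self_add).trans ((H i hi).U s hs hsT)⟩,
      ⟨(H i hi).bandTh, by positivity,
        (le_self_add.trans le_self_add).trans ((H i hi).Th s hs hsT)⟩⟩

/-- The constant is `72 = 8 + 64`, where `q ≤ 1` lowers the extra power of `q` in the triple sum. -/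
theorem conv_sum_le (A : IsAdmissible χ μ lam κ K Λ T q y) (hk : 0 < k) :
    convDeriv q y k + convTriple q y k ≤ 72 * q * (k * wt q y k) := by
  have h1 := convDeriv_le (q := q) A.y_nonneg hk
  have h2 := convTriple_le A.q_nonneg A.y_nonneg hk
  have h3 : q ^ 2 * (k * wt q y k) ≤ q * (k * wt q y k) := by
    refine mul_le_mul_of_nonneg_right ?_ (mul_nonneg (by positivity) (A.wt_nonneg k))
    nlinarith [A.q_nonneg, A.q_le]
  linarith

/-- The products of densities and time derivatives. -/
theorem modNormL1_timeDeriv_le {E : Type*} [NormedAddCommGroup E] [NormedSpace ℂ E]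
    [CompleteSpace E] (A : IsAdmissible χ μ lam κ K Λ T q y)
    (H : ∀ i < k, IsControlled χ μ lam κ Λ T q y i (a i)) (hk : 0 < k) {f : ℕ → ℝ → R3 → E} {M : ℝ}
    (hM : 0 ≤ M)
    (hf : ∀ i < k, IsBand (i * Λ) (f i)) {t : ℝ} (ht : 0 < t) (htT : t ≤ T)
    (hle : ∀ i < k, modNormL1 χ t (timeDeriv (f i))
      ≤ ENNReal.ofReal (M * (wt q y i * (t * Λ) ^ (i - 1)))) :
    IsBand (k * Λ) (fun s x => ∑ i ∈ Finset.Icc 1 (k - 1), (a i).P s x • timeDeriv (f (k - i)) s x) ∧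
    modNormL1 χ t (fun s x => ∑ i ∈ Finset.Icc 1 (k - 1), (a i).P s x • timeDeriv (f (k - i)) s x)
      ≤ ENNReal.ofReal (16 * K * q * (M * (wt q y k * (t * Λ) ^ (k - 1)))) := by
  have hΛ := A.freq_nonneg
  have hK0 := A.alg.nonneg
  have hb : ∀ i ∈ Finset.Icc 1 (k - 1),
      IsBand (k * Λ) (fun s x => (a i).P s x • timeDeriv (f (k - i)) s x) := fun i hi => by
    rw [Finset.mem_Icc] at hi
    have h := (H i (by omega)).bandP.smul (hf (k - i) (by omega)).timeDeriv
    rwa [radius_add (by omega : i + (k - i) = k)] at h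
  refine ⟨IsBand.sum _ hb, (modNormL1_sum_le A.window _ hb t).trans ?_⟩
  have h1 : ∀ i ∈ Finset.Icc 1 (k - 1),
      modNormL1 χ t (fun s x => (a i).P s x • timeDeriv (f (k - i)) s x)
      ≤ ENNReal.ofReal (K * M * (t * Λ) ^ (k - 1) * (wt q y i * wt q y (k - i))) := by
    intro i hi
    rw [Finset.mem_Icc] at hi
    have hw := A.wt_nonneg i
    refine (modNormL1_smul_le A.window A.alg (x := wt q y i * (t * Λ) ^ i)
      (H i (by omega)).bandP (hf (k - i) (by omega)).timeDeriv (by positivity)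
      (fun s hs hst => ?_) (hle (k - i) (by omega))).trans (ENNReal.ofReal_le_ofReal (le_of_eq ?_))
    · refine ((H i (by omega)).P s hs (hst.le.trans htT)).trans (ENNReal.ofReal_le_ofReal ?_)
      gcongr
    · rw [pow_mixed (t * Λ) (by omega : 1 ≤ k - i) (by omega : i + (k - i) = k)]
      ring
  refine (Finset.sum_le_sum h1).trans ?_
  rw [← ENNReal.ofReal_sum_of_nonneg fun i _ => by
    have := A.wt_nonneg i
    have := A.wt_nonneg (k - i)
    positivity]
  refine ENNReal.ofReal_le_ofReal ?_
  rw [← Finset.mul_sum]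
  have h2 := conv_le A.q_nonneg A.y_nonneg hk
  have h3 : 0 ≤ K * M * (t * Λ) ^ (k - 1) := by positivity
  refine (mul_le_mul_of_nonneg_left h2 h3).trans (le_of_eq ?_)
  ring

/-- Sources growing like a power of time, with the loss of one derivative. -/
theorem modNormL1_le_of_source {E : Type*} [NormedAddCommGroup E] [NormedSpace ℂ E] [CompleteSpace E]
    (A : IsAdmissible χ μ lam κ K Λ T q y) (hk : 2 ≤ k) {f : ℝ → R3 → E} {M t : ℝ} (hM : 0 ≤ M)
    (ht : 0 < t) (hf : ∀ s, 0 < s → s < t → modNorm χ (f s) ≤ ENNReal.ofReal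
      (M * (Λ * (s * Λ) ^ (k - 2)) * (convDeriv q y k + convTriple q y k))) :
    modNormL1 χ t f ≤ ENNReal.ofReal (144 * M * q * (wt q y k * (t * Λ) ^ (k - 1))) := by
  obtain ⟨m, rfl⟩ : ∃ m, k = m + 2 := ⟨k - 2, by omega⟩
  have hΛ := A.freq_nonneg
  have hq := A.q_nonneg
  have hw := A.wt_nonneg (m + 2)
  have hc := A.conv_sum_le (k := m + 2) (by omega)
  have h1 := modNormL1_le_of_pow (χ := χ) (f := f)
    (c := M * Λ ^ (m + 1) * (72 * q * (((m + 2 : ℕ) : ℝ) * wt q y (m + 2)))) (by positivity) ht.le m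
    fun s hs hst => (hf s hs hst).trans (ENNReal.ofReal_le_ofReal (by
      rw [Nat.add_sub_cancel]
      have h2 : 0 ≤ M * (Λ * (s * Λ) ^ m) := by positivity
      refine (mul_le_mul_of_nonneg_left hc h2).trans (le_of_eq ?_)
      rw [mul_pow]
      ring))
  refine h1.trans (ENNReal.ofReal_le_ofReal ?_)
  rw [show m + 2 - 1 = m + 1 from rfl, mul_pow]
  -- The factor `k` left by the convolution meets the `1/(k-1)` from integrating `s^(k-2)`; no loss
  -- in `k` remains.
  have h3 : ((m + 2 : ℕ) : ℝ) / (m + 1) ≤ 2 := by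
    rw [div_le_iff₀ (by positivity)]
    push_cast
    linarith [Nat.cast_nonneg (α := ℝ) m]
  have h4 : 0 ≤ 72 * M * q * (wt q y (m + 2) * (t ^ (m + 1) * Λ ^ (m + 1))) := by positivity
  calc _ = 72 * M * q * (wt q y (m + 2) * (t ^ (m + 1) * Λ ^ (m + 1))) *
        (((m + 2 : ℕ) : ℝ) / (m + 1)) := by ring
    _ ≤ 72 * M * q * (wt q y (m + 2) * (t ^ (m + 1) * Λ ^ (m + 1))) * 2 :=
        mul_le_mul_of_nonneg_left h3 h4
    _ = _ := by ring

end IsAdmissible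

end Induction

/-! ### Temperature, velocity and density of index `k` from the terms of lower index -/

section Step

variable {χ : R3 → ℂ} {μ lam κ K Λ T q y : ℝ} {a : ℕ → Terms} {k : ℕ}

namespace IsAdmissible

/-- The source of the temperature. -/
theorem thetaSource_le (A : IsAdmissible χ μ lam κ K Λ T q y)
    (H : ∀ i < k, IsControlled χ μ lam κ Λ T q y i (a i)) (hk : 2 ≤ k) :
    IsBand (k * Λ) (thetaSource μ lam a k) ∧ ∀ t, 0 < t → t ≤ T →
      modNormL1 χ t (thetaSource μ lam a k)
        ≤ ENNReal.ofReal (4768 * K ^ 4 * q * (Λ * (wt q y k * (t * Λ) ^ (k - 1)))) := by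
  have hχ := A.window
  have hΛ := A.freq_nonneg
  have hK0 := A.alg.nonneg
  have hK1 := A.alg.one_le
  have hq := A.q_nonneg
  have hw := A.wt_nonneg k
  have heq : thetaSource μ lam a k = fun s x => thetaMain μ lam a k s x -
      ∑ i ∈ Finset.Icc 1 (k - 1), (a i).P s x • timeDeriv (a (k - i)).Th s x := by
    ext s x
    simp only [thetaSource, thetaMain, smul_eq_mul]
    ring
  have hmain := ((A.boundedBelow H A.time le_rfl).thetaMain_le A.mu_le A.lam_le).band
  have hprod : ∀ t, 0 < t → t ≤ T → _ := fun t ht htT =>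
    A.modNormL1_timeDeriv_le H (by omega) hΛ (f := fun i => (a i).Th) (fun i hi => (H i hi).bandTh)
      ht htT fun i hi => (le_add_self.trans le_self_add).trans ((H i hi).Th t ht htT)
  rw [heq]
  refine ⟨hmain.sub (hprod T A.time le_rfl).1, fun t ht htT => ?_⟩
  refine (modNormL1_sub_le hχ hmain (hprod t ht htT).1 t).trans ?_
  have h1 := A.modNormL1_le_of_source hk (f := thetaMain μ lam a k) (M := 33 * K ^ 4 * Λ)
    (by positivity) ht fun s hs hst =>
      ((A.boundedBelow H hs (hst.le.trans htT)).thetaMain_le A.mu_le A.lam_le).le.trans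
        (ENNReal.ofReal_le_ofReal (le_of_eq (by ring)))
  refine (add_le_add h1 (hprod t ht htT).2).trans ?_
  rw [← ENNReal.ofReal_add (by positivity) (by positivity)]
  refine ENNReal.ofReal_le_ofReal ?_
  -- The constant is `4768 = 144·33 + 16`, from the main part and the products with time
  -- derivatives.
  have e : K ≤ K ^ 4 := le_self_pow₀ hK1 (by norm_num)
  have h2 : 0 ≤ q * (Λ * (wt q y k * (t * Λ) ^ (k - 1))) := by positivity
  nlinarith [mul_le_mul_of_nonneg_right e h2]

theorem integral_zero_eq {E : Type*} [NormedAddCommGroup E] [NormedSpace ℂ E] (g : ℝ → R3 → E) :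
    (fun x => ∫ s in (0 : ℝ)..0, g s x) = fun _ => 0 :=
  funext fun _ => intervalIntegral.integral_same

/-- The temperature. -/
theorem nextTh_le (A : IsAdmissible χ μ lam κ K Λ T q y)
    (H : ∀ i < k, IsControlled χ μ lam κ Λ T q y i (a i)) (hk : 2 ≤ k) :
    IsBand (k * Λ) (nextTh μ lam κ a k) ∧ ∀ t, 0 < t → t ≤ T →
      modNorm χ (nextTh μ lam κ a k t) + modNormL1 χ t (timeDeriv (nextTh μ lam κ a k))
        + modNormL1 χ t (fun s x => (κ : ℂ) * Laplacian.laplacian (nextTh μ lam κ a k s) x)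
        ≤ ENNReal.ofReal (4768 * K ^ 5 * q * (Λ * (wt q y k * (t * Λ) ^ (k - 1)))) := by
  obtain ⟨hb, hle⟩ := A.thetaSource_le H hk
  have heq : nextTh μ lam κ a k = fun t x => ∫ s in (0 : ℝ)..t,
      quadSg (heatCoeff κ) (t - s) (thetaSource μ lam a k s) x := by
    ext t x
    simp only [nextTh, heatSg_eq]
  obtain ⟨hf, hev⟩ := hb.duhamel (heatCoeff κ)
  rw [← heq] at hf hev
  have h0 : nextTh μ lam κ a k 0 = fun _ => 0 := by
    rw [heq]
    exact integral_zero_eq fun s => quadSg (heatCoeff κ) (0 - s) (thetaSource μ lam a k s)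
  have hev' : ∀ t x, timeDeriv (nextTh μ lam κ a k) t x
      = quadOp (heatCoeff κ) (nextTh μ lam κ a k t) x + thetaSource μ lam a k t x := fun t x => by
    rw [hev t x, heq]
  refine ⟨hf, fun t ht htT => ?_⟩
  have hmr := hf.maximal_regularity A.window (isCoercive_heatCoeff κ) A.heat hb hev' ht.le
    (htT.trans A.time_le)
  have hop : (fun s => quadOp (heatCoeff κ) (nextTh μ lam κ a k s))
      = fun s x => (κ : ℂ) * Laplacian.laplacian (nextTh μ lam κ a k s) x :=
    funext fun s => funext fun x => quadOp_heatCoeff κ (hf.contDiff_space s) x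
  rw [hop, h0, IsBand.modNorm_zero, zero_add] at hmr
  refine hmr.trans ((mul_le_mul' A.reg_heat (hle t ht htT)).trans ?_)
  rw [← ENNReal.ofReal_mul A.alg.nonneg]
  exact ENNReal.ofReal_le_ofReal (le_of_eq (by ring))

/-- The source of the velocity. -/
theorem velocitySource_le (A : IsAdmissible χ μ lam κ K Λ T q y)
    (H : ∀ i < k, IsControlled χ μ lam κ Λ T q y i (a i)) (hk : 2 ≤ k) :
    IsBand (k * Λ) (velocitySource a (nextTh μ lam κ a k) k) ∧ ∀ t, 0 < t → t ≤ T →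
      modNormL1 χ t (velocitySource a (nextTh μ lam κ a k) k)
        ≤ ENNReal.ofReal (14800 * K ^ 6 * q * (wt q y k * (t * Λ) ^ (k - 1))) := by
  have hχ := A.window
  have hΛ := A.freq_nonneg
  have hK0 := A.alg.nonneg
  have hK1 := A.alg.one_le
  have hq := A.q_nonneg
  have hw := A.wt_nonneg k
  obtain ⟨hbTh, hTh⟩ := A.nextTh_le H hk
  have heq : velocitySource a (nextTh μ lam κ a k) k = fun s x => velocityMain a k s x -
      grad (pressure a (nextTh μ lam κ a k) k s) x -
      ∑ i ∈ Finset.Icc 1 (k - 1), (a i).P s x • timeDeriv (a (k - i)).U s x := rfl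
  have hmain := (A.boundedBelow H A.time le_rfl).velocityMain_le.band
  have hTh' : ∀ s, 0 < s → s ≤ T → BandLE χ s (k * Λ) (nextTh μ lam κ a k)
      (4768 * K ^ 5 * q * (Λ * (wt q y k * (s * Λ) ^ (k - 1)))) := fun s hs hsT =>
    ⟨hbTh, by positivity, (le_self_add.trans le_self_add).trans (hTh s hs hsT)⟩
  have hgrad : ∀ s, 0 < s → s ≤ T → _ := fun s hs hsT =>
    ((A.boundedBelow H hs hsT).pressure_le (hTh' s hs hsT)).grad A.window A.alg
      (one_le_radius A.freq (by omega))
  have hprod : ∀ t, 0 < t → t ≤ T → _ := fun t ht htT =>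
    A.modNormL1_timeDeriv_le H (by omega) zero_le_one (f := fun i => (a i).U)
      (fun i hi => (H i hi).bandU) ht htT fun i hi => by
        rw [one_mul]
        exact (le_add_self.trans le_self_add).trans ((H i hi).U t ht htT)
  have hgb := (hgrad T A.time le_rfl).band
  rw [heq]
  refine ⟨(hmain.sub hgb).sub (hprod T A.time le_rfl).1, fun t ht htT => ?_⟩
  refine ((modNormL1_sub_le hχ (hmain.sub hgb) (hprod t ht htT).1 t).trans
    (add_le_add_left (modNormL1_sub_le hχ hmain hgb t) _)).trans ?_
  have h1 := A.modNormL1_le_of_source hk (f := velocityMain a k) (M := 3 * K ^ 3)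
    (by positivity) ht fun s hs hst => (A.boundedBelow H hs (hst.le.trans htT)).velocityMain_le.le
  have h2 : modNormL1 χ t (fun s => grad (pressure a (nextTh μ lam κ a k) k s))
      ≤ ENNReal.ofReal (14352 * K ^ 6 * q * (wt q y k * (t * Λ) ^ (k - 1))) := by
    have hk0 : (0 : ℝ) < k := by exact_mod_cast (by omega : 0 < k)
    have h3 := modNormL1_le_of_pow (χ := χ) (t := t)
      (f := fun s => grad (pressure a (nextTh μ lam κ a k) k s))
      (c := 14352 * K ^ 6 * q * wt q y k * (k * Λ ^ 2) * Λ ^ (k - 1)) (by positivity) ht.le (k - 1)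
      fun s hs hst => (hgrad s hs (hst.le.trans htT)).le.trans (ENNReal.ofReal_le_ofReal ?_)
    · refine h3.trans (ENNReal.ofReal_le_ofReal ?_)
      rw [Nat.sub_add_cancel (by omega : 1 ≤ k), Nat.cast_sub (by omega : 1 ≤ k), Nat.cast_one,
        sub_add_cancel]
      -- The gradient costs `k Λ` on a pressure that already has the factor `Λ`. Time integration
      -- cancels `k` and returns `t`; the leftover `t Λ²` is the reason for the restriction to times
      -- of order `2^{-2N}`.
      have h4 : t * Λ ^ 2 ≤ 1 :=
        (mul_le_mul_of_nonneg_right htT (by positivity)).trans A.short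
      have h5 : t ^ k = t * t ^ (k - 1) := by rw [← pow_succ', Nat.sub_add_cancel (by omega)]
      have h6 : 0 ≤ 14352 * K ^ 6 * q * (wt q y k * (t * Λ) ^ (k - 1)) := by positivity
      calc _ = 14352 * K ^ 6 * q * (wt q y k * (t * Λ) ^ (k - 1)) * (t * Λ ^ 2) := by
            rw [h5, mul_pow]
            field_simp
        _ ≤ _ := mul_le_of_le_one_right h6 h4
    · have h4 := conv_le A.q_nonneg A.y_nonneg (by omega : 0 < k)
      have h5 : 0 ≤ 3 * (K * (k * Λ)) * (K * Λ * (s * Λ) ^ (k - 1)) := by positivity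
      have h6 := mul_le_mul_of_nonneg_left h4 h5
      have e : K ^ 2 ≤ K ^ 6 := pow_le_pow_right₀ hK1 (by norm_num)
      have h7 : 0 ≤ 48 * (k * Λ ^ 2) * (s * Λ) ^ (k - 1) * q * wt q y k := by positivity
      have h8 := mul_le_mul_of_nonneg_right e h7
      rw [mul_assoc _ (Λ ^ (k - 1)), ← mul_pow, mul_comm Λ s]
      nlinarith
  refine (add_le_add (add_le_add h1 h2) (hprod t ht htT).2).trans ?_
  rw [← ENNReal.ofReal_add (by positivity) (by positivity),
    ← ENNReal.ofReal_add (by positivity) (by positivity)]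
  refine ENNReal.ofReal_le_ofReal ?_
  -- The constant is `14800 = 144·3 + 14352 + 16`, where `14352 = 3·(4768 + 16)` comes from the
  -- pressure.
  have e : K ≤ K ^ 6 := le_self_pow₀ hK1 (by norm_num)
  have e3 : K ^ 3 ≤ K ^ 6 := pow_le_pow_right₀ hK1 (by norm_num)
  have h3 : 0 ≤ q * (wt q y k * (t * Λ) ^ (k - 1)) := by positivity
  nlinarith [mul_le_mul_of_nonneg_right e h3, mul_le_mul_of_nonneg_right e3 h3]

/-- The velocity. -/
theorem nextU_le (A : IsAdmissible χ μ lam κ K Λ T q y)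
    (H : ∀ i < k, IsControlled χ μ lam κ Λ T q y i (a i)) (hk : 2 ≤ k) {V : ℝ → R3 → C3}
    (hV : V = nextU μ lam a (nextTh μ lam κ a k) k) :
    IsBand (k * Λ) V ∧ ∀ t, 0 < t → t ≤ T →
      modNorm χ (V t) + modNormL1 χ t (timeDeriv V) + modNormL1 χ t (fun s => lame μ lam (V s))
        ≤ ENNReal.ofReal (14800 * K ^ 7 * q * (wt q y k * (t * Λ) ^ (k - 1))) := by
  obtain ⟨hb, hle⟩ := A.velocitySource_le H hk
  obtain ⟨g, hg⟩ : ∃ g, g = velocitySource a (nextTh μ lam κ a k) k := ⟨_, rfl⟩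
  rw [← hg] at hb hle
  have heq : V = fun t x => ∫ s in (0 : ℝ)..t, quadSg (lameCoeff μ lam) (t - s) (g s) x := by
    ext1 t
    ext1 x
    simp only [hV, hg, nextU, lameSg_eq]
  obtain ⟨hf, hev⟩ := hb.duhamel (lameCoeff μ lam)
  rw [← heq] at hf hev
  have h0 : V 0 = fun _ => 0 := by
    rw [heq]
    exact integral_zero_eq fun s => quadSg (lameCoeff μ lam) (0 - s) (g s)
  have hev' : ∀ t x, timeDeriv V t x = quadOp (lameCoeff μ lam) (V t) x + g t x := fun t x => by
    rw [hev t x, heq]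
  refine ⟨hf, fun t ht htT => ?_⟩
  have hmr := hf.maximal_regularity A.window isCoercive_lameCoeff A.shear hb hev' ht.le
    (htT.trans A.time_le)
  have hop : (fun s => quadOp (lameCoeff μ lam) (V s)) = fun s => lame μ lam (V s) :=
    funext fun s => funext fun x => quadOp_lameCoeff μ lam (hf.contDiff_space s) x
  rw [hop, h0, IsBand.modNorm_zero, zero_add] at hmr
  refine hmr.trans ((mul_le_mul' A.reg_lame (hle t ht htT)).trans ?_)
  rw [← ENNReal.ofReal_mul A.alg.nonneg]
  exact ENNReal.ofReal_le_ofReal (le_of_eq (by ring))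

/-- The density. -/
theorem nextP_le (A : IsAdmissible χ μ lam κ K Λ T q y)
    (H : ∀ i < k, IsControlled χ μ lam κ Λ T q y i (a i)) (hk : 2 ≤ k) {V : ℝ → R3 → C3}
    (hV : V = nextU μ lam a (nextTh μ lam κ a k) k) :
    IsBand (k * Λ) (nextP a V k) ∧ ∀ t, 0 < t → t ≤ T →
      modNorm χ (nextP a V k t)
        ≤ ENNReal.ofReal (44448 * K ^ 8 * q * (wt q y k * (t * Λ) ^ k)) := by
  have hΛ := A.freq_nonneg
  have hK0 := A.alg.nonneg
  have hK1 := A.alg.one_le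
  have hq := A.q_nonneg
  have hw := A.wt_nonneg k
  obtain ⟨hbU, hU⟩ := A.nextU_le H hk hV
  have hS : ∀ s, 0 < s → s ≤ T → _ := fun s hs hsT =>
    (A.boundedBelow H hs hsT).densitySource_le (by omega) (Uk := V)
      (x := 14800 * K ^ 7 * q * (wt q y k * (s * Λ) ^ (k - 1)))
      ⟨hbU, by positivity, (le_self_add.trans le_self_add).trans (hU s hs hsT)⟩
  have hb := (hS T A.time le_rfl).band
  refine ⟨hb.primitive.neg, fun t ht htT => ?_⟩
  refine (hb.primitive.modNorm_neg_le A.window t).trans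
    ((hb.modNorm_integral_le A.window ht.le).trans ?_)
  have hk0 : (0 : ℝ) < k := by exact_mod_cast (by omega : 0 < k)
  have h3 := modNormL1_le_of_pow (χ := χ) (t := t) (f := densitySource a V k)
    (c := 44448 * K ^ 8 * q * wt q y k * (k * Λ) * Λ ^ (k - 1)) (by positivity) ht.le (k - 1)
    fun s hs hst => (hS s hs (hst.le.trans htT)).le.trans (ENNReal.ofReal_le_ofReal ?_)
  · refine h3.trans (ENNReal.ofReal_le_ofReal (le_of_eq ?_))
    rw [Nat.sub_add_cancel (by omega : 1 ≤ k), Nat.cast_sub (by omega : 1 ≤ k), Nat.cast_one,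
      sub_add_cancel, mul_pow]
    -- The factor `k` of the divergence cancels exactly against the `1/k` from integrating
    -- `s^(k-1)`, and its `Λ` raises the power of `tΛ` from `k - 1` to `k`.
    have h5 : Λ ^ k = Λ * Λ ^ (k - 1) := by rw [← pow_succ', Nat.sub_add_cancel (by omega)]
    rw [h5]
    field_simp
  · have h4 := conv_le A.q_nonneg A.y_nonneg (by omega : 0 < k)
    have h5 : 0 ≤ 3 * K * (k * Λ) * (K * (s * Λ) ^ (k - 1)) := by positivity
    have h6 := mul_le_mul_of_nonneg_left h4 h5
    have e : K ^ 2 ≤ K ^ 8 := pow_le_pow_right₀ hK1 (by norm_num)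
    have h7 : 0 ≤ 48 * (k * Λ) * (s * Λ) ^ (k - 1) * q * wt q y k := by positivity
    have h8 := mul_le_mul_of_nonneg_right e h7
    rw [mul_assoc _ (Λ ^ (k - 1)), ← mul_pow, mul_comm Λ s]
    nlinarith

/-- The inductive step. -/
theorem isControlled_next (A : IsAdmissible χ μ lam κ K Λ T q y) (hqK : 44448 * K ^ 8 * q ≤ 1)
    (H : ∀ i < k, IsControlled χ μ lam κ Λ T q y i (a i)) (hk : 2 ≤ k) :
    IsControlled χ μ lam κ Λ T q y k (nextTerms μ lam κ a k) := by
  have hΛ := A.freq_nonneg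
  have hK1 := A.alg.one_le
  have hq := A.q_nonneg
  have hw := A.wt_nonneg k
  -- The density has the largest constant, `44448 = 3·(14800 + 16)`; since `K ≥ 1`, its smallness
  -- condition implies the other two.
  have e5 : 4768 * K ^ 5 * q ≤ 1 := by
    have : K ^ 5 ≤ K ^ 8 := pow_le_pow_right₀ hK1 (by norm_num)
    nlinarith [mul_le_mul_of_nonneg_right this hq, pow_nonneg (zero_le_one.trans hK1) 8]
  have e7 : 14800 * K ^ 7 * q ≤ 1 := by
    have : K ^ 7 ≤ K ^ 8 := pow_le_pow_right₀ hK1 (by norm_num)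
    nlinarith [mul_le_mul_of_nonneg_right this hq, pow_nonneg (zero_le_one.trans hK1) 8]
  -- The order is forced: the source of `U_k` contains `Θ_k`, and that of `P_k` contains `U_k`.
  obtain ⟨hbTh, hTh⟩ := A.nextTh_le H hk
  obtain ⟨hbU, hU⟩ := A.nextU_le H hk rfl
  obtain ⟨hbP, hP⟩ := A.nextP_le H hk rfl
  refine ⟨hbP, hbU, hbTh, fun t ht htT => (hP t ht htT).trans ?_,
    fun t ht htT => (hU t ht htT).trans ?_, fun t ht htT => (hTh t ht htT).trans ?_⟩ <;>
  refine ENNReal.ofReal_le_ofReal (mul_le_of_le_one_left (by positivity) ?_) <;> assumption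

end IsAdmissible

end Step

/-! ### The terms of index zero and one, and the induction -/

section Expansion

variable {χ : R3 → ℂ} {μ lam κ K Λ T q y : ℝ} {u₀ : R3 → C3} {m : ℝ}

section Zero

variable {E : Type*} [NormedAddCommGroup E] [NormedSpace ℂ E]

theorem timeDeriv_zero : timeDeriv (fun (_ : ℝ) (_ : R3) => (0 : E)) = fun _ _ => 0 :=
  funext fun s => funext fun _ => deriv_const s (0 : E)

theorem pd_zero (i : Fin 3) : pd i (fun _ : R3 => (0 : E)) = fun _ => 0 := by
  ext1 x
  simp [pd]

theorem modNormL1_zero [CompleteSpace E] (χ : R3 → ℂ) (t : ℝ) :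
    modNormL1 χ t (fun (_ : ℝ) (_ : R3) => (0 : E)) = 0 := by
  rw [modNormL1, IsBand.modNorm_zero, lintegral_zero]

theorem lame_zero (μ lam : ℝ) : (fun _ : ℝ => lame μ lam fun _ => 0) = fun _ _ => 0 := by
  ext1 t
  ext1 x
  rw [← quadOp_lameCoeff μ lam contDiff_const x]
  simp only [quadOp, pd_zero, map_zero, Finset.sum_const_zero]

theorem mul_laplacian_zero (κ : ℝ) :
    (fun (_ : ℝ) (x : R3) => (κ : ℂ) * Laplacian.laplacian (fun _ : R3 => (0 : ℂ)) x)
      = fun _ _ => 0 := by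
  ext1 t
  ext1 x
  rw [InnerProductSpace.laplacian_const]
  exact mul_zero _

end Zero

namespace IsAdmissible

/-- All three functions vanish, in accordance with the weight of index zero. -/
theorem isControlled_zero :
    IsControlled χ μ lam κ Λ T q y 0 ⟨fun _ _ => 0, fun _ _ => 0, fun _ _ => 0⟩ := by
  refine ⟨IsBand.zero _, IsBand.zero _, IsBand.zero _, fun t _ _ => ?_, fun t _ _ => ?_,
    fun t _ _ => ?_⟩
  · rw [IsBand.modNorm_zero]
    exact zero_le
  · rw [lame_zero, timeDeriv_zero, modNormL1_zero, IsBand.modNorm_zero, add_zero, add_zero]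
    exact zero_le
  · rw [mul_laplacian_zero, timeDeriv_zero, modNormL1_zero, IsBand.modNorm_zero, add_zero, add_zero]
    exact zero_le

/-- The first term, that is the linear evolution of the data. -/
theorem isControlled_one (A : IsAdmissible χ μ lam κ K Λ T q y) (hu : IsBand Λ (fun _ => u₀))
    (hm : 0 ≤ m) (hu₀ : modNorm χ u₀ ≤ ENNReal.ofReal m) (hmq : 3 * K ^ 2 * m ≤ q * y) :
    IsControlled χ μ lam κ Λ T q y 1 (expansion μ lam κ u₀ 1) := by
  have hK0 := A.alg.nonneg
  have hK1 := A.alg.one_le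
  have hΛ := A.freq_nonneg
  have hw : wt q y 1 = q * y := by simp [wt]
  obtain ⟨V, hV⟩ : ∃ V : ℝ → R3 → C3, V = fun t => lameSg μ lam t u₀ := ⟨_, rfl⟩
  have hVq : V = fun t => quadSg (lameCoeff μ lam) t u₀ := by
    rw [hV]
    exact funext fun t => congrFun (lameSg_eq μ lam t) u₀
  obtain ⟨hb, h0, hev⟩ := hu.quadSg (lameCoeff μ lam)
  have hb' : IsBand Λ V := by rw [hVq]; exact hb
  have hev' : ∀ t x, timeDeriv V t x = quadOp (lameCoeff μ lam) (V t) x + (fun _ _ => 0) t x :=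
    fun t x => by rw [hVq, hev t x, add_zero]
  have hU : ∀ t, 0 < t → t ≤ T → modNorm χ (V t) + modNormL1 χ t (timeDeriv V)
      + modNormL1 χ t (fun s => lame μ lam (V s)) ≤ ENNReal.ofReal (K * m) := fun t ht htT => by
    have hmr := hb'.maximal_regularity A.window isCoercive_lameCoeff A.shear (IsBand.zero Λ) hev'
      ht.le (htT.trans A.time_le)
    have hop : (fun s => quadOp (lameCoeff μ lam) (V s)) = fun s => lame μ lam (V s) :=
      funext fun s => funext fun x => quadOp_lameCoeff μ lam (hb'.contDiff_space s) x
    have hz : modNormL1 χ t (fun (_ : ℝ) (_ : R3) => (0 : C3)) = 0 := by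
      simp [modNormL1, IsBand.modNorm_zero]
    have hV0 : V 0 = u₀ := by rw [hVq]; exact h0
    rw [hop, hz, add_zero, hV0] at hmr
    refine hmr.trans ((mul_le_mul' A.reg_lame hu₀).trans ?_)
    rw [← ENNReal.ofReal_mul hK0]
  have hU' : ∀ s, 0 < s → s ≤ T → BandLE χ s Λ V (K * m) := fun s hs hsT =>
    ⟨hb', by positivity, (le_self_add.trans le_self_add).trans (hU s hs hsT)⟩
  have hD : ∀ s, 0 < s → s ≤ T → _ := fun s hs hsT =>
    (hU' s hs hsT).dvg A.window A.alg A.freq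
  have hDb := (hD T A.time le_rfl).band
  have hone : ((1 : ℕ) : ℝ) * Λ = Λ := by rw [Nat.cast_one, one_mul]
  have hexp : expansion μ lam κ u₀ 1
      = ⟨fun t x => - ∫ s in (0 : ℝ)..t, dvg (V s) x, V, fun _ _ => 0⟩ := by
    rw [expansion, hV]
  rw [hexp]
  have hz : IsControlled χ μ lam κ Λ T q y 0 _ := isControlled_zero
  refine ⟨by rw [hone]; exact hDb.primitive.neg, by rw [hone]; exact hb', IsBand.zero _,
    fun t ht htT => ?_, fun t ht htT => (hU t ht htT).trans (ENNReal.ofReal_le_ofReal ?_),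
    fun t ht htT => (hz.Th t ht htT).trans ?_⟩
  · refine (hDb.primitive.modNorm_neg_le A.window t).trans
      ((hDb.modNorm_integral_le A.window ht.le).trans ?_)
    -- The density is the most expensive part of the first term: maximal regularity gives `K m`, and
    -- the divergence a further `3 K Λ`. This is the origin of `3 K² m` in `hmq`.
    have h3 := modNormL1_le_of_pow (χ := χ) (t := t) (f := fun s => dvg (V s))
      (c := 3 * (K * Λ * (K * m))) (by positivity) ht.le 0
      fun s hs hst => (hD s hs (hst.le.trans htT)).le.trans
        (ENNReal.ofReal_le_ofReal (le_of_eq (by ring)))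
    refine h3.trans (ENNReal.ofReal_le_ofReal ?_)
    rw [hw]
    have h4 := mul_le_mul_of_nonneg_right hmq (by positivity : 0 ≤ t * Λ)
    simp only [zero_add, pow_one, Nat.cast_zero, div_one]
    linarith
  · rw [hw, Nat.sub_self, pow_zero, mul_one]
    refine le_trans ?_ hmq
    have : K ≤ 3 * K ^ 2 := by nlinarith
    exact mul_le_mul_of_nonneg_right this hm
  · have := A.wt_nonneg 1
    rw [wt_zero, zero_mul, mul_zero, ENNReal.ofReal_zero]
    exact zero_le

/-- All terms of the expansion are controlled. -/
theorem isControlled_expansion (A : IsAdmissible χ μ lam κ K Λ T q y)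
    (hqK : 44448 * K ^ 8 * q ≤ 1) (hu : IsBand Λ (fun _ => u₀))
    (hm : 0 ≤ m) (hu₀ : modNorm χ u₀ ≤ ENNReal.ofReal m) (hmq : 3 * K ^ 2 * m ≤ q * y) (k : ℕ) :
    IsControlled χ μ lam κ Λ T q y k (expansion μ lam κ u₀ k) := by
  induction k using Nat.strong_induction_on with
  | _ k ih =>
    rcases Nat.lt_or_ge k 2 with h | h
    · interval_cases k
      · rw [expansion]
        exact isControlled_zero
      · exact A.isControlled_one hu hm hu₀ hmq
    · rw [expansion_eq μ lam κ u₀ k h]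
      exact A.isControlled_next hqK ih h

end IsAdmissible

end Expansion

/-! ### Summation -/

section Summation

variable {χ : R3 → ℂ} {μ lam κ T q Y R t : ℝ} {N : ℕ}

theorem wt_le (hq : 0 ≤ q) (hq1 : q ≤ 1) (hY : 0 ≤ Y) (hR : 0 ≤ R) {k : ℕ} (hk : 1 ≤ k) :
    wt q (Y * R) k ≤ Y ^ k * R ^ k := by
  rw [wt, ← mul_pow]
  have h1 : (1 : ℝ) ≤ (k : ℝ) ^ 3 := one_le_pow₀ (by exact_mod_cast hk)
  have h2 : 0 ≤ (Y * R) ^ k := by positivity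
  exact (div_le_self (by positivity) h1).trans (mul_le_of_le_one_left h2 hq1)

/-- The induction works with decay `k⁻³`, whereas the refined bounds contain `(1+k)⁻⁴`. The
discrepancy is put into the geometric constants at the price of `16^k`. -/
theorem succ_pow_four_le (k : ℕ) : (1 + (k : ℝ)) ^ 4 ≤ 16 ^ k := by
  have h : 1 + k ≤ 2 ^ k := by have := Nat.lt_two_pow_self (n := k); omega
  calc (1 + (k : ℝ)) ^ 4 ≤ ((2 : ℝ) ^ k) ^ 4 :=
        pow_le_pow_left₀ (by positivity) (by exact_mod_cast h) 4
    _ = 16 ^ k := by rw [← pow_mul, mul_comm, pow_mul]; norm_num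

theorem wt_le_refined (hq : 0 ≤ q) (hq1 : q ≤ 1) (hY : 1 ≤ Y) (hR : 0 ≤ R) {k e : ℕ} (hk : 1 ≤ k)
    (he : k ≤ e) : wt q (Y * R) k ≤ (16 * Y) ^ e * R ^ k / (1 + k) ^ 4 := by
  have hY0 : 0 ≤ Y := zero_le_one.trans hY
  rw [le_div_iff₀ (by positivity)]
  calc _ ≤ Y ^ k * R ^ k * 16 ^ k := mul_le_mul (wt_le hq hq1 hY0 hR hk) (succ_pow_four_le k)
        (by positivity) (by positivity)
    _ = (16 * Y) ^ k * R ^ k := by rw [mul_pow]; ring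
    _ ≤ _ := by
        refine mul_le_mul_of_nonneg_right (pow_le_pow_right₀ ?_ he) (by positivity)
        linarith

/-- The scaling in `termSize` brings all three parts to the size `wt (tΛ)^(k-1)`; their number is
absorbed by `3 ≤ 3^k`. -/
theorem IsControlled.termSize_le {k : ℕ} {a : Terms}
    (h : IsControlled χ μ lam κ (2 ^ N) T q (Y * R) k a)
    (hq : 0 ≤ q) (hq1 : q ≤ 1) (hY : 0 ≤ Y) (hR : 0 ≤ R) (hk : 1 ≤ k) (ht : 0 < t) (htT : t ≤ T) :
    termSize χ N t a ≤ ENNReal.ofReal ((3 * Y) ^ k * R ^ k * (t * 2 ^ N) ^ (k - 1)) := by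
  have hw := wt_nonneg hq (mul_nonneg hY hR) k
  have hσ : 0 < t * 2 ^ N := by positivity
  have h1 := mul_le_mul_right (h.P t ht htT) (ENNReal.ofReal ((t * 2 ^ N)⁻¹))
  have h2 := (le_self_add.trans le_self_add).trans (h.U t ht htT)
  have h3 := mul_le_mul_right ((le_self_add.trans le_self_add).trans (h.Th t ht htT))
    (ENNReal.ofReal ((2 ^ N)⁻¹))
  rw [← ENNReal.ofReal_mul (by positivity)] at h1 h3
  refine (add_le_add (add_le_add h1 h2) h3).trans ?_
  rw [← ENNReal.ofReal_add (by positivity) (by positivity),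
    ← ENNReal.ofReal_add (by positivity) (by positivity)]
  refine ENNReal.ofReal_le_ofReal ?_
  have e1 : (t * 2 ^ N)⁻¹ * (wt q (Y * R) k * (t * 2 ^ N) ^ k)
      = wt q (Y * R) k * (t * 2 ^ N) ^ (k - 1) := by
    obtain ⟨n, rfl⟩ : ∃ n, k = n + 1 := ⟨k - 1, by omega⟩
    rw [pow_succ, Nat.add_sub_cancel]
    field_simp
  have e2 : ((2 : ℝ) ^ N)⁻¹ * (2 ^ N * (wt q (Y * R) k * (t * 2 ^ N) ^ (k - 1)))
      = wt q (Y * R) k * (t * 2 ^ N) ^ (k - 1) := by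
    rw [← mul_assoc, inv_mul_cancel₀ (by positivity), one_mul]
  rw [e1, e2]
  have h4 : 3 * wt q (Y * R) k ≤ (3 * Y) ^ k * R ^ k := by
    have h5 : (3 : ℝ) ≤ 3 ^ k := le_self_pow₀ (by norm_num) (by omega)
    calc _ ≤ 3 ^ k * (Y ^ k * R ^ k) :=
          mul_le_mul h5 (wt_le hq hq1 hY hR hk) hw (by positivity)
      _ = _ := by rw [mul_pow]; ring
  have h6 := mul_le_mul_of_nonneg_right h4 (pow_nonneg hσ.le (k - 1))
  linarith

theorem tsum_geometric_le {f : ℕ → ℝ≥0∞} {M x : ℝ} (hM : 0 ≤ M) (hx : 0 ≤ x) (hx2 : x ≤ 1 / 2)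
    (hf : ∀ k, f k ≤ ENNReal.ofReal (M * x ^ k)) : ∑' k, f k ≤ ENNReal.ofReal (2 * M) := by
  have hg : HasSum (fun k => M * (1 / 2 : ℝ) ^ k) (M * 2) := hasSum_geometric_two.mul_left M
  refine (ENNReal.tsum_le_tsum hf).trans ?_
  calc _ ≤ ∑' k, ENNReal.ofReal (M * (1 / 2 : ℝ) ^ k) := ENNReal.tsum_le_tsum fun k =>
        ENNReal.ofReal_le_ofReal (by gcongr)
    _ = _ := by
        rw [← ENNReal.ofReal_tsum_of_nonneg (fun k => by positivity) hg.summable, hg.tsum_eq,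
          mul_comm]

/-- Uses `log 2 ≥ 1/2`; it enters only through the ratio of the geometric series. -/
theorem amp_le_two {N : ℕ} (hN : 2 ≤ N) : amp N ≤ 2 := by
  have h1 : Real.log 2 ≤ Real.log N := Real.log_le_log (by norm_num) (by exact_mod_cast hN)
  have h2 := Real.log_two_gt_d9
  rw [amp, inv_le_comm₀ (by linarith) (by norm_num)]
  linarith

theorem le_ofReal_of_toReal_le {x : ℝ≥0∞} {K : ℝ} (hx : x < ⊤) (h : x.toReal ≤ K) :
    x ≤ ENNReal.ofReal K :=
  (ENNReal.le_ofReal_iff_toReal_le hx.ne (ENNReal.toReal_nonneg.trans h)).2 h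

/-- A constant larger than all those of the linear and of the algebraic estimates. -/
theorem exists_common_bound {μ lam κ : ℝ} (φ₀ : 𝓢(R3, ℂ)) {χ : R3 → ℂ}
    (hχ : IsModulationWindow χ) : ∃ K : ℝ, IsAlgebraBound χ K ∧ |μ| ≤ K ∧ |lam| ≤ K ∧
      regConst (heatCoeff κ) κ ≤ ENNReal.ofReal K ∧
      regConst (lameCoeff μ lam) (min μ (2 * μ + lam)) ≤ ENNReal.ofReal K ∧
      dataConst χ φ₀ ≤ ENNReal.ofReal K := by
  have h1 := ENNReal.toReal_nonneg (a := prodConst χ)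
  have h2 := ENNReal.toReal_nonneg (a := derivConst)
  have h3 := ENNReal.toReal_nonneg (a := regConst (heatCoeff κ) κ)
  have h4 := ENNReal.toReal_nonneg (a := regConst (lameCoeff μ lam) (min μ (2 * μ + lam)))
  have h5 := ENNReal.toReal_nonneg (a := dataConst χ φ₀)
  have h6 := abs_nonneg μ
  have h7 := abs_nonneg lam
  refine ⟨1 + (prodConst χ).toReal + derivConst.toReal + (regConst (heatCoeff κ) κ).toReal +
    (regConst (lameCoeff μ lam) (min μ (2 * μ + lam))).toReal + (dataConst χ φ₀).toReal +
    |μ| + |lam|, ⟨by linarith, le_ofReal_of_toReal_le (prodConst_lt_top hχ) (by linarith),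
      le_ofReal_of_toReal_le derivConst_lt_top (by linarith)⟩, by linarith, by linarith,
    le_ofReal_of_toReal_le (regConst_lt_top _ _) (by linarith),
    le_ofReal_of_toReal_le (regConst_lt_top _ _) (by linarith),
    le_ofReal_of_toReal_le (dataConst_lt_top hχ φ₀) (by linarith)⟩

theorem IsControlled.isRegularAt {Λ y : ℝ} {k : ℕ} {a : Terms}
    (h : IsControlled χ μ lam κ Λ T q y k a) (t : ℝ) :
    IsRegularAt a.P t ∧ IsRegularAt a.U t ∧ IsRegularAt a.Th t :=
  ⟨h.bandP.isRegularAt t, h.bandU.isRegularAt t, h.bandTh.isRegularAt t⟩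

/-- The refined bounds. -/
theorem IsControlled.refined {k : ℕ} {a : Terms}
    (h : IsControlled χ μ lam κ (2 ^ N) T q (Y * R) k a)
    (hq : 0 ≤ q) (hq1 : q ≤ 1) (hY : 1 ≤ Y) (hR : 0 ≤ R) (hk : 1 ≤ k) (ht : 0 < t) (htT : t ≤ T) :
    modNorm χ (a.P t) ≤ ENNReal.ofReal ((16 * Y) ^ (k - 1) * (16 * Y) ^ k * t ^ k * 2 ^ (k * N)
        * R ^ k / (1 + k) ^ 4) ∧
      modNorm χ (a.U t) + modNormL1 χ t (timeDeriv a.U)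
          + modNormL1 χ t (fun s => lame μ lam (a.U s)) ≤
        ENNReal.ofReal ((16 * Y) ^ (k - 1) * (16 * Y) ^ max (k - 1) 1 * t ^ (k - 1)
          * 2 ^ ((k - 1) * N) * R ^ k / (1 + k) ^ 4) ∧
      modNorm χ (a.Th t) + modNormL1 χ t (timeDeriv a.Th)
          + modNormL1 χ t (fun s x => (κ : ℂ) * Laplacian.laplacian (a.Th s) x) ≤
        ENNReal.ofReal ((16 * Y) ^ (k - 1) * (16 * Y) ^ k * t ^ (k - 1) * 2 ^ (k * N) * R ^ k
          / (1 + k) ^ 4) := by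
  have p1 : (2 : ℝ) ^ (k * N) = (2 ^ N) ^ k := by rw [mul_comm, pow_mul]
  have p2 : (2 : ℝ) ^ ((k - 1) * N) = (2 ^ N) ^ (k - 1) := by rw [mul_comm, pow_mul]
  have p3 : ((2 : ℝ) ^ N) ^ k = 2 ^ N * (2 ^ N) ^ (k - 1) := by
    rw [← pow_succ', Nat.sub_add_cancel hk]
  have w1 := wt_le_refined hq hq1 hY hR hk (by omega : k ≤ k - 1 + k)
  have w2 := wt_le_refined hq hq1 hY hR hk (by omega : k ≤ k - 1 + max (k - 1) 1)
  rw [pow_add] at w1 w2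
  refine ⟨(h.P t ht htT).trans (ENNReal.ofReal_le_ofReal ?_),
    (h.U t ht htT).trans (ENNReal.ofReal_le_ofReal ?_),
    (h.Th t ht htT).trans (ENNReal.ofReal_le_ofReal ?_)⟩
  · refine (mul_le_mul_of_nonneg_right w1 (by positivity)).trans (le_of_eq ?_)
    rw [p1, mul_pow t]
    ring
  · refine (mul_le_mul_of_nonneg_right w2 (by positivity)).trans (le_of_eq ?_)
    rw [p2, mul_pow t]
    ring
  · refine (mul_le_mul_of_nonneg_left (mul_le_mul_of_nonneg_right w1 (by positivity))
      (by positivity)).trans (le_of_eq ?_)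
    rw [p1, p3, mul_pow t]
    ring

end Summation

end IdealGas

end

/-! ### Choice of the constants and conclusion -/

open IdealGas in
theorem proposition3p2
    (μ lam κ : ℝ) (hμ : 0 < μ) (hlam : 0 < 2 * μ + lam) (hκ : 0 < κ)
    (φ₀ : 𝓢(R3, ℂ)) (hφ : IsLittlewoodPaley φ₀)
    (χ : R3 → ℂ) (hχ : IsModulationWindow χ) :
    ∃ C₀ c₁ c₂ ε₀ : ℝ, 0 < C₀ ∧ 0 < c₁ ∧ 0 < c₂ ∧ 0 < ε₀ ∧
      ∀ δ : ℝ, 0 < δ → δ < 1 → ∀ N : ℕ, 2 ≤ N →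
      ∀ a : ℕ → Terms, a = expansion μ lam κ (initialVelocity φ₀ δ N) →
      ∀ t : ℝ, 0 < t → t ≤ ε₀ / 2 ^ (2 * N) →
        -- all norms below are norms of Schwartz functions
        (∀ k : ℕ, IsRegularAt (a k).P t ∧ IsRegularAt (a k).U t ∧ IsRegularAt (a k).Th t) ∧
        -- the geometric bound
        (∀ k : ℕ, 1 ≤ k → termSize χ N t (a k) ≤
          ENNReal.ofReal (C₀ ^ k * t ^ (k - 1) * 2 ^ ((k - 1) * N) * amp N ^ k)) ∧
        -- convergence of the expansion, and control of the terms with `k ≥ 3`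
        ∑' k : ℕ, termSize χ N t (a k) < ⊤ ∧
        ∑' k : ℕ, termSize χ N t (a (k + 3)) ≤
          ENNReal.ofReal (2 * C₀ ^ 3 * t ^ 2 * 2 ^ (2 * N) * amp N ^ 3) ∧
        -- the refined bounds
        (∀ k : ℕ, 1 ≤ k →
          modNorm χ ((a k).P t) ≤
            ENNReal.ofReal (c₁ ^ (k - 1) * c₂ ^ k * t ^ k * 2 ^ (k * N) * amp N ^ k
              / (1 + k) ^ 4) ∧
          modNorm χ ((a k).U t) + modNormL1 χ t (timeDeriv (a k).U)
              + modNormL1 χ t (fun s => lame μ lam ((a k).U s)) ≤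
            ENNReal.ofReal (c₁ ^ (k - 1) * c₂ ^ max (k - 1) 1 * t ^ (k - 1)
              * 2 ^ ((k - 1) * N) * amp N ^ k / (1 + k) ^ 4) ∧
          modNorm χ ((a k).Th t) + modNormL1 χ t (timeDeriv (a k).Th)
              + modNormL1 χ t (fun s x => (κ : ℂ) * Laplacian.laplacian ((a k).Th s) x) ≤
            ENNReal.ofReal (c₁ ^ (k - 1) * c₂ ^ k * t ^ (k - 1) * 2 ^ (k * N) * amp N ^ k
              / (1 + k) ^ 4)) := by
  obtain ⟨K, hK, hKμ, hKl, hKh, hKL, hKd⟩ :=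
    exists_common_bound (μ := μ) (lam := lam) (κ := κ) φ₀ hχ
  have hK0 := hK.nonneg
  have hK1 := hK.one_le
  have hK8 : (1 : ℝ) ≤ K ^ 8 := one_le_pow₀ hK1
  have hK3 : (1 : ℝ) ≤ K ^ 3 := one_le_pow₀ hK1
  -- The smallness of `q` is what closes the induction.
  obtain ⟨q, hq⟩ : ∃ q : ℝ, q = (44448 * K ^ 8)⁻¹ := ⟨_, rfl⟩
  have hqpos : 0 < q := by rw [hq]; positivity
  have hqK : 44448 * K ^ 8 * q = 1 := by rw [hq]; exact mul_inv_cancel₀ (by positivity)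
  have hq1 : q ≤ 1 := by rw [hq]; exact inv_le_one_of_one_le₀ (by linarith)
  -- The data has size at most `m = K R`, so the first term requires `3 K² m = 3 K³ R ≤ q y`. With
  -- `y = Y R` this holds with equality.
  obtain ⟨Y, hY⟩ : ∃ Y : ℝ, Y = 3 * K ^ 3 / q := ⟨_, rfl⟩
  have hqY : q * Y = 3 * K ^ 3 := by rw [hY]; field_simp
  have hY1 : 1 ≤ Y := by
    rw [hY, le_div_iff₀ hqpos]
    linarith
  have hY0 : 0 ≤ Y := zero_le_one.trans hY1
  -- The `3` counts the parts of `termSize`, and the `16` pays for `(1+k)⁴`. The time constant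
  -- serves twice: it gives `t Λ² ≤ 1` and makes the series geometric.
  refine ⟨3 * Y, 16 * Y, 16 * Y, (3 * Y)⁻¹, by positivity, by positivity, by positivity,
    by positivity, ?_⟩
  intro δ hδ0 hδ1 N hN a ha t ht htT
  have hR := amp_nonneg N
  have hpow : (2 : ℝ) ^ (2 * N) = (2 ^ N) ^ 2 := by rw [mul_comm, pow_mul]
  have hΛ4 : (4 : ℝ) ≤ 2 ^ N := by
    calc (4 : ℝ) = 2 ^ 2 := by norm_num
      _ ≤ 2 ^ N := pow_le_pow_right₀ (by norm_num) hN
  have hshort : (3 * Y)⁻¹ / 2 ^ (2 * N) * (2 ^ N) ^ 2 ≤ 1 := by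
    rw [hpow, div_mul_cancel₀ _ (by positivity)]
    exact inv_le_one_of_one_le₀ (by linarith)
  have hA : IsAdmissible χ μ lam κ K (2 ^ N) ((3 * Y)⁻¹ / 2 ^ (2 * N)) q (Y * amp N) :=
    ⟨hχ, hK, hKμ, hKl, hκ, lt_min hμ hlam, hKh, hKL, by linarith, by positivity, hshort,
      hqpos.le, hq1, mul_nonneg hY0 hR⟩
  have hdata : modNorm χ (initialVelocity φ₀ δ N) ≤ ENNReal.ofReal (K * amp N) := by
    rw [ENNReal.ofReal_mul hK0]
    exact (modNorm_initialVelocity_le hχ hφ hδ1 hN).trans (mul_le_mul' hKd le_rfl)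
  have hc : ∀ k, IsControlled χ μ lam κ (2 ^ N) ((3 * Y)⁻¹ / 2 ^ (2 * N)) q (Y * amp N) k (a k) := by
    intro k
    rw [ha]
    refine hA.isControlled_expansion hqK.le (isBand_initialVelocity hφ δ hN)
      (mul_nonneg hK0 hR) hdata (le_of_eq ?_) k
    rw [← mul_assoc q, hqY]
    ring
  have hsize : ∀ k, 1 ≤ k → termSize χ N t (a k) ≤
      ENNReal.ofReal ((3 * Y) ^ k * amp N ^ k * (t * 2 ^ N) ^ (k - 1)) := fun k hk =>
    (hc k).termSize_le hqpos.le hq1 hY0 hR hk ht htT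
  have hσ : t * 2 ^ N ≤ (3 * Y)⁻¹ / 4 := by
    calc t * 2 ^ N ≤ (3 * Y)⁻¹ / 2 ^ (2 * N) * 2 ^ N := by gcongr
      _ = (3 * Y)⁻¹ / 2 ^ N := by rw [hpow]; field_simp
      _ ≤ _ := by gcongr
  -- From `Λ ≥ 4` and `R ≤ 2` the ratio is at most `2/4`, whence the factor two in the bound of the
  -- tail.
  have hratio : 3 * Y * amp N * (t * 2 ^ N) ≤ 1 / 2 := by
    calc 3 * Y * amp N * (t * 2 ^ N) ≤ 3 * Y * 2 * ((3 * Y)⁻¹ / 4) := by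
          gcongr
          exact amp_le_two hN
      _ = 1 / 2 := by field_simp; norm_num
  have htail : ∑' k : ℕ, termSize χ N t (a (k + 3)) ≤
      ENNReal.ofReal (2 * (3 * Y) ^ 3 * t ^ 2 * 2 ^ (2 * N) * amp N ^ 3) := by
    refine (tsum_geometric_le (M := (3 * Y) ^ 3 * amp N ^ 3 * (t * 2 ^ N) ^ 2)
      (x := 3 * Y * amp N * (t * 2 ^ N)) (by positivity) (by positivity) hratio fun k => ?_).trans
        (ENNReal.ofReal_le_ofReal (le_of_eq ?_))
    · refine (hsize (k + 3) (by omega)).trans (ENNReal.ofReal_le_ofReal (le_of_eq ?_))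
      rw [show k + 3 - 1 = k + 2 from rfl]
      ring
    · rw [hpow]
      ring
  refine ⟨fun k => (hc k).isRegularAt t, fun k hk => (hsize k hk).trans (le_of_eq ?_), ?_, htail,
    fun k hk => (hc k).refined hqpos.le hq1 hY1 hR hk ht htT⟩
  · congr 1
    rw [mul_pow t, mul_comm (k - 1) N, pow_mul]
    ring
  -- The three terms of lowest index are finite one by one, that of index zero being zero; the rest
  -- is the tail already bounded.
  · rw [← ENNReal.summable.sum_add_tsum_nat_add' (k := 3)]
    refine ENNReal.add_lt_top.2 ⟨ENNReal.sum_lt_top.2 fun k _ => ?_,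
      htail.trans_lt ENNReal.ofReal_lt_top⟩
    rcases Nat.eq_zero_or_pos k with rfl | hk
    · rw [ha, expansion]
      simp [termSize, IsBand.modNorm_zero]
    · exact (hsize k hk).trans_lt ENNReal.ofReal_lt_top
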